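/- **Setting.** For a real $d\times d$ matrix $A$ let $\lambda_A$ be the largest real part of its (complex) eigenvalues and $S_A=\{v\in\Delta^d: vA=\lambda_A v\}$, where $\Delta^d=\{v\in\mathbb R^d: v_k\ge 0,\ \sum_k v_k=1\}$ (row vectors). Let $\|\cdot\|$ denote fixed norms on $\mathbb R^d$ and on matrices (which ones is immaterial), $\mathrm{dist}(x,S)=\inf_{y\in S}\|x-y\|$, $y^+=(\max(y_k,0))_k$, $\alpha(y)=\sum_k y_k$, and fix $p\in\Delta^d$; $0/0$ is read as $p$ in $y^+/\alpha(y^+)$. A maximum over an empty range is $0$. A generalized Friedman urn with $d$ types starts from a random $Y_0$ with values in $\mathbb R_+^d\setminus\{0\}$ almost surely (for instance deterministic). At stage $m\ge 1$ a type is drawn; $X_m$ is the corresponding unit row vector, $D_m$ is a random $d\times d$ matrix with integrable entries (of any sign), $Y_m=Y_{m-1}+X_mD_m$ and $$P(X_{m,k}=1\mid\mathcal F_{m-1})=\frac{Y_{m-1,k}^+}{\alpha(Y_{m-1}^+)},\qquad k=1,\dots,d,$$ where $\mathcal F_m$ is generated by $Y_0,\dots,Y_m$, $X_1,\dots,X_m$,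 $D_1,\dots,D_m$. Put $N_n=\sum_{m=1}^nX_m$, $H_n=E[D_n\mid\mathcal F_{n-1}]$ and $M_{n,2}=\sum_{m=1}^nX_m(D_m-H_m)$. **Theorem 3.5.** (i) Suppose that there is a random matrix $H$ such that, with probability one, $H_{q,k}\ge 0$ for $q\ne k$, $H$ has a right eigenvector for $\lambda_H$ with strictly positive entries, and $\lambda_H>0$. Suppose that $$\sum_{m=1}^n\|H_m-H\|=o(n)\ \text{ in probability}\tag{1}$$ and $$\max_{m\le n}\|M_{m,2}\|=o(n)\ \text{ in probability.}\tag{2}$$ Then $S_H\neq\emptyset$ almost surely and, for every real $T>0$, as $n\to\infty$, $$\max_{n\le m\le nT}\mathrm{dist}\Big(\frac{Y_m}{m},\lambda_HS_H\Big),\quad \max_{n\le m\le nT}\mathrm{dist}\Big(\frac{Y_m^+}{m},\lambda_HS_H\Big),\quad \max_{n\le m\le nT}\mathrm{dist}\Big(\frac{Y_m^+}{\alpha(Y_m^+)},S_H\Big),\quad \max_{n\le m\le nT}\mathrm{dist}\Big(\frac{N_m}{m},S_H\Big)$$ all tend to $0$ in probability. If, moreover, $H$ is almost surely irreducible (no simultaneous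 permutation of rows and columns gives $\begin{pmatrix}A_{11}&A_{12}\\0&A_{22}\end{pmatrix}$ with nonempty square diagonal blocks), then there is a random vector $v$ with $S_H=\{v\}$ almost surely, and, in probability, $$\frac{Y_n}{n}\to\lambda_Hv,\qquad \frac{Y_n^+}{n}\to\lambda_Hv,\qquad \frac{Y_n^+}{\alpha(Y_n^+)}\to v,\qquad \frac{N_n}{n}\to v .$$ (ii) Suppose that, for every $m\ge1$, $X_m$ and $D_m$ are conditionally independent given $\mathcal F_{m-1}$. Then (2) holds if $$\sum_{m=1}^nE\big[\|D_m\|\,\big|\,\mathcal F_{m-1}\big]=O(n)\ \text{ in probability}\tag{3}$$ and, for every $\epsilon>0$, $$\sum_{m=1}^nE\big[\|D_m\|\mathbf 1\{\|D_m\|\ge\epsilon n\}\,\big|\,\mathcal F_{m-1}\big]=o(n)\ \text{ in probability.}\tag{4}$$ (iii) If $\{D_n\}_{n\ge1}$ is uniformly integrable, then (3) and (4) hold. (iv) If there is a constant $c_0$ with $D_{q,k}(n)\ge -c_0$ almost surely for all $q,k$ and $n\ge 1$, and (1) holds for some random matrix $H$, then (3) holds. -/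

import Mathlib

open MeasureTheory Filter

namespace FriedmanUrn

noncomputable section

/-! Vectors are row vectors in `Fin d → ℝ`, with the maximum norm; matrices are measured by the sum
of the absolute values of their entries. All norms on these finite-dimensional spaces are
equivalent, and every notion below that involves a norm is unchanged by passing to an equivalent
one. -/

/-! ### Linear algebra -/

/-- `λ_A`, the largest real part of the complex eigenvalues of the real matrix `A`. -/
def lam {d : ℕ} (A : Matrix (Fin d) (Fin d) ℝ) : ℝ :=
  sSup (Complex.re '' spectrum ℂ (A.map (fun x : ℝ => (x : ℂ))))

/-- `S_A`, the set of left eigenvectors of `A` for `λ_A` that lie in the standard simplex. -/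
def eigenSimplex {d : ℕ} (A : Matrix (Fin d) (Fin d) ℝ) : Set (Fin d → ℝ) :=
  {v | v ∈ stdSimplex ℝ (Fin d) ∧ Matrix.vecMul v A = lam A • v}

/-- `λ_A S_A`. -/
def scaledEigenSimplex {d : ℕ} (A : Matrix (Fin d) (Fin d) ℝ) : Set (Fin d → ℝ) :=
  (fun v => lam A • v) '' eigenSimplex A

/-- Nonnegative off-diagonal entries, a strictly positive right eigenvector for `λ_A`, and
`λ_A > 0`. -/
structure Admissible {d : ℕ} (A : Matrix (Fin d) (Fin d) ℝ) : Prop where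
  offDiag_nonneg : ∀ q k, q ≠ k → 0 ≤ A q k
  exists_pos_eigenvector : ∃ u : Fin d → ℝ, (∀ k, 0 < u k) ∧ Matrix.mulVec A u = lam A • u
  lam_pos : 0 < lam A

/-- `A` is reducible if a simultaneous permutation of rows and columns brings it to the block form
`[[A₁₁, A₁₂], [0, A₂₂]]` with (nonempty) square diagonal blocks, of sizes `r` and `d - r`. -/
def Reducible {d : ℕ} (A : Matrix (Fin d) (Fin d) ℝ) : Prop :=
  ∃ (s : Equiv.Perm (Fin d)) (r : ℕ), 0 < r ∧ r < d ∧
    ∀ i j : Fin d, r ≤ (i : ℕ) → (j : ℕ) < r → A.submatrix s s i j = 0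

/-- A norm on matrices: the sum of the absolute values of the entries. -/
def matNorm {d : ℕ} (A : Matrix (Fin d) (Fin d) ℝ) : ℝ := ∑ q, ∑ k, |A q k|

/-! ### The urn -/

/-- The componentwise positive part `y⁺`. -/
def pos {d : ℕ} (y : Fin d → ℝ) : Fin d → ℝ := fun k => max (y k) 0

/-- `y⁺ / ∑ⱼ yⱼ⁺`, where `0 / 0` is defined to be the fixed probability vector `p`. -/
def proportion {d : ℕ} (p y : Fin d → ℝ) : Fin d → ℝ :=
  if ∑ j, pos y j = 0 then p else (∑ j, pos y j)⁻¹ • pos y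

/-- `X_m`, the unit row vector of the type `J m` drawn at stage `m`. -/
def draw {d : ℕ} {Ω : Type*} (J : ℕ → Ω → Fin d) (m : ℕ) (ω : Ω) : Fin d → ℝ :=
  Pi.single (J m ω) 1

/-- The urn composition: `Y_m = Y_{m-1} + X_m D_m`, starting from `Y₀`. -/
def urn {d : ℕ} {Ω : Type*} (Y₀ : Ω → Fin d → ℝ) (J : ℕ → Ω → Fin d)
    (D : ℕ → Ω → Matrix (Fin d) (Fin d) ℝ) : ℕ → Ω → Fin d → ℝ
  | 0, ω => Y₀ ω
  | m + 1, ω => urn Y₀ J D m ω + Matrix.vecMul (draw J (m + 1) ω) (D (m + 1) ω)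

/-- `N_n = X_1 + ⋯ + X_n`: the numbers of draws of each type in the first `n` stages. -/
def counts {d : ℕ} {Ω : Type*} (J : ℕ → Ω → Fin d) (n : ℕ) (ω : Ω) : Fin d → ℝ :=
  ∑ m ∈ Finset.Icc 1 n, draw J m ω

/-- The history `ℱ_n`, generated by `Y_0, …, Y_n`, `X_1, …, X_n` and `D_1, …, D_n`. -/
@[reducible] def history {d : ℕ} {Ω : Type*} (Y₀ : Ω → Fin d → ℝ) (J : ℕ → Ω → Fin d)
    (D : ℕ → Ω → Matrix (Fin d) (Fin d) ℝ) (n : ℕ) : MeasurableSpace Ω :=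
  (⨆ m ∈ Finset.Icc 0 n, MeasurableSpace.comap (urn Y₀ J D m) inferInstance) ⊔
    ((⨆ m ∈ Finset.Icc 1 n, MeasurableSpace.comap (draw J m) inferInstance) ⊔
      (⨆ m ∈ Finset.Icc 1 n,
        MeasurableSpace.comap (fun ω (q k : Fin d) => D m ω q k) inferInstance))

/-- `(Y₀, J, D)` drives a generalized Friedman urn: given the past, type `k` is drawn at stage `m`
with conditional probability `Y_{m-1,k}⁺ / ∑ⱼ Y_{m-1,j}⁺`. The values `J 0` and `D 0` are not
used. The entries of the replacement matrices are integrable, so that their conditional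
expectations make sense. -/
structure IsUrn {d : ℕ} {Ω : Type*} [MeasurableSpace Ω] (μ : Measure Ω) (p : Fin d → ℝ)
    (Y₀ : Ω → Fin d → ℝ) (J : ℕ → Ω → Fin d)
    (D : ℕ → Ω → Matrix (Fin d) (Fin d) ℝ) : Prop where
  prob : p ∈ stdSimplex ℝ (Fin d)
  measurable_init : Measurable Y₀
  init_nonneg : ∀ᵐ ω ∂μ, (∀ k, 0 ≤ Y₀ ω k) ∧ Y₀ ω ≠ 0
  measurable_type : ∀ m, 1 ≤ m → Measurable (J m)
  measurable_entry : ∀ m, 1 ≤ m → ∀ q k, Measurable (fun ω => D m ω q k)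
  integrable_entry : ∀ m, 1 ≤ m → ∀ q k, Integrable (fun ω => D m ω q k) μ
  selection : ∀ m, 1 ≤ m → ∀ k,
    μ[fun ω => draw J m ω k | history Y₀ J D (m - 1)] =ᵐ[μ]
      fun ω => proportion p (urn Y₀ J D (m - 1) ω) k

/-- For every `m ≥ 1`, the draw `X_m` and the matrix `D_m` are conditionally independent given
`ℱ_{m-1}`. -/
def CondIndepDraws {d : ℕ} {Ω : Type*} [MeasurableSpace Ω] (μ : Measure Ω)
    (Y₀ : Ω → Fin d → ℝ) (J : ℕ → Ω → Fin d)
    (D : ℕ → Ω → Matrix (Fin d) (Fin d) ℝ) : Prop :=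
  ∀ m, 1 ≤ m → ∀ (k : Fin d) (B : Set (Fin d → Fin d → ℝ)), MeasurableSet B →
    μ[({ω | J m ω = k} ∩ {ω | (fun q l => D m ω q l) ∈ B}).indicator (fun _ => (1 : ℝ)) |
        history Y₀ J D (m - 1)] =ᵐ[μ]
      μ[{ω | J m ω = k}.indicator (fun _ => (1 : ℝ)) | history Y₀ J D (m - 1)] *
        μ[{ω | (fun q l => D m ω q l) ∈ B}.indicator (fun _ => (1 : ℝ)) |
          history Y₀ J D (m - 1)]

/-- `H_n = E[D_n | ℱ_{n-1}]` (for `n ≥ 1`). -/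
def condMean {d : ℕ} {Ω : Type*} [MeasurableSpace Ω] (μ : Measure Ω) (Y₀ : Ω → Fin d → ℝ)
    (J : ℕ → Ω → Fin d) (D : ℕ → Ω → Matrix (Fin d) (Fin d) ℝ) (n : ℕ) (ω : Ω) :
    Matrix (Fin d) (Fin d) ℝ :=
  Matrix.of fun q k => (μ[fun ω' => D n ω' q k | history Y₀ J D (n - 1)]) ω

/-- `M_{n,2} = ∑_{m=1}^n X_m (D_m - E[D_m | ℱ_{m-1}])`. -/
def martSum {d : ℕ} {Ω : Type*} [MeasurableSpace Ω] (μ : Measure Ω) (Y₀ : Ω → Fin d → ℝ)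
    (J : ℕ → Ω → Fin d) (D : ℕ → Ω → Matrix (Fin d) (Fin d) ℝ) (n : ℕ) (ω : Ω) :
    Fin d → ℝ :=
  ∑ m ∈ Finset.Icc 1 n, Matrix.vecMul (draw J m ω) (D m ω - condMean μ Y₀ J D m ω)

/-! ### Convergence in probability -/

/-- `Z_n = o(n)` in probability. -/
def LittleOInProb {Ω : Type*} [MeasurableSpace Ω] (μ : Measure Ω) (Z : ℕ → Ω → ℝ) : Prop :=
  TendstoInMeasure μ (fun n ω => Z n ω / (n : ℝ)) atTop (fun _ => (0 : ℝ))

/-- `Z_n = O(n)` in probability, that is, `Z_n / n` is bounded in probability. -/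
def BigOInProb {Ω : Type*} [MeasurableSpace Ω] (μ : Measure Ω) (Z : ℕ → Ω → ℝ) : Prop :=
  ∀ ε : ENNReal, 0 < ε → ∃ C : ℝ, ∀ᶠ n : ℕ in atTop, μ {ω | C * (n : ℝ) < |Z n ω|} ≤ ε

/-- `max_{n ≤ m ≤ nT} dist (x_m, S) → 0` in probability, for a random sequence `x` and a random
set `S`. The maximum over an empty range is `0`. -/
def WindowDistTendsto {d : ℕ} {Ω : Type*} [MeasurableSpace Ω] (μ : Measure Ω) (T : ℝ)
    (x : ℕ → Ω → Fin d → ℝ) (S : Ω → Set (Fin d → ℝ)) : Prop :=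
  TendstoInMeasure μ
    (fun (n : ℕ) ω =>
      (Finset.Icc n ⌊(n : ℝ) * T⌋₊).sup (fun m => Metric.infNndist (x m ω) (S ω)))
    atTop (fun _ => (0 : NNReal))

/-- `∑_{m=1}^n ‖H_m - H‖ = o(n)` in probability. -/
def MeanCondition {d : ℕ} {Ω : Type*} [MeasurableSpace Ω] (μ : Measure Ω) (Y₀ : Ω → Fin d → ℝ)
    (J : ℕ → Ω → Fin d) (D : ℕ → Ω → Matrix (Fin d) (Fin d) ℝ)
    (H : Ω → Matrix (Fin d) (Fin d) ℝ) : Prop :=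
  LittleOInProb μ
    (fun n ω => ∑ m ∈ Finset.Icc 1 n, matNorm (condMean μ Y₀ J D m ω - H ω))

/-- `max_{m ≤ n} ‖M_{m,2}‖ = o(n)` in probability. -/
def MartingaleCondition {d : ℕ} {Ω : Type*} [MeasurableSpace Ω] (μ : Measure Ω)
    (Y₀ : Ω → Fin d → ℝ) (J : ℕ → Ω → Fin d)
    (D : ℕ → Ω → Matrix (Fin d) (Fin d) ℝ) : Prop :=
  LittleOInProb μ
    (fun n ω => (((Finset.Icc 1 n).sup (fun m => ‖martSum μ Y₀ J D m ω‖₊) : NNReal) : ℝ))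

/-- `∑_{m=1}^n E[‖D_m‖ | ℱ_{m-1}] = O(n)` in probability. -/
def MomentCondition {d : ℕ} {Ω : Type*} [MeasurableSpace Ω] (μ : Measure Ω)
    (Y₀ : Ω → Fin d → ℝ) (J : ℕ → Ω → Fin d)
    (D : ℕ → Ω → Matrix (Fin d) (Fin d) ℝ) : Prop :=
  BigOInProb μ (fun n ω =>
    ∑ m ∈ Finset.Icc 1 n, (μ[fun ω' => matNorm (D m ω') | history Y₀ J D (m - 1)]) ω)

/-- `∑_{m=1}^n E[‖D_m‖ 1{‖D_m‖ ≥ ε n} | ℱ_{m-1}] = o(n)` in probability, for every `ε > 0`. -/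
def TailCondition {d : ℕ} {Ω : Type*} [MeasurableSpace Ω] (μ : Measure Ω)
    (Y₀ : Ω → Fin d → ℝ) (J : ℕ → Ω → Fin d)
    (D : ℕ → Ω → Matrix (Fin d) (Fin d) ℝ) : Prop :=
  ∀ ε : ℝ, 0 < ε → LittleOInProb μ (fun n ω =>
    ∑ m ∈ Finset.Icc 1 n,
      (μ[{ω' | ε * (n : ℝ) ≤ matNorm (D m ω')}.indicator (fun ω' => matNorm (D m ω')) |
        history Y₀ J D (m - 1)]) ω)

end

end FriedmanUrn

/-! Let `z_m` be the sum of the first `m` selection probabilities. The differences `N_m - z_m` form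
a martingale with bounded increments, so Kolmogorov's inequality makes them `o(n)` uniformly.
Splitting `Y_m = Y_0 + M_{m,2} + ∑ X_j (H_j - H) + N_m H` and using (1) and (2) gives `Y_m = z_m H +
o(n)` uniformly over `m ≤ K n`. Everything after that is deterministic (`exists_forall_trajectory`).

Fix a trajectory `y` with `y_m ≈ z_m A`. While the total `α_j = ∑ y_j⁺` is positive, `z_{j+1} = z_j
+ α_j⁻¹ (z_j A + e_j)` with `e_j = y_j⁺ - z_j A`: an Euler scheme for `z' = z A` in the clock `∑ 1 /
α_j`. Pairing with the right eigenvector `u > 0` shows that `α_j` grows linearly (`le_sum_pos`).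
Nonnegativity off the diagonal keeps negative parts small, since coordinate `k` of `z A` can
decrease only while `y_k > 0` (`neg_le_vecMul_cumProportion`). Hence `e_j` is small, the clock
advances by a multiple of `log D` between `n / D` and `n`, and `z_m ≈ z_{n/D} exp(τ A)` with `τ` as
large as desired (`exists_norm_sub_mul_exp_le`).

Conjugation by `diag u` turns `A` into `λ + r (P - 1)` with `P` stochastic (`exists_stochastic`).
The bound `‖exp(tP)(P - 1)‖ ≤ e^t / √t`, valid for every contraction `P`, shows that `z_m (A - λ)`
is of relative size `O(1 / √τ)`; neither irreducibility nor Jordan forms enter. So `z_m / m` is an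
approximate left eigenvector in the simplex, and compactness puts it near `S_A`. The same argument
for a noise-free trajectory gives `S_A ≠ ∅`. In the irreducible case the vectors of `S_A` are
strictly positive, which forces uniqueness.

The thresholds in the deterministic statement depend on `H(ω)`; the return to convergence in
probability goes through almost surely convergent subsequences. For (ii), the matrices are truncated
at `ε n`. The truncated sums are martingales with small second moment once the compensator is cut
off at `C n`, and the remainders are controlled by Lenglart's inequality. Parts (iii) and (iv)
follow from Markov's inequality and from `|x| ≤ x + 2|c₀|` for `x ≥ -c₀`. -/

namespace FriedmanUrn

/-! ### Exponentials in Banach algebras and the decay of `exp(tP)(P - 1)`. -/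

section BanachAlgebra

open NormedSpace

variable {𝔸 : Type*} [NormedRing 𝔸] [NormedAlgebra ℝ 𝔸]

theorem exp_smul_one (t : ℝ) : exp (t • (1 : 𝔸)) = Real.exp t • 1 := by
  rw [← Algebra.algebraMap_eq_smul_one, ← algebraMap_exp_comm, Real.exp_eq_exp_ℝ,
    Algebra.algebraMap_eq_smul_one]

variable [CompleteSpace 𝔸]

theorem hasSum_exp_smul (t : ℝ) (x : 𝔸) :
    HasSum (fun n : ℕ => (t ^ n / (n.factorial : ℝ)) • x ^ n) (exp (t • x)) := by
  have h := exp_series_hasSum_exp' (𝕂 := ℝ) (t • x)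
  refine h.congr_fun (fun n => ?_)
  rw [smul_pow, smul_smul, div_eq_inv_mul]

theorem hasSum_real_exp (t : ℝ) :
    HasSum (fun n : ℕ => t ^ n / (n.factorial : ℝ)) (Real.exp t) := by
  rw [Real.exp_eq_exp_ℝ]
  exact expSeries_div_hasSum_exp t

/-- Together with the version for `n ^ 2`, these are the first two Poisson moments, multiplied by
`e^t`. -/
theorem hasSum_mul_real_exp (t : ℝ) :
    HasSum (fun n : ℕ => (n : ℝ) * (t ^ n / (n.factorial : ℝ))) (t * Real.exp t) := by
  rw [← hasSum_nat_add_iff' 1]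
  simp only [Finset.range_one, Finset.sum_singleton, Nat.cast_zero, zero_mul, sub_zero]
  refine ((hasSum_real_exp t).mul_left t).congr_fun (fun n => ?_)
  rw [Nat.factorial_succ]
  push_cast
  have : (n.factorial : ℝ) ≠ 0 := by positivity
  field_simp
  ring

theorem hasSum_sq_mul_real_exp (t : ℝ) :
    HasSum (fun n : ℕ => (n : ℝ) ^ 2 * (t ^ n / (n.factorial : ℝ)))
      (t * (t * Real.exp t + Real.exp t)) := by
  rw [← hasSum_nat_add_iff' 1]
  simp only [Finset.range_one, Finset.sum_singleton, Nat.cast_zero, zero_pow two_ne_zero,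
    zero_mul, sub_zero]
  refine (((hasSum_mul_real_exp t).add (hasSum_real_exp t)).mul_left t).congr_fun
    (fun n => ?_)
  rw [Nat.factorial_succ]
  push_cast
  have : (n.factorial : ℝ) ≠ 0 := by positivity
  field_simp
  ring

/-- The coefficient of `P ^ n` in `exp(tP)(P - 1)` is `(n / t - 1) t ^ n / n!`, and `‖P ^ n‖ ≤ 1`.
So the norm is at most `e^t E|N / t - 1|` with `N` Poisson of mean and variance `t`, and `E|N / t -
1| ≤ 1 / √t`. -/
theorem norm_exp_smul_mul_sub_one_le [NormOneClass 𝔸] {P : 𝔸} (hP : ‖P‖ ≤ 1) {t : ℝ} (ht : 0 < t) :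
    ‖exp (t • P) * (P - 1)‖ ≤ Real.exp t / √t := by
  set c : ℕ → ℝ := fun n => t ^ n / (n.factorial : ℝ) with hc
  have hc0 : ∀ n, 0 ≤ c n := fun n => by positivity
  have h1 : HasSum (fun n : ℕ => (c n) • P ^ n) (exp (t • P)) := hasSum_exp_smul t P
  have h2 : HasSum (fun n : ℕ => ((n / t) * c n) • P ^ n) (exp (t • P) * P) := by
    rw [← hasSum_nat_add_iff' 1]
    simp only [Finset.range_one, Finset.sum_singleton, Nat.cast_zero, zero_div, zero_mul,
      zero_smul, sub_zero]
    refine (h1.mul_right P).congr_fun (fun n => ?_)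
    rw [smul_mul_assoc, ← pow_succ]
    congr 1
    simp only [hc]
    rw [Nat.factorial_succ]
    push_cast
    have : (n.factorial : ℝ) ≠ 0 := by positivity
    field_simp
    ring
  have h3 : HasSum (fun n : ℕ => ((n / t - 1) * c n) • P ^ n) (exp (t • P) * (P - 1)) := by
    rw [mul_sub, mul_one]
    refine (h2.sub h1).congr_fun (fun n => ?_)
    rw [← sub_smul]; congr 1; ring
  have hs : 0 < √t := Real.sqrt_pos.2 ht
  have hss : √t * √t = t := Real.mul_self_sqrt ht.le
  -- The summable majorant comes from `|x| ≤ (√t x² + 1 / √t) / 2`, which replaces the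
  -- Cauchy–Schwarz inequality for the Poisson law.
  have h4 : HasSum (fun n : ℕ => ((√t * (n / t - 1) ^ 2 + 1 / √t) / 2) * c n)
      (Real.exp t / √t) := by
    have := ((((hasSum_sq_mul_real_exp t).mul_left (√t / t ^ 2 / 2)).sub
      ((hasSum_mul_real_exp t).mul_left (√t / t))).add
      ((hasSum_real_exp t).mul_left (√t / 2 + 1 / √t / 2)))
    have e : √t / t ^ 2 / 2 * (t * (t * Real.exp t + Real.exp t)) - √t / t * (t * Real.exp t) +
        (√t / 2 + 1 / √t / 2) * Real.exp t = Real.exp t / √t := by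
      have ht2 : √t ^ 2 = t := by rw [sq, hss]
      field_simp
      rw [ht2]; ring
    rw [e] at this
    refine this.congr_fun (fun n => ?_)
    simp only [hc]
    have : (n.factorial : ℝ) ≠ 0 := by positivity
    field_simp
    ring
  rw [← h3.tsum_eq]
  refine tsum_of_norm_bounded h4 (fun n => ?_)
  rw [norm_smul, norm_mul, Real.norm_of_nonneg (hc0 n)]
  have hPn : ‖P ^ n‖ ≤ 1 := (norm_pow_le P n).trans (pow_le_one₀ (norm_nonneg _) hP)
  have hx : |(n : ℝ) / t - 1| ≤ (√t * (n / t - 1) ^ 2 + 1 / √t) / 2 := by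
    have := sq_nonneg (√t * |(n : ℝ) / t - 1| - 1)
    rw [sub_sq, mul_pow, sq_abs, sq (√t)] at this
    rw [← sub_nonneg]
    have e : (√t * ((n : ℝ) / t - 1) ^ 2 + 1 / √t) / 2 - |(n : ℝ) / t - 1| =
      (√t * √t * ((n : ℝ) / t - 1) ^ 2 - 2 * (√t * |(n : ℝ) / t - 1|) * 1 + 1 ^ 2) / (2 * √t) := by
      field_simp
      ring
    rw [e]; positivity
  calc ‖(n : ℝ) / t - 1‖ * c n * ‖P ^ n‖ ≤ ‖(n : ℝ) / t - 1‖ * c n * 1 := by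
        gcongr
    _ ≤ _ := by
        rw [mul_one]
        exact mul_le_mul_of_nonneg_right hx (hc0 n)

theorem norm_exp_smul_sub_one_sub_le [NormOneClass 𝔸] {s : ℝ} (hs : 0 ≤ s) (x : 𝔸) (h : s * ‖x‖ ≤ 1) :
    ‖exp (s • x) - 1 - s • x‖ ≤ (s * ‖x‖) ^ 2 := by
  have h1 := (hasSum_nat_add_iff' 2).2 (hasSum_exp_smul s x)
  have h2 := (hasSum_nat_add_iff' 2).2 (hasSum_real_exp (s * ‖x‖))
  simp only [Finset.sum_range_succ, Finset.range_zero, Finset.sum_empty, pow_zero, pow_one,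
    Nat.factorial_zero, Nat.factorial_one, Nat.cast_one, div_one, one_smul, zero_add] at h1 h2
  have h3 := tsum_of_norm_bounded (f := fun n : ℕ => (s ^ (n + 2) / ((n + 2).factorial : ℝ)) •
    x ^ (n + 2)) h2 (fun n => ?_)
  · rw [h1.tsum_eq] at h3
    rw [sub_sub]
    refine h3.trans ?_
    have h4 := Real.abs_exp_sub_one_sub_id_le (x := s * ‖x‖) (by rwa [abs_of_nonneg (by positivity)])
    have := le_abs_self (Real.exp (s * ‖x‖) - 1 - s * ‖x‖)
    linarith
  · rw [norm_smul, Real.norm_of_nonneg (by positivity), mul_pow, mul_div_right_comm]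
    gcongr
    exact norm_pow_le _ _

theorem norm_exp_smul_le [NormOneClass 𝔸] {s : ℝ} (hs : 0 ≤ s) (x : 𝔸) :
    ‖exp (s • x)‖ ≤ Real.exp (s * ‖x‖) := by
  rw [← (hasSum_exp_smul s x).tsum_eq]
  refine tsum_of_norm_bounded (hasSum_real_exp (s * ‖x‖)) (fun n => ?_)
  rw [norm_smul, Real.norm_of_nonneg (by positivity), mul_pow, mul_div_right_comm]
  gcongr
  exact norm_pow_le _ _

theorem exp_smul_shift (P : 𝔸) (l r t : ℝ) :
    exp (t • (l • 1 + r • (P - 1) : 𝔸)) =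
      Real.exp (t * l - t * r) • exp ((t * r) • P) := by
  let _ : NormedAlgebra ℚ 𝔸 := NormedAlgebra.restrictScalars ℚ ℝ 𝔸
  have e : t • (l • 1 + r • (P - 1) : 𝔸) =
      algebraMap ℝ 𝔸 (t * l - t * r) + (t * r) • P := by
    rw [Algebra.algebraMap_eq_smul_one]
    module
  rw [e, exp_add_of_commute (Algebra.commutes _ _), ← algebraMap_exp_comm, Real.exp_eq_exp_ℝ,
    Algebra.algebraMap_eq_smul_one, smul_mul_assoc, one_mul]

theorem mul_exp_of_semiconjBy {x a b : 𝔸} (h : SemiconjBy x a b) : x * exp a = exp b * x :=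
  let _ : NormedAlgebra ℚ 𝔸 := NormedAlgebra.restrictScalars ℚ ℝ 𝔸
  h.exp_right

end BanachAlgebra

/-! ### Euler schemes for row vectors and smoothing by the semigroup. -/

section RowRecursion

open NormedSpace
open scoped Matrix.Norms.Operator

variable {n : Type*} [Fintype n]

theorem norm_row_eq (W : Matrix Unit n ℝ) : ‖W‖ = ∑ j, |W () j| := by
  have : W = Matrix.replicateRow Unit (W ()) := by ext i j; rfl
  conv_lhs => rw [this]
  rw [Matrix.linfty_opNorm_replicateRow]
  rfl

variable [DecidableEq n] [Nonempty n]

/-- A discrete Gronwall argument: replacing `1 + s B` by `exp(s B)` costs `R (σ‖B‖)²` per step, the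
perturbation costs `σ E`, and earlier errors are multiplied by at most `exp(σ‖B‖)`. In the
application `σ` has order `1 / n` while `R` and the number of steps have order `n`, so the total is
`O(1 + E)`. -/
theorem norm_sub_mul_exp_le (B : Matrix n n ℝ) (Z e : ℕ → Matrix Unit n ℝ) (s : ℕ → ℝ)
    {σ R E : ℝ} (hσ : 0 ≤ σ) (hR : 0 ≤ R) (hE : 0 ≤ E) (hσB : σ * ‖B‖ ≤ 1) {k m : ℕ}
    (hkm : k ≤ m)
    (hs : ∀ j, k ≤ j → j < m → 0 ≤ s j ∧ s j ≤ σ) (hZ : ∀ j, k ≤ j → j < m → ‖Z j‖ ≤ R)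
    (he : ∀ j, k ≤ j → j < m → ‖e j‖ ≤ E)
    (hrec : ∀ j, k ≤ j → j < m → Z (j + 1) = Z j + s j • (Z j * B + e j)) :
    ‖Z m - Z k * exp ((∑ j ∈ Finset.Ico k m, s j) • B)‖ ≤
      ((m - k : ℕ) : ℝ) * (R * (σ * ‖B‖) ^ 2 + σ * E) *
        Real.exp (σ * ‖B‖ * ((m - k : ℕ) : ℝ)) := by
  induction m, hkm using Nat.le_induction with
  | base => simp
  | succ m hkm ih =>
    have ih := ih (fun j h1 h2 => hs j h1 (by lia)) (fun j h1 h2 => hZ j h1 (by lia))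
      (fun j h1 h2 => he j h1 (by lia)) (fun j h1 h2 => hrec j h1 (by lia))
    obtain ⟨hs0, hs1⟩ := hs m hkm (by lia)
    set t := ∑ j ∈ Finset.Ico k m, s j
    rw [Finset.sum_Ico_succ_top hkm, hrec m hkm (by lia)]
    set X := R * (σ * ‖B‖) ^ 2 + σ * E with hX
    have hX0 : 0 ≤ X := by positivity
    have hexp : exp ((t + s m) • B) = exp (t • B) * exp (s m • B) := by
      rw [add_smul]
      exact Matrix.exp_add_of_commute _ _ (((Commute.refl B).smul_left _).smul_right _)
    have key : Z m + s m • (Z m * B + e m) - Z k * exp ((t + s m) • B) =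
        (Z m - Z k * exp (t • B)) * exp (s m • B) +
          (s m • e m - Z m * (exp (s m • B) - 1 - s m • B)) := by
      rw [hexp, Matrix.sub_mul, Matrix.mul_sub, Matrix.mul_sub, Matrix.mul_one, smul_add,
        Matrix.mul_smul, Matrix.mul_assoc]
      abel
    have hsB : s m * ‖B‖ ≤ σ * ‖B‖ := mul_le_mul_of_nonneg_right hs1 (norm_nonneg _)
    have h1 : ‖exp (s m • B)‖ ≤ Real.exp (σ * ‖B‖) :=
      (norm_exp_smul_le hs0 B).trans (Real.exp_le_exp.2 hsB)
    have h2 : ‖exp (s m • B) - 1 - s m • B‖ ≤ (σ * ‖B‖) ^ 2 :=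
      (norm_exp_smul_sub_one_sub_le hs0 B (hsB.trans hσB)).trans (by gcongr)
    have h3 : ‖s m • e m‖ ≤ σ * E := by
      rw [norm_smul, Real.norm_of_nonneg hs0]
      exact mul_le_mul hs1 (he m hkm (by lia)) (norm_nonneg _) hσ
    have h4 : ‖Z m * (exp (s m • B) - 1 - s m • B)‖ ≤ R * (σ * ‖B‖) ^ 2 :=
      (Matrix.linfty_opNorm_mul _ _).trans
        (mul_le_mul (hZ m hkm (by lia)) h2 (norm_nonneg _) hR)
    have hcast : ((m + 1 - k : ℕ) : ℝ) = ((m - k : ℕ) : ℝ) + 1 := by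
      rw [Nat.succ_sub hkm]; push_cast; ring
    rw [key, hcast]
    set L : ℝ := ((m - k : ℕ) : ℝ)
    have hL : 0 ≤ L := Nat.cast_nonneg _
    have h5 : ‖(Z m - Z k * exp (t • B)) * exp (s m • B)‖ ≤
        L * X * Real.exp (σ * ‖B‖ * L) * Real.exp (σ * ‖B‖) :=
      (Matrix.linfty_opNorm_mul _ _).trans (mul_le_mul ih h1 (norm_nonneg _) (by positivity))
    rw [mul_assoc, ← Real.exp_add, ← mul_add_one] at h5
    have h6 : 1 ≤ Real.exp (σ * ‖B‖ * (L + 1)) := Real.one_le_exp (by positivity)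
    calc _ ≤ L * X * Real.exp (σ * ‖B‖ * (L + 1)) + (σ * E + R * (σ * ‖B‖) ^ 2) :=
          (norm_add_le _ _).trans (add_le_add h5 ((norm_sub_le _ _).trans (add_le_add h3 h4)))
      _ = L * X * Real.exp (σ * ‖B‖ * (L + 1)) + X * 1 := by rw [hX]; ring
      _ ≤ L * X * Real.exp (σ * ‖B‖ * (L + 1)) + X * Real.exp (σ * ‖B‖ * (L + 1)) := by gcongr
      _ = _ := by ring

/-- For `Z ≥ 0` the factor `exp(τB)` multiplies the total mass by exactly `e^{τ l}`, because the
rows of `P` sum to one. The growth `e^{τ l} ‖Z‖` in the smoothing estimate is therefore absorbed by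
`‖W‖ + δ`, leaving the relative factor `r / √(τ r)`. -/
theorem norm_mul_generator_le {P : Matrix n n ℝ} (hP : ‖P‖ ≤ 1)
    (hP1 : ∀ i, ∑ j, P i j = 1) {l r τ : ℝ} (hr : 0 < r) (hτ : 0 < τ)
    {Z : Matrix Unit n ℝ} (hZ : ∀ j, 0 ≤ Z () j) (W : Matrix Unit n ℝ) {δ : ℝ}
    (hW : ‖W - Z * exp (τ • (l • 1 + r • (P - 1) : Matrix n n ℝ))‖ ≤ δ) :
    ‖W * (r • (P - 1))‖ ≤ (‖W‖ + δ) * (r / √(τ * r)) + δ * ‖r • (P - 1)‖ := by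
  set B : Matrix n n ℝ := l • 1 + r • (P - 1) with hB
  set V := Z * exp (τ • B) with hV
  -- Multiplying by the all-ones matrix takes row sums; a square matrix keeps the intertwining `B A
  -- = l A` inside one ring.
  set A : Matrix n n ℝ := Matrix.of fun _ _ => 1 with hA
  have hPA : P * A = A := by
    ext i j
    simp [Matrix.mul_apply, hA, hP1]
  have hsemi : SemiconjBy A ((τ * l) • (1 : Matrix n n ℝ)) (τ • B) := by
    rw [SemiconjBy, hB, smul_mul_assoc, add_mul, smul_mul_assoc, smul_mul_assoc, sub_mul, hPA,
      one_mul, sub_self, smul_zero, add_zero, mul_smul_comm, mul_one, smul_smul]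
  have hexp1 : exp ((τ * l) • (1 : Matrix n n ℝ)) = Real.exp (τ * l) • 1 :=
    exp_smul_one _
  have hVA : V * A = Real.exp (τ * l) • (Z * A) := by
    have : A * exp ((τ * l) • (1 : Matrix n n ℝ)) = exp (τ • B) * A :=
      mul_exp_of_semiconjBy hsemi
    rw [hexp1, mul_smul_comm, mul_one] at this
    rw [hV, Matrix.mul_assoc, ← this, Matrix.mul_smul]
  have hsum : Real.exp (τ * l) * ‖Z‖ ≤ ‖V‖ := by
    obtain ⟨i⟩ := ‹Nonempty n›
    have h := congrFun (congrFun hVA ()) i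
    simp only [Matrix.mul_apply, hA, Matrix.of_apply, mul_one, Matrix.smul_apply, smul_eq_mul] at h
    rw [norm_row_eq, norm_row_eq, Finset.sum_congr rfl (fun j _ => abs_of_nonneg (hZ j)), ← h]
    exact Finset.sum_le_sum fun j _ => le_abs_self _
  have hVW : ‖V‖ ≤ ‖W‖ + δ := by
    have := norm_sub_norm_le V W
    rw [norm_sub_rev] at this
    linarith
  have hτr : 0 < τ * r := mul_pos hτ hr
  have hVQ : ‖V * (r • (P - 1))‖ ≤ (‖W‖ + δ) * (r / √(τ * r)) := by
    have e : V * (r • (P - 1)) = (Real.exp (τ * l - τ * r) * r) •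
        (Z * (exp ((τ * r) • P) * (P - 1))) := by
      have hsh : exp (τ • B) = Real.exp (τ * l - τ * r) • exp ((τ * r) • P) :=
        exp_smul_shift P l r τ
      rw [hV, hsh, Matrix.mul_smul, Matrix.mul_smul, Matrix.smul_mul,
        Matrix.mul_assoc, smul_smul, mul_comm r]
    rw [e, norm_smul, Real.norm_of_nonneg (by positivity)]
    calc _ ≤ Real.exp (τ * l - τ * r) * r * (‖Z‖ * (Real.exp (τ * r) / √(τ * r))) := by
          gcongr
          exact (Matrix.linfty_opNorm_mul _ _).trans (by
            gcongr
            exact norm_exp_smul_mul_sub_one_le hP hτr)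
      _ = Real.exp (τ * l) * ‖Z‖ * (r / √(τ * r)) := by
          rw [Real.exp_sub]
          field_simp
      _ ≤ _ := by
          gcongr
          exact hsum.trans hVW
  calc ‖W * (r • (P - 1))‖ = ‖V * (r • (P - 1)) + (W - V) * (r • (P - 1))‖ := by
        rw [← Matrix.add_mul]; congr 2; abel
    _ ≤ _ := (norm_add_le _ _).trans (add_le_add hVQ ((Matrix.linfty_opNorm_mul _ _).trans
        (mul_le_mul_of_nonneg_right hW (norm_nonneg _))))

end RowRecursion

/-! ### Deterministic trajectories: size of the total and of the negative parts. -/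

section Trajectory

variable {d : ℕ} {A : Matrix (Fin d) (Fin d) ℝ} {p : Fin d → ℝ} {y : ℕ → Fin d → ℝ}

/-- The sum of the first `m` selection probabilities along the trajectory `y`. -/
noncomputable def cumProportion (p : Fin d → ℝ) (y : ℕ → Fin d → ℝ) (m : ℕ) : Fin d → ℝ :=
  ∑ j ∈ Finset.range m, proportion p (y j)

theorem pos_nonneg (y : Fin d → ℝ) (k : Fin d) : 0 ≤ pos y k := le_max_right _ _

theorem le_pos (y : Fin d → ℝ) (k : Fin d) : y k ≤ pos y k := le_max_left _ _

theorem proportion_mem (hp : p ∈ stdSimplex ℝ (Fin d)) (y : Fin d → ℝ) :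
    proportion p y ∈ stdSimplex ℝ (Fin d) := by
  unfold proportion
  split_ifs with h
  · exact hp
  · have h0 : 0 ≤ ∑ j, pos y j := Finset.sum_nonneg fun j _ => pos_nonneg y j
    refine ⟨fun k => ?_, ?_⟩
    · simp only [Pi.smul_apply, smul_eq_mul]
      exact mul_nonneg (inv_nonneg.2 h0) (pos_nonneg y k)
    · simp only [Pi.smul_apply, smul_eq_mul]
      rw [← Finset.mul_sum, inv_mul_cancel₀ h]

theorem cumProportion_succ (p : Fin d → ℝ) (y : ℕ → Fin d → ℝ) (m : ℕ) :
    cumProportion p y (m + 1) = cumProportion p y m + proportion p (y m) :=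
  Finset.sum_range_succ _ _

theorem cumProportion_nonneg (hp : p ∈ stdSimplex ℝ (Fin d)) (m : ℕ) (k : Fin d) :
    0 ≤ cumProportion p y m k := by
  rw [cumProportion, Finset.sum_apply]
  exact Finset.sum_nonneg fun j _ => (proportion_mem hp (y j)).1 k

theorem sum_cumProportion (hp : p ∈ stdSimplex ℝ (Fin d)) (m : ℕ) :
    ∑ k, cumProportion p y m k = m := by
  simp only [cumProportion, Finset.sum_apply]
  rw [Finset.sum_comm, Finset.sum_congr rfl fun j _ => (proportion_mem hp (y j)).2]
  simp

theorem matNorm_nonneg (A : Matrix (Fin d) (Fin d) ℝ) : 0 ≤ matNorm A :=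
  Finset.sum_nonneg fun _ _ => Finset.sum_nonneg fun _ _ => abs_nonneg _

theorem abs_le_matNorm (A : Matrix (Fin d) (Fin d) ℝ) (q k : Fin d) : |A q k| ≤ matNorm A :=
  (Finset.single_le_sum (f := fun k => |A q k|) (fun _ _ => abs_nonneg _) (Finset.mem_univ k)).trans
    (Finset.single_le_sum (f := fun q => ∑ k, |A q k|)
      (fun _ _ => Finset.sum_nonneg fun _ _ => abs_nonneg _) (Finset.mem_univ q))

theorem sum_abs_vecMul_le (A : Matrix (Fin d) (Fin d) ℝ) (z : Fin d → ℝ) :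
    ∑ k, |Matrix.vecMul z A k| ≤ (∑ q, |z q|) * matNorm A := by
  calc ∑ k, |Matrix.vecMul z A k| ≤ ∑ k, ∑ q, |z q| * |A q k| := by
        refine Finset.sum_le_sum fun k _ => ?_
        simp only [Matrix.vecMul, dotProduct]
        refine (Finset.abs_sum_le_sum_abs _ _).trans (le_of_eq ?_)
        simp only [abs_mul]
    _ = ∑ q, |z q| * ∑ k, |A q k| := by
        rw [Finset.sum_comm]; simp only [Finset.mul_sum]
    _ ≤ ∑ q, |z q| * matNorm A := by
        refine Finset.sum_le_sum fun q _ => mul_le_mul_of_nonneg_left ?_ (abs_nonneg _)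
        exact Finset.single_le_sum (f := fun q => ∑ k, |A q k|)
          (fun _ _ => Finset.sum_nonneg fun _ _ => abs_nonneg _) (Finset.mem_univ q)
    _ = _ := by rw [Finset.sum_mul]

theorem abs_vecMul_le (A : Matrix (Fin d) (Fin d) ℝ) (z : Fin d → ℝ) (k : Fin d) :
    |Matrix.vecMul z A k| ≤ (∑ q, |z q|) * matNorm A :=
  (Finset.single_le_sum (f := fun k => |Matrix.vecMul z A k|) (fun _ _ => abs_nonneg _)
    (Finset.mem_univ k)).trans (sum_abs_vecMul_le A z)

theorem sum_abs_cumProportion (hp : p ∈ stdSimplex ℝ (Fin d)) (m : ℕ) :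
    ∑ k, |cumProportion p y m k| = m := by
  rw [Finset.sum_congr rfl fun k _ => abs_of_nonneg (cumProportion_nonneg hp m k),
    sum_cumProportion hp]

theorem sum_abs_proportion (hp : p ∈ stdSimplex ℝ (Fin d)) (y : Fin d → ℝ) :
    ∑ k, |proportion p y k| = 1 := by
  rw [Finset.sum_congr rfl fun k _ => abs_of_nonneg ((proportion_mem hp y).1 k),
    (proportion_mem hp y).2]

/-- If `y_k ≤ 0` and the total is positive, then type `k` has proportion zero and only off-diagonal
entries contribute to coordinate `k`, which cannot decrease. If `y_k > 0`, the coordinate is above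
`-E` and one step lowers it by at most `matNorm A`. Up to time `M` the total may vanish, and the
crude bound `matNorm A * m` serves instead. -/
theorem neg_le_vecMul_cumProportion (hp : p ∈ stdSimplex ℝ (Fin d))
    (hA : ∀ q k, q ≠ k → 0 ≤ A q k) {N : ℕ} {E M : ℝ} (hE : 0 ≤ E) (hM : 0 ≤ M)
    (hy : ∀ m ≤ N, ∀ k, |y m k - Matrix.vecMul (cumProportion p y m) A k| ≤ E)
    (hα : ∀ m ≤ N, M < m → 0 < ∑ j, pos (y m) j) (k : Fin d) {m : ℕ} (hm : m ≤ N) :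
    -(E + matNorm A + matNorm A * M) ≤ Matrix.vecMul (cumProportion p y m) A k := by
  have hn := matNorm_nonneg A
  induction m with
  | zero =>
    have : 0 ≤ matNorm A * M := mul_nonneg hn hM
    simp only [cumProportion, Finset.range_zero, Finset.sum_empty, Matrix.zero_vecMul,
      Pi.zero_apply]
    linarith
  | succ m ih =>
    have ih := ih (by lia)
    rcases le_or_gt (m : ℝ) M with h | h
    · have h1 := abs_vecMul_le A (cumProportion p y (m + 1)) k
      rw [sum_abs_cumProportion hp] at h1
      have h2 := neg_le_of_abs_le h1
      push_cast at h2
      nlinarith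
    · have hpos := hα m (by lia) h
      rw [cumProportion_succ, Matrix.add_vecMul, Pi.add_apply]
      rcases le_or_gt (y m k) 0 with h0 | h0
      · have : 0 ≤ Matrix.vecMul (proportion p (y m)) A k := by
          simp only [Matrix.vecMul, dotProduct]
          refine Finset.sum_nonneg fun q _ => ?_
          by_cases hqk : q = k
          · subst hqk
            have : proportion p (y m) q = 0 := by
              rw [proportion, if_neg hpos.ne', Pi.smul_apply, pos, max_eq_right h0, smul_zero]
            rw [this, zero_mul]
          · exact mul_nonneg ((proportion_mem hp (y m)).1 q) (hA q k hqk)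
        linarith
      · have h1 := abs_vecMul_le A (proportion p (y m)) k
        rw [sum_abs_proportion hp, one_mul] at h1
        have h2 := neg_le_of_abs_le h1
        have h3 := (abs_le.1 (hy m (by lia) k)).2
        have : 0 ≤ matNorm A * M := mul_nonneg hn hM
        linarith

theorem sum_mul_le_sum_pos {u : Fin d → ℝ} (hu : ∀ k, 0 < u k) (x : Fin d → ℝ) :
    ∑ k, x k * u k ≤ (∑ k, u k) * ∑ k, pos x k := by
  rw [Finset.mul_sum]
  refine Finset.sum_le_sum fun k _ => ?_
  calc x k * u k ≤ pos x k * u k := mul_le_mul_of_nonneg_right (le_pos x k) (hu k).le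
    _ ≤ pos x k * ∑ k, u k := by
        refine mul_le_mul_of_nonneg_left ?_ (pos_nonneg x k)
        exact Finset.single_le_sum (fun k _ => (hu k).le) (Finset.mem_univ k)
    _ = _ := mul_comm _ _

/-- Pairing with `u` gives `(z A) ⬝ u = l (z ⬝ u) ≥ l w m`, as `z` has mass `m`. This is the linear
growth of the total of the positive parts. -/
theorem le_sum_pos (hp : p ∈ stdSimplex ℝ (Fin d)) {u : Fin d → ℝ} (hu : ∀ k, 0 < u k) {l : ℝ}
    (hl : 0 < l) (hAu : Matrix.mulVec A u = l • u) {w E : ℝ} (hw : ∀ k, w ≤ u k) {m : ℕ}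
    (hy : ∀ k, |y m k - Matrix.vecMul (cumProportion p y m) A k| ≤ E) :
    l * w * m - E * ∑ k, u k ≤ (∑ k, u k) * ∑ k, pos (y m) k := by
  refine le_trans ?_ (sum_mul_le_sum_pos hu (y m))
  have h1 : ∑ k, Matrix.vecMul (cumProportion p y m) A k * u k =
      l * ∑ k, cumProportion p y m k * u k := by
    have : Matrix.vecMul (cumProportion p y m) A ⬝ᵥ u =
      cumProportion p y m ⬝ᵥ Matrix.mulVec A u := (Matrix.dotProduct_mulVec _ _ _).symm
    rw [hAu, dotProduct_smul] at this
    exact this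
  have h2 : w * m ≤ ∑ k, cumProportion p y m k * u k := by
    rw [← sum_cumProportion (y := y) hp m, mul_comm, Finset.sum_mul]
    exact Finset.sum_le_sum fun k _ =>
      mul_le_mul_of_nonneg_left (hw k) (cumProportion_nonneg hp m k)
  have h3 : ∑ k, Matrix.vecMul (cumProportion p y m) A k * u k - E * ∑ k, u k ≤
      ∑ k, y m k * u k := by
    rw [Finset.mul_sum, ← Finset.sum_sub_distrib]
    refine Finset.sum_le_sum fun k _ => ?_
    have := (abs_le.1 (hy k)).1
    nlinarith [hu k]
  have h4 := mul_le_mul_of_nonneg_left h2 hl.le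
  rw [h1] at h3
  linarith

theorem sum_pos_le (hp : p ∈ stdSimplex ℝ (Fin d)) {E : ℝ} {m : ℕ}
    (hy : ∀ k, |y m k - Matrix.vecMul (cumProportion p y m) A k| ≤ E) :
    ∑ k, pos (y m) k ≤ matNorm A * m + d * E := by
  have h1 := sum_abs_vecMul_le A (cumProportion p y m)
  rw [sum_abs_cumProportion hp, mul_comm] at h1
  calc ∑ k, pos (y m) k ≤ ∑ k, (|Matrix.vecMul (cumProportion p y m) A k| + E) := by
        refine Finset.sum_le_sum fun k _ => max_le ?_ ?_
        · have := (abs_le.1 (hy k)).2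
          linarith [le_abs_self (Matrix.vecMul (cumProportion p y m) A k)]
        · linarith [(abs_nonneg _).trans (hy k), abs_nonneg (Matrix.vecMul (cumProportion p y m) A k)]
    _ ≤ _ := by
        rw [Finset.sum_add_distrib]
        simpa using h1

end Trajectory

/-! ### Conjugation to a stochastic matrix. -/

section Conjugation

open scoped Matrix.Norms.Operator

variable {d : ℕ} {A : Matrix (Fin d) (Fin d) ℝ}

/-- Doob's transform: `P = 1 + (diag(u)⁻¹ A diag(u) - l) / r` has row sums one because `A u = l u`.
-/
theorem exists_stochastic (hA : ∀ q k, q ≠ k → 0 ≤ A q k) {u : Fin d → ℝ} (hu : ∀ k, 0 < u k)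
    {l : ℝ} (hl : 0 < l) (hAu : Matrix.mulVec A u = l • u) :
    ∃ (P : Matrix (Fin d) (Fin d) ℝ) (r : ℝ), 0 < r ∧ ‖P‖ ≤ 1 ∧ (∀ i, ∑ j, P i j = 1) ∧
      ∀ i j, u i * (l • 1 + r • (P - 1) : Matrix (Fin d) (Fin d) ℝ) i j = A i j * u j := by
  -- With this `r` the diagonal entries of `P` are `(A i i + matNorm A) / r ≥ 0`.
  set r := l + matNorm A
  have hr : 0 < r := add_pos_of_pos_of_nonneg hl (matNorm_nonneg A)
  set P : Matrix (Fin d) (Fin d) ℝ :=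
    Matrix.of fun i j => (A i j * u j / u i) / r + (if i = j then 1 - l / r else 0) with hP
  have hP0 : ∀ i j, 0 ≤ P i j := by
    intro i j
    simp only [hP, Matrix.of_apply]
    have hui := hu i
    have huj := hu j
    split_ifs with h
    · subst h
      rw [mul_div_assoc, div_self hui.ne', mul_one]
      have h1 := (abs_le.1 (abs_le_matNorm A i i)).1
      have : A i i / r + (1 - l / r) = (A i i + matNorm A) / r := by
        field_simp; ring
      rw [this]
      exact div_nonneg (by linarith) hr.le
    · have := hA i j h
      positivity
  have hP1 : ∀ i, ∑ j, P i j = 1 := by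
    intro i
    have hui := hu i
    simp only [hP, Matrix.of_apply]
    rw [Finset.sum_add_distrib, ← Finset.sum_div, ← Finset.sum_div]
    have : ∑ j, A i j * u j = l * u i := congrFun hAu i
    rw [this]
    simp only [Finset.sum_ite_eq, Finset.mem_univ, if_true]
    field_simp
    ring
  refine ⟨P, r, hr, ?_, hP1, fun i j => ?_⟩
  · rw [Matrix.linfty_opNorm_def]
    norm_cast
    refine Finset.sup_le fun i _ => ?_
    rw [← NNReal.coe_le_coe]
    push_cast
    rw [← hP1 i]
    refine le_of_eq (Finset.sum_congr rfl fun j _ => ?_)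
    rw [Real.norm_of_nonneg (hP0 i j)]
  · have hui := hu i
    simp only [hP, Matrix.add_apply, Matrix.smul_apply, Matrix.sub_apply, Matrix.of_apply,
      Matrix.one_apply, smul_eq_mul]
    split_ifs with h
    · field_simp; ring
    · field_simp; ring

end Conjugation

/-! ### The selection sums are approximate left eigenvectors. -/

section Core

open NormedSpace
open scoped Matrix.Norms.Operator

theorem log_div_le_sum_inv {k m : ℕ} (hk : 1 ≤ k) (hkm : k ≤ m) :
    Real.log ((m : ℝ) / k) ≤ ∑ j ∈ Finset.Ico k m, (j : ℝ)⁻¹ := by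
  have hk0 : (0 : ℝ) < k := by exact_mod_cast hk
  induction m, hkm using Nat.le_induction with
  | base => simp [hk0.ne']
  | succ m hkm ih =>
    have hm0 : (0 : ℝ) < m := by exact_mod_cast hk.trans hkm
    rw [Finset.sum_Ico_succ_top hkm]
    have h1 : ((m + 1 : ℕ) : ℝ) / k = (m : ℝ) / k * (1 + (m : ℝ)⁻¹) := by
      push_cast; field_simp
    rw [h1, Real.log_mul (by positivity) (by positivity)]
    have := Real.log_le_sub_one_of_pos (x := 1 + (m : ℝ)⁻¹) (by positivity)
    linarith

variable {d : ℕ} {A : Matrix (Fin d) (Fin d) ℝ} {p : Fin d → ℝ} {y : ℕ → Fin d → ℝ}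

/-- The vector `z` in coordinates weighted by `u`, as a one-row matrix. -/
def weightedRow (u z : Fin d → ℝ) : Matrix Unit (Fin d) ℝ := Matrix.of fun _ k => z k * u k

theorem weightedRow_mul {B : Matrix (Fin d) (Fin d) ℝ} {u : Fin d → ℝ}
    (hB : ∀ i j, u i * B i j = A i j * u j) (z : Fin d → ℝ) :
    weightedRow u z * B = weightedRow u (Matrix.vecMul z A) := by
  ext i k
  simp only [weightedRow, Matrix.mul_apply, Matrix.of_apply, Matrix.vecMul, dotProduct]
  rw [Finset.sum_mul]
  refine Finset.sum_congr rfl fun q _ => ?_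
  rw [mul_assoc, hB, mul_assoc]

theorem norm_weightedRow_le {u z : Fin d → ℝ} (hu : ∀ k, 0 < u k) {b : ℝ} (hz : ∀ k, |z k| ≤ b) :
    ‖weightedRow u z‖ ≤ b * ∑ k, u k := by
  rw [norm_row_eq, Finset.mul_sum]
  refine Finset.sum_le_sum fun k _ => ?_
  simp only [weightedRow, Matrix.of_apply]
  rw [abs_mul, abs_of_pos (hu k)]
  exact mul_le_mul_of_nonneg_right (hz k) (hu k).le

theorem norm_weightedRow_cumProportion_le (hp : p ∈ stdSimplex ℝ (Fin d)) {u : Fin d → ℝ}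
    (hu : ∀ k, 0 < u k) (m : ℕ) : ‖weightedRow u (cumProportion p y m)‖ ≤ m * ∑ k, u k := by
  refine norm_weightedRow_le hu fun k => ?_
  rw [← sum_abs_cumProportion (y := y) hp m]
  exact Finset.single_le_sum (f := fun k => |cumProportion p y m k|) (fun _ _ => abs_nonneg _)
    (Finset.mem_univ k)

/-- If `y_m` is within `E` of `z_m A`, where `z` is the sum of the selection probabilities, then the
negative parts of `y` are of order `1 + E`. -/
theorem sub_vecMul_mem (hp : p ∈ stdSimplex ℝ (Fin d)) (hA : ∀ q k, q ≠ k → 0 ≤ A q k)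
    {u : Fin d → ℝ} (hu : ∀ k, 0 < u k) {l : ℝ} (hl : 0 < l)
    (hAu : Matrix.mulVec A u = l • u) {w : ℝ} (hw0 : 0 < w) (hw : ∀ k, w ≤ u k) {N : ℕ} {E : ℝ}
    (hE : 0 ≤ E)
    (hy : ∀ m ≤ N, ∀ k, |y m k - Matrix.vecMul (cumProportion p y m) A k| ≤ E)
    {m : ℕ} (hm : m ≤ N) (k : Fin d) :
    -(E + matNorm A + matNorm A * (E * (∑ k, u k) / (l * w))) ≤
      Matrix.vecMul (cumProportion p y m) A k := by
  have hU : 0 ≤ ∑ k, u k := Finset.sum_nonneg fun k _ => (hu k).le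
  refine neg_le_vecMul_cumProportion hp hA hE (by positivity) hy (fun m hm hM => ?_) k hm
  have h1 := le_sum_pos hp hu hl hAu hw (hy m hm)
  rw [div_lt_iff₀ (by positivity)] at hM
  by_contra hcon
  have : (∑ k, u k) * ∑ k, pos (y m) k ≤ 0 :=
    mul_nonpos_of_nonneg_of_nonpos hU (not_lt.1 hcon)
  nlinarith

-- From time `n / D` on, the total at time `j` lies between `c j` and `(matNorm A + d) j`. The upper
-- bound makes the clock `τ = ∑ 1 / α_j` at least `log D / (matNorm A + d)`; the lower bound makes
-- the steps `O(1 / n)`, which puts the recursion in the range of `norm_sub_mul_exp_le`. The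
-- constants are uniform in `y`, and `D` stays free so that `τ` can be made large afterwards.
set_option maxHeartbeats 1000000 in
theorem exists_norm_sub_mul_exp_le (hp : p ∈ stdSimplex ℝ (Fin d))
    (hA : ∀ q k, q ≠ k → 0 ≤ A q k)
    {u : Fin d → ℝ} (hu : ∀ k, 0 < u k) {l : ℝ} (hl : 0 < l)
    (hAu : Matrix.mulVec A u = l • u) {w : ℝ} (hw0 : 0 < w) (hw : ∀ k, w ≤ u k)
    {B : Matrix (Fin d) (Fin d) ℝ} (hB : ∀ i j, u i * B i j = A i j * u j) (K : ℕ) {D : ℕ}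
    (hD : 1 ≤ D) :
    ∃ G η₁ : ℝ, 0 < G ∧ 0 < η₁ ∧ ∃ n₀ : ℕ, ∀ n ≥ n₀, ∀ η : ℝ, 0 ≤ η → η ≤ η₁ →
      ∀ y : ℕ → Fin d → ℝ,
      (∀ m ≤ K * n, ∀ k, |y m k - Matrix.vecMul (cumProportion p y m) A k| ≤ η * n) →
      ∀ m, n ≤ m → m ≤ K * n → ∃ τ : ℝ, Real.log D ≤ (matNorm A + d) * τ ∧
        ‖weightedRow u (cumProportion p y m) -
          weightedRow u (cumProportion p y (n / D)) * exp (τ • B)‖ ≤ G * (1 + η * n) := by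
  have hd : Nonempty (Fin d) := by
    by_contra h
    have := hp.2
    simp [not_nonempty_iff.1 h] at this
  have hdpos : (0 : ℝ) < d := by
    exact_mod_cast Fin.pos_iff_nonempty.2 hd
  set U := ∑ k, u k with hUdef
  have hU : 0 < U := Finset.sum_pos (fun k _ => hu k) Finset.univ_nonempty
  set h := matNorm A with hh
  have hh0 : 0 ≤ h := matNorm_nonneg A
  set b := ‖B‖ with hb
  have hb0 : 0 ≤ b := norm_nonneg _
  -- Half of the growth rate in `le_sum_pos`; the other half pays for the error `E U`.
  set c := l * w / (2 * U) with hc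
  have hc0 : 0 < c := by positivity
  have hD0 : (0 : ℝ) < D := by exact_mod_cast hD
  set g := 2 * D * K / c with hg
  have hg0 : 0 ≤ g := by positivity
  set c4 := 1 + h * U / (l * w) + h with hc4
  have hc40 : 0 < c4 := by positivity
  -- The two bounds on `η` give `E U ≤ l w k₀ / 2` and `E ≤ k₀` for `E = η n`, `k₀ = n / D`. The two
  -- bounds on `n` give `k₀ ≥ 1` and `σ b ≤ 1`.
  refine ⟨(g * (g * U) * b ^ 2 + g * (c4 * U) + 1) * Real.exp (b * g),
    min (l * w / (4 * D * U)) (1 / (2 * D)), by positivity, by positivity,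
    max D ⌈2 * D * b / c⌉₊, ?_⟩
  intro n hn η hη0 hη1 y hy m hnm hmN
  have hnD : D ≤ n := (le_max_left _ _).trans hn
  have hnb : 2 * D * b / c ≤ n := Nat.ceil_le.1 ((le_max_right _ _).trans hn)
  have hη2 : η * (4 * D * U) ≤ l * w :=
    (le_div_iff₀ (by positivity)).1 (hη1.trans (min_le_left _ _))
  have hη3 : η * (2 * D) ≤ 1 := (le_div_iff₀ (by positivity)).1 (hη1.trans (min_le_right _ _))
  set k₀ := n / D with hk₀
  have hk1 : 1 ≤ k₀ := (Nat.one_le_div_iff (by lia)).2 hnD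
  have hk1' : (1 : ℝ) ≤ k₀ := by exact_mod_cast hk1
  have hkn : k₀ * D ≤ n := Nat.div_mul_le_self n D
  have hkn' : (k₀ : ℝ) * D ≤ n := by exact_mod_cast hkn
  have hkm : k₀ ≤ m := (Nat.div_le_self n D).trans hnm
  have hnk : (n : ℝ) ≤ 2 * D * k₀ := by
    have h1 : n < D * (k₀ + 1) := Nat.lt_mul_div_succ n (by lia)
    have h2 : (n : ℝ) < D * (k₀ + 1) := by exact_mod_cast h1
    nlinarith
  set E := η * n with hE
  have hE0 : 0 ≤ E := by positivity
  have hn0 : (0 : ℝ) ≤ n := Nat.cast_nonneg n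
  have hcast : ∀ j, k₀ ≤ j → (k₀ : ℝ) ≤ j := fun j hj => by exact_mod_cast hj
  have hEk : E ≤ k₀ := by
    calc E ≤ η * (2 * D * k₀) := mul_le_mul_of_nonneg_left hnk hη0
      _ = η * (2 * D) * k₀ := by ring
      _ ≤ 1 * k₀ := by gcongr
      _ = k₀ := one_mul _
  have hEU : E * U ≤ l * w * k₀ / 2 := by
    have : E ≤ η * (2 * D * k₀) := mul_le_mul_of_nonneg_left hnk hη0
    calc E * U ≤ η * (2 * D * k₀) * U := by gcongr
      _ = η * (4 * D * U) * (k₀ / 2) := by ring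
      _ ≤ l * w * (k₀ / 2) := by gcongr
      _ = _ := by ring
  have hαlow : ∀ j, k₀ ≤ j → j < m → c * j ≤ ∑ k, pos (y j) k := by
    intro j hj hjm
    have h1 := le_sum_pos hp hu hl hAu hw (hy j (hjm.le.trans hmN))
    have h2 : l * w * j / 2 ≤ U * ∑ k, pos (y j) k := by
      have : l * w * k₀ ≤ l * w * j := by gcongr
      linarith
    rw [hc]
    rw [div_mul_eq_mul_div, div_le_iff₀ (by positivity)]
    linarith
  have hαup : ∀ j, k₀ ≤ j → j < m → ∑ k, pos (y j) k ≤ (h + d) * j := by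
    intro j hj hjm
    have h1 := sum_pos_le (A := A) hp (hy j (hjm.le.trans hmN))
    have h2 : (d : ℝ) * E ≤ d * j := by
      have := hcast j hj
      gcongr
      linarith
    linarith
  have hαpos : ∀ j, k₀ ≤ j → j < m → 0 < ∑ k, pos (y j) k := fun j hj hjm =>
    lt_of_lt_of_le (mul_pos hc0 (by have := hcast j hj; linarith)) (hαlow j hj hjm)
  set s : ℕ → ℝ := fun j => (∑ k, pos (y j) k)⁻¹ with hs
  refine ⟨∑ j ∈ Finset.Ico k₀ m, s j, ?_, ?_⟩
  · have h1 := log_div_le_sum_inv hk1 hkm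
    have h2 : Real.log D ≤ Real.log ((m : ℝ) / k₀) := by
      refine Real.log_le_log hD0 ((le_div_iff₀ (by linarith)).2 ?_)
      have : (n : ℝ) ≤ m := by exact_mod_cast hnm
      linarith [mul_comm (k₀ : ℝ) D]
    refine h2.trans (h1.trans ?_)
    rw [Finset.mul_sum]
    refine Finset.sum_le_sum fun j hj => ?_
    obtain ⟨hj1, hj2⟩ := Finset.mem_Ico.1 hj
    have hjpos : (0 : ℝ) < j := by have := hcast j hj1; linarith
    rw [hs, ← div_eq_mul_inv, inv_eq_one_div, div_le_div_iff₀ hjpos (hαpos j hj1 hj2), one_mul]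
    exact hαup j hj1 hj2
  · set σ := 1 / (c * k₀) with hσ
    have hσ0 : 0 ≤ σ := by positivity
    have hσn : σ * n ≤ 2 * D / c := by
      rw [hσ, one_div_mul_eq_div, div_le_div_iff₀ (by positivity) hc0]
      nlinarith
    have hσb : σ * b ≤ 1 := by
      rw [div_le_iff₀ hc0] at hnb
      rw [hσ, one_div_mul_eq_div, div_le_one (by positivity)]
      have h1 : 2 * D * b ≤ 2 * D * (c * k₀) := by nlinarith
      exact le_of_mul_le_mul_left h1 (by positivity)
    -- Entrywise bound for `y⁺ - z A`: where `y > 0` it is at most `E`, elsewhere it is `-z A`,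
    -- controlled from above by `sub_vecMul_mem`.
    set E' := E + h + h * (E * U / (l * w)) with hE'
    have hE'0 : 0 ≤ E' := by positivity
    set R : ℝ := K * n * U with hR
    have hR0 : 0 ≤ R := by positivity
    set e : ℕ → Matrix Unit (Fin d) ℝ := fun j =>
      weightedRow u (pos (y j) - Matrix.vecMul (cumProportion p y j) A) with he
    have hmN' : (m : ℝ) ≤ K * n := by exact_mod_cast hmN
    have main := norm_sub_mul_exp_le B (fun j => weightedRow u (cumProportion p y j)) e s
      hσ0 hR0 (E := E' * U) (by positivity) hσb hkm (fun j hj hjm => ⟨?_, ?_⟩)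
      (fun j hj hjm => ?_) (fun j hj hjm => ?_) (fun j hj hjm => ?_)
    · refine main.trans ?_
      set L : ℝ := ((m - k₀ : ℕ) : ℝ)
      have hL0 : 0 ≤ L := Nat.cast_nonneg _
      have hL : L ≤ K * n := by
        refine le_trans ?_ hmN'
        exact Nat.cast_le.2 (Nat.sub_le m k₀)
      have hσKn : σ * (K * n) ≤ g := by
        calc σ * (K * n) = K * (σ * n) := by ring
          _ ≤ K * (2 * D / c) := by gcongr
          _ = g := by rw [hg]; ring
      have hσL : σ * L ≤ g := (mul_le_mul_of_nonneg_left hL hσ0).trans hσKn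
      have hσR : σ * R ≤ g * U := by
        rw [hR, ← mul_assoc]
        exact mul_le_mul_of_nonneg_right hσKn hU.le
      have hE'le : E' ≤ c4 * (1 + E) := by
        rw [hE', hc4]
        have h1 : 0 ≤ h * U / (l * w) := by positivity
        rw [← sub_nonneg]
        have h2 : (1 + h * U / (l * w) + h) * (1 + E) - (E + h + h * (E * U / (l * w))) =
          1 + h * U / (l * w) + h * E := by ring
        rw [h2]
        positivity
      have h1 : L * (R * (σ * b) ^ 2 + σ * (E' * U)) ≤
          (g * (g * U) * b ^ 2 + g * (c4 * U) + 1) * (1 + E) := by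
        calc L * (R * (σ * b) ^ 2 + σ * (E' * U))
            = (σ * L) * (σ * R) * b ^ 2 + (σ * L) * (E' * U) := by ring
          _ ≤ g * (g * U) * b ^ 2 + g * (c4 * (1 + E) * U) := by gcongr
          _ ≤ _ := by
            rw [← sub_nonneg]
            have h2 : (g * (g * U) * b ^ 2 + g * (c4 * U) + 1) * (1 + E) -
              (g * (g * U) * b ^ 2 + g * (c4 * (1 + E) * U)) =
                g * (g * U) * b ^ 2 * E + 1 + E := by ring
            rw [h2]
            positivity
      have h2 : σ * b * L ≤ b * g := by
        calc σ * b * L = b * (σ * L) := by ring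
          _ ≤ b * g := by gcongr
      calc _ ≤ (g * (g * U) * b ^ 2 + g * (c4 * U) + 1) * (1 + E) * Real.exp (b * g) := by
            gcongr
        _ = _ := by ring
    · exact inv_nonneg.2 (hαpos j hj hjm).le
    · change (∑ k, pos (y j) k)⁻¹ ≤ σ
      rw [hσ, inv_eq_one_div]
      refine one_div_le_one_div_of_le (by positivity) (le_trans ?_ (hαlow j hj hjm))
      have := hcast j hj
      gcongr
    · refine (norm_weightedRow_cumProportion_le hp hu j).trans ?_
      rw [hR]
      have : (j : ℝ) ≤ K * n := by
        refine le_trans ?_ hmN'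
        exact_mod_cast hjm.le
      gcongr
    · refine norm_weightedRow_le hu fun k => ?_
      have hjN := hjm.le.trans hmN
      have h1 := sub_vecMul_mem hp hA hu hl hAu hw0 hw hE0 hy hjN k
      have h2 := abs_le.1 (hy j hjN k)
      have h3 : 0 ≤ h * (E * U / (l * w)) := by positivity
      rw [Pi.sub_apply, abs_le]
      constructor
      · have := le_pos (y j) k
        linarith [h2.1]
      · rw [sub_le_iff_le_add]
        refine max_le ?_ ?_
        · linarith [h2.2]
        · linarith
    · have hne := (hαpos j hj hjm).ne'
      rw [weightedRow_mul hB, cumProportion_succ, proportion, if_neg hne]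
      ext i k
      simp only [he, weightedRow, Matrix.of_apply, Matrix.add_apply, Matrix.smul_apply,
        Pi.add_apply, Pi.smul_apply, Pi.sub_apply, smul_eq_mul, hs]
      ring

/-- The constants are chosen in the order `ε`, then `D` (so that `τ` is large enough for the
smoothing), then `G` from the Euler comparison at that `D`, then `η` and `n₀`. -/
theorem exists_forall_trajectory (hp : p ∈ stdSimplex ℝ (Fin d)) (hA : Admissible A) (K : ℕ)
    {ε : ℝ} (hε : 0 < ε) :
    ∃ η : ℝ, 0 < η ∧ ∃ n₀ : ℕ, ∀ n ≥ n₀, ∀ y : ℕ → Fin d → ℝ,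
      (∀ m ≤ K * n, ∀ k, |y m k - Matrix.vecMul (cumProportion p y m) A k| ≤ η * n) →
      (∀ m, n ≤ m → m ≤ K * n → ∀ k,
        |Matrix.vecMul (cumProportion p y m) A k - lam A * cumProportion p y m k| ≤ ε * m) ∧
      (∀ m ≤ K * n, ∀ k, |pos (y m) k - y m k| ≤ ε * n) := by
  obtain ⟨hoff, ⟨u, hu, hAu⟩, hl⟩ := hA
  set l := lam A with hldef
  have hd : Nonempty (Fin d) := by
    by_contra h
    have := hp.2
    simp [not_nonempty_iff.1 h] at this
  have hdpos : (0 : ℝ) < d := by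
    exact_mod_cast Fin.pos_iff_nonempty.2 hd
  obtain ⟨k₁, hk₁⟩ := Finite.exists_min u
  set w := u k₁ with hwdef
  have hw0 : 0 < w := hu k₁
  obtain ⟨P, r, hr, hP, hP1, hPA⟩ := exists_stochastic hoff hu hl hAu
  set B : Matrix (Fin d) (Fin d) ℝ := l • 1 + r • (P - 1) with hB
  set U := ∑ k, u k with hUdef
  have hU : 0 < U := Finset.sum_pos (fun k _ => hu k) Finset.univ_nonempty
  set h := matNorm A with hh
  have hh0 : 0 ≤ h := matNorm_nonneg A
  have hC1 : 0 < h + d := by positivity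
  set q := ‖r • (P - 1)‖ with hq
  have hq0 : 0 ≤ q := norm_nonneg _
  set ε' := ε * w / 2 with hε'
  have hε'0 : 0 < ε' := by positivity
  -- the ratio `D` of the time scales
  obtain ⟨D, hD1, hD⟩ : ∃ D : ℕ, 1 < D ∧
      ∀ τ : ℝ, Real.log D ≤ (h + d) * τ → 0 < τ ∧ (U + 2) * (r / √(τ * r)) ≤ ε' := by
    -- The value of `τ` at which `(U + 2) r / √(τ r)` equals `ε'`.
    set τ₀ := r * ((U + 2) / ε') ^ 2 with hτ₀
    have hτ₀0 : 0 < τ₀ := by positivity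
    have ht : Tendsto (fun D : ℕ => Real.log D) atTop atTop :=
      Real.tendsto_log_atTop.comp tendsto_natCast_atTop_atTop
    obtain ⟨D, hD1, hD2⟩ := ((eventually_gt_atTop 1).and
      (ht.eventually_ge_atTop ((h + d) * τ₀))).exists
    refine ⟨D, hD1, fun τ hτ => ?_⟩
    have h1 : τ₀ ≤ τ := le_of_mul_le_mul_left (hD2.trans hτ) hC1
    have hτ0 : 0 < τ := hτ₀0.trans_le h1
    refine ⟨hτ0, ?_⟩
    rw [mul_div_assoc', div_le_iff₀ (by positivity), ← div_le_iff₀' hε'0]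
    refine Real.le_sqrt_of_sq_le ?_
    calc ((U + 2) * r / ε') ^ 2 = τ₀ * r := by rw [hτ₀]; ring
      _ ≤ τ * r := by gcongr
  obtain ⟨G, η₁, hG, hη₁, n₁, hmain⟩ :=
    exists_norm_sub_mul_exp_le hp hoff hu hl hAu hw0 hk₁ hPA K hD1.le
  -- The Euler error will be at most `2 θ m`; the second bound makes its image under `r (P - 1)`, of
  -- norm `q`, at most `ε' m`.
  set θ := min 1 (ε' / (2 * (q + 1))) with hθ
  have hθ0 : 0 < θ := by positivity
  set c5 := 2 + h * U / (l * w) with hc5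
  have hc50 : 0 < c5 := by positivity
  refine ⟨min η₁ (min (θ / G) (ε / (2 * c5))), by positivity,
    max n₁ (max ⌈G / θ⌉₊ ⌈2 * h / ε⌉₊), ?_⟩
  intro n hn y hy
  set η := min η₁ (min (θ / G) (ε / (2 * c5))) with hη
  have hη0 : 0 ≤ η := by positivity
  have hηG : η * G ≤ θ :=
    (le_div_iff₀ hG).1 ((min_le_right _ _).trans (min_le_left _ _))
  have hηc : η * (2 * c5) ≤ ε :=
    (le_div_iff₀ (by positivity)).1 ((min_le_right _ _).trans (min_le_right _ _))
  have hn1 : n₁ ≤ n := (le_max_left _ _).trans hn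
  have hnG : G ≤ n * θ := (div_le_iff₀ hθ0).1
    (Nat.ceil_le.1 (((le_max_left _ _).trans (le_max_right _ _)).trans hn))
  have hnh : 2 * h ≤ n * ε := (div_le_iff₀ hε).1
    (Nat.ceil_le.1 (((le_max_right _ _).trans (le_max_right _ _)).trans hn))
  have hn0 : (0 : ℝ) ≤ n := Nat.cast_nonneg n
  refine ⟨fun m hnm hmN k => ?_, fun m hmN k => ?_⟩
  · obtain ⟨τ, hτ, hdiff⟩ := hmain n hn1 η hη0 (min_le_left _ _) y hy m hnm hmN
    obtain ⟨hτ0, hτD⟩ := hD τ hτ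
    have hnm' : (n : ℝ) ≤ m := by exact_mod_cast hnm
    have hδ : G * (1 + η * n) ≤ 2 * θ * m := by
      have h1 : G * (1 + η * n) = G + η * G * n := by ring
      have h2 : η * G * n ≤ θ * n := by gcongr
      have h3 : θ * n ≤ θ * m := by gcongr
      rw [h1]; linarith
    have h1 := norm_mul_generator_le hP hP1 (l := l) hr hτ0
      (Z := weightedRow u (cumProportion p y (n / D)))
      (fun j => mul_nonneg (cumProportion_nonneg hp _ _) (hu j).le)
      (weightedRow u (cumProportion p y m)) (hdiff.trans hδ)
    have hm0 : (0 : ℝ) ≤ m := Nat.cast_nonneg m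
    have h2 : ‖weightedRow u (cumProportion p y m)‖ + 2 * θ * m ≤ (U + 2) * m := by
      have := norm_weightedRow_cumProportion_le (y := y) hp hu m
      have h3 : θ * m ≤ 1 * m := by
        gcongr
        exact min_le_left _ _
      nlinarith
    have hθq : 2 * θ * q ≤ ε' := by
      have h3 : θ * (2 * (q + 1)) ≤ ε' := (le_div_iff₀ (by positivity)).1 (min_le_right _ _)
      nlinarith
    have h4 : ‖weightedRow u (cumProportion p y m) * (r • (P - 1))‖ ≤ ε * w * m := by
      refine h1.trans ?_
      calc _ ≤ (U + 2) * m * (r / √(τ * r)) + 2 * θ * m * q := by gcongr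
        _ = (U + 2) * (r / √(τ * r)) * m + 2 * θ * q * m := by ring
        _ ≤ ε' * m + ε' * m := by gcongr
        _ = _ := by rw [hε']; ring
    have h5 : r • (P - 1) = B - l • 1 := by rw [hB]; abel
    rw [h5, Matrix.mul_sub, weightedRow_mul hPA, Matrix.mul_smul, Matrix.mul_one,
      norm_row_eq] at h4
    have h6 := (Finset.single_le_sum (f := fun j => |(weightedRow u
      (Matrix.vecMul (cumProportion p y m) A) - l • weightedRow u (cumProportion p y m)) () j|)
      (fun _ _ => abs_nonneg _) (Finset.mem_univ k)).trans h4
    simp only [weightedRow, Matrix.sub_apply, Matrix.smul_apply, Matrix.of_apply,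
      smul_eq_mul] at h6
    rw [← mul_assoc, ← sub_mul, abs_mul, abs_of_pos (hu k)] at h6
    have h7 : |Matrix.vecMul (cumProportion p y m) A k - l * cumProportion p y m k| * w ≤
        ε * m * w := by
      refine le_trans ?_ (h6.trans (le_of_eq (by ring)))
      gcongr
      exact hk₁ k
    exact le_of_mul_le_mul_right h7 hw0
  · have h1 := sub_vecMul_mem hp hoff hu hl hAu hw0 hk₁ (by positivity : 0 ≤ η * n) hy hmN k
    have h2 := abs_le.1 (hy m hmN k)
    rw [abs_of_nonneg (sub_nonneg.2 (le_pos _ _)), sub_le_iff_le_add]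
    have h3 : η * n * 2 + h + h * (η * n * U / (l * w)) ≤ ε * n := by
      calc η * n * 2 + h + h * (η * n * U / (l * w)) = η * (2 * c5) * (n / 2) + h := by
            rw [hc5]; ring
        _ ≤ ε * (n / 2) + h := by gcongr
        _ ≤ _ := by linarith
    have h4 : 0 ≤ ε * n := by positivity
    refine max_le (by linarith) (by linarith [h2.1])

end Core

/-! ### The eigenvector set: compactness, measurability, uniqueness. -/

section EigenSimplex

variable {d : ℕ} {A : Matrix (Fin d) (Fin d) ℝ}

theorem sum_mul_pos_of_mem_stdSimplex {u v : Fin d → ℝ} (hu : ∀ k, 0 < u k)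
    (hv : v ∈ stdSimplex ℝ (Fin d)) : 0 < v ⬝ᵥ u := by
  have h0 : ∀ k ∈ Finset.univ, 0 ≤ v k * u k := fun k _ => mul_nonneg (hv.1 k) (hu k).le
  refine lt_of_le_of_ne (Finset.sum_nonneg h0) fun h => ?_
  have h1 : ∀ k, v k = 0 := fun k =>
    (mul_eq_zero.1 ((Finset.sum_eq_zero_iff_of_nonneg h0).1 h.symm k (Finset.mem_univ k))).resolve_right
      (hu k).ne'
  have h2 := hv.2
  simp [h1] at h2

/-- Pairing with `u` shows that a left eigenvector in the simplex can only have eigenvalue `lam A`.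
This description is a closed condition in `(A, v)` that does not involve `lam`, so no regularity of
`lam` is needed for measurability. -/
theorem Admissible.eigenSimplex_eq (hA : Admissible A) :
    eigenSimplex A =
      {v | v ∈ stdSimplex ℝ (Fin d) ∧ Matrix.vecMul v A = (∑ k, Matrix.vecMul v A k) • v} := by
  obtain ⟨-, ⟨u, hu, hAu⟩, -⟩ := hA
  ext v
  simp only [eigenSimplex, Set.mem_ofPred_eq, and_congr_right_iff]
  intro hv
  constructor
  · intro h
    have : ∑ k, Matrix.vecMul v A k = lam A := by
      rw [h]
      simp only [Pi.smul_apply, smul_eq_mul, ← Finset.mul_sum, hv.2, mul_one]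
    rw [this, h]
  · intro h
    have h1 : Matrix.vecMul v A ⬝ᵥ u = v ⬝ᵥ Matrix.mulVec A u := (Matrix.dotProduct_mulVec _ _ _).symm
    rw [hAu, dotProduct_smul, h, smul_dotProduct, smul_eq_mul, smul_eq_mul] at h1
    rw [h, mul_right_cancel₀ (sum_mul_pos_of_mem_stdSimplex hu hv).ne' h1]

theorem continuous_norm_vecMul_sub (A : Matrix (Fin d) (Fin d) ℝ) (l : ℝ) :
    Continuous fun v : Fin d → ℝ => ‖Matrix.vecMul v A - l • v‖ := by
  have : Continuous fun v : Fin d → ℝ => Matrix.vecMul v A :=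
    Continuous.matrix_vecMul continuous_id continuous_const
  fun_prop

theorem eigenSimplex_nonempty_of_forall
    (h : ∀ ε > 0, ∃ v ∈ stdSimplex ℝ (Fin d), ∀ k, |Matrix.vecMul v A k - lam A * v k| ≤ ε) :
    (eigenSimplex A).Nonempty := by
  have hne : (stdSimplex ℝ (Fin d)).Nonempty := (h 1 one_pos).imp fun _ hv => hv.1
  obtain ⟨v, hv, hmin⟩ := (isCompact_stdSimplex ℝ (Fin d)).exists_isMinOn hne
    (continuous_norm_vecMul_sub A (lam A)).continuousOn
  refine ⟨v, hv, ?_⟩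
  rw [← sub_eq_zero, ← norm_le_zero_iff]
  refine le_of_forall_pos_le_add fun ε hε => ?_
  obtain ⟨x, hx, hxε⟩ := h ε hε
  rw [zero_add]
  refine (hmin hx).trans ((pi_norm_le_iff_of_nonneg hε.le).2 fun k => ?_)
  exact hxε k

/-- The residual `‖vA - λv‖` has a positive minimum on the compact part of the simplex at distance
at least `ε` from the eigenvector set. -/
theorem exists_forall_infDist_eigenSimplex_lt {ε : ℝ} (hε : 0 < ε) :
    ∃ δ > 0, ∀ v ∈ stdSimplex ℝ (Fin d),
      (∀ k, |Matrix.vecMul v A k - lam A * v k| ≤ δ) →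
        Metric.infDist v (eigenSimplex A) < ε := by
  set C := stdSimplex ℝ (Fin d) ∩ {v | ε ≤ Metric.infDist v (eigenSimplex A)} with hC
  have hCc : IsCompact C := (isCompact_stdSimplex ℝ (Fin d)).inter_right
    (isClosed_le continuous_const (Metric.continuous_infDist_pt _))
  rcases C.eq_empty_or_nonempty with h | h
  · refine ⟨1, one_pos, fun v hv _ => ?_⟩
    by_contra hcon
    have : v ∈ C := ⟨hv, not_lt.1 hcon⟩
    simp [h] at this
  · obtain ⟨v, hv, hmin⟩ := hCc.exists_isMinOn h
      (continuous_norm_vecMul_sub A (lam A)).continuousOn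
    have hpos : 0 < ‖Matrix.vecMul v A - lam A • v‖ := by
      rw [norm_pos_iff, sub_ne_zero]
      intro heq
      have : v ∈ eigenSimplex A := ⟨hv.1, heq⟩
      have h1 : ε ≤ Metric.infDist v (eigenSimplex A) := hv.2
      rw [Metric.infDist_zero_of_mem this] at h1
      linarith
    refine ⟨‖Matrix.vecMul v A - lam A • v‖ / 2, by positivity, fun x hx hxδ => ?_⟩
    by_contra hcon
    have h1 := hmin (⟨hx, not_lt.1 hcon⟩ : x ∈ C)
    have h2 : ‖Matrix.vecMul x A - lam A • x‖ ≤ ‖Matrix.vecMul v A - lam A • v‖ / 2 :=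
      (pi_norm_le_iff_of_nonneg (by positivity)).2 hxδ
    have h3 : ‖Matrix.vecMul v A - lam A • v‖ ≤ ‖Matrix.vecMul x A - lam A • x‖ := h1
    linarith

/-- The distance to the image of a compact family with closed constraints depends measurably on the
parameter. -/
theorem measurable_infEDist_image {M V E : Type*} [TopologicalSpace M] [TopologicalSpace V]
    [PseudoEMetricSpace E] [MeasurableSpace M] [MeasurableSpace E] [OpensMeasurableSpace (E × M)]
    {K : Set V} (hK : IsCompact K) {C : Set (M × V)} (hC : IsClosed C) {f : M × V → E}
    (hf : Continuous f) :
    Measurable fun x : E × M =>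
      Metric.infEDist x.1 ((fun v => f (x.2, v)) '' {v | v ∈ K ∧ (x.2, v) ∈ C}) := by
  refine measurable_of_Iic fun c => ?_
  rcases eq_or_ne c ⊤ with rfl | hc
  · simp
  have : CompactSpace K := isCompact_iff_compactSpace.1 hK
  -- A sublevel set at a finite level is the projection of this closed set along the compact factor,
  -- since the infimum is attained. The level `⊤`, the value for an empty set, is treated
  -- separately.
  set F : Set ((E × M) × K) :=
    {q | (q.1.2, (q.2 : V)) ∈ C ∧ edist q.1.1 (f (q.1.2, (q.2 : V))) ≤ c} with hF
  have hFc : IsClosed F := by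
    have h1 : IsClosed {q : (E × M) × K | (q.1.2, (q.2 : V)) ∈ C} := hC.preimage (by fun_prop)
    have h2 : IsClosed {q : (E × M) × K | edist q.1.1 (f (q.1.2, (q.2 : V))) ≤ c} :=
      isClosed_le (Continuous.edist (by fun_prop) (hf.comp (by fun_prop))) continuous_const
    exact h1.inter h2
  have : (fun x : E × M => Metric.infEDist x.1
      ((fun v => f (x.2, v)) '' {v | v ∈ K ∧ (x.2, v) ∈ C})) ⁻¹' Set.Iic c = Prod.fst '' F := by
    ext ⟨e, a⟩
    simp only [Set.mem_preimage, Set.mem_Iic, Set.mem_image]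
    constructor
    · intro h
      have hcomp : IsCompact ((fun v => f (a, v)) '' {v | v ∈ K ∧ (a, v) ∈ C}) := by
        refine IsCompact.image ?_ (by fun_prop)
        exact hK.inter_right (hC.preimage (by fun_prop))
      rcases ((fun v => f (a, v)) '' {v | v ∈ K ∧ (a, v) ∈ C}).eq_empty_or_nonempty with h0 | h0
      · rw [h0, Metric.infEDist_empty] at h
        exact absurd (top_le_iff.1 h) hc
      · obtain ⟨z, ⟨v, hv, rfl⟩, hz⟩ := hcomp.exists_infEDist_eq_edist h0 e
        exact ⟨((e, a), ⟨v, hv.1⟩), ⟨hv.2, hz ▸ h⟩, rfl⟩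
    · rintro ⟨⟨⟨e', a'⟩, v⟩, ⟨h1, h2⟩, h3⟩
      obtain ⟨rfl, rfl⟩ := Prod.mk.inj h3
      refine le_trans (Metric.infEDist_le_edist_of_mem ?_) h2
      exact ⟨v.1, ⟨v.2, h1⟩, rfl⟩
  rw [this]
  exact (isClosedMap_fst_of_compactSpace _ hFc).measurableSet

/-- `measurable_infEDist_image` applies with the closed relation from `Admissible.eigenSimplex_eq`.
The scaled set is treated as the image under `v ↦ vH`, which agrees with `λ_H v` on `S_H`. -/
theorem aemeasurable_infNndist_eigenSimplex {Ω : Type*} [MeasurableSpace Ω] {μ : Measure Ω}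
    {H : Ω → Matrix (Fin d) (Fin d) ℝ} (hH : ∀ q k, Measurable fun ω => H ω q k)
    (hadm : ∀ᵐ ω ∂μ, Admissible (H ω)) {x : Ω → Fin d → ℝ} (hx : AEMeasurable x μ) :
    AEMeasurable (fun ω => Metric.infNndist (x ω) (eigenSimplex (H ω))) μ ∧
      AEMeasurable (fun ω => Metric.infNndist (x ω) (scaledEigenSimplex (H ω))) μ := by
  have hvec : Continuous fun q : (Fin d → Fin d → ℝ) × (Fin d → ℝ) =>
      Matrix.vecMul q.2 (Matrix.of q.1) :=
    Continuous.matrix_vecMul continuous_snd continuous_fst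
  set C : Set ((Fin d → Fin d → ℝ) × (Fin d → ℝ)) :=
    {q | Matrix.vecMul q.2 (Matrix.of q.1) = (∑ k, Matrix.vecMul q.2 (Matrix.of q.1) k) • q.2}
    with hC
  have hCc : IsClosed C := by
    have h1 : Continuous fun q : (Fin d → Fin d → ℝ) × (Fin d → ℝ) =>
        ∑ k, Matrix.vecMul q.2 (Matrix.of q.1) k :=
      continuous_finsetSum _ fun k _ => (continuous_apply k).comp hvec
    have h2 : Continuous fun q : (Fin d → Fin d → ℝ) × (Fin d → ℝ) =>
        (∑ k, Matrix.vecMul q.2 (Matrix.of q.1) k) • q.2 := h1.smul continuous_snd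
    exact isClosed_eq hvec h2
  have hHm : Measurable fun ω => (fun q k => H ω q k : Fin d → Fin d → ℝ) :=
    measurable_pi_lambda _ fun q => measurable_pi_lambda _ fun k => hH q k
  have hpair := hx.prodMk hHm.aemeasurable
  have h1 := ((measurable_infEDist_image (isCompact_stdSimplex ℝ (Fin d)) hCc
    (f := Prod.snd) continuous_snd).comp_aemeasurable hpair).ennreal_toNNReal
  have h2 := ((measurable_infEDist_image (isCompact_stdSimplex ℝ (Fin d)) hCc
    hvec).comp_aemeasurable hpair).ennreal_toNNReal
  constructor
  · refine h1.congr ?_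
    filter_upwards [hadm] with ω hω
    simp only [Metric.infNndist, hω.eigenSimplex_eq, Function.comp, Set.image_id']
    rfl
  · refine h2.congr ?_
    filter_upwards [hadm] with ω hω
    have : scaledEigenSimplex (H ω) = (fun v => Matrix.vecMul v (H ω)) '' eigenSimplex (H ω) :=
      Set.image_congr fun v hv => hv.2.symm
    simp only [Metric.infNndist, this, hω.eigenSimplex_eq, Function.comp]
    rfl

/-- Where `v j = 0`, the sum `∑ v q * A q j` of nonnegative terms vanishes, so `A i j = 0` whenever
`v i ≠ 0`. Listing the zeros of `v` first exhibits the forbidden zero block. -/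
theorem pos_of_mem_eigenSimplex (hA : Admissible A) (hirr : ¬ Reducible A) {v : Fin d → ℝ}
    (hv : v ∈ eigenSimplex A) (k : Fin d) : 0 < v k := by
  classical
  refine lt_of_le_of_ne (hv.1.1 k) fun hk => hirr ?_
  set Z : Finset (Fin d) := Finset.univ.filter fun j => v j = 0 with hZ
  have hZpos : 0 < Z.card := Finset.card_pos.2 ⟨k, by simp [hZ, hk.symm]⟩
  have hZd : Z.card < d := by
    refine lt_of_le_of_ne ((Finset.card_le_univ Z).trans_eq (Fintype.card_fin d)) fun h => ?_
    have hZu : Z = Finset.univ := (Finset.card_eq_iff_eq_univ Z).1 (by rw [h, Fintype.card_fin])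
    have h0 : ∀ j, v j = 0 := fun j => by
      have : j ∈ Z := hZu ▸ Finset.mem_univ j
      simpa [hZ] using this
    have h2 := hv.1.2
    simp [h0] at h2
  have hA0 : ∀ i j, v i ≠ 0 → v j = 0 → A i j = 0 := by
    intro i j hi hj
    have h1 : ∑ q, v q * A q j = 0 := by
      have := congrFun hv.2 j
      simpa [hj, Matrix.vecMul, dotProduct] using this
    have h2 : ∀ q ∈ Finset.univ, 0 ≤ v q * A q j := by
      intro q _
      by_cases hqj : q = j
      · rw [hqj, hj, zero_mul]
      · exact mul_nonneg (hv.1.1 q) (hA.offDiag_nonneg q j hqj)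
    exact (mul_eq_zero.1 ((Finset.sum_eq_zero_iff_of_nonneg h2).1 h1 i
      (Finset.mem_univ i))).resolve_left hi
  have hcard : Fintype.card {i : Fin d // (i : ℕ) < Z.card} = Fintype.card {j // v j = 0} := by
    rw [Fintype.card_subtype, Fintype.card_subtype]
    have : (Finset.univ.filter fun i : Fin d => (i : ℕ) < Z.card) = Finset.Iio ⟨Z.card, hZd⟩ := by
      ext i
      simp [Fin.lt_def]
    rw [this, Fin.card_Iio]
  let e := Fintype.equivOfCardEq hcard
  refine ⟨e.extendSubtype, Z.card, hZpos, hZd, fun i j hi hj => ?_⟩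
  rw [Matrix.submatrix_apply]
  exact hA0 _ _ (e.extendSubtype_not_mem i (by simpa using hi)) (e.extendSubtype_mem j hj)

/-- Subtract from `v` the largest multiple `t w` that leaves it nonnegative. The remainder has a
zero coordinate, so unless it vanishes its normalization contradicts `pos_of_mem_eigenSimplex`. -/
theorem eigenSimplex_subsingleton (hA : Admissible A) (hirr : ¬ Reducible A) :
    (eigenSimplex A).Subsingleton := by
  have key : ∀ v ∈ eigenSimplex A, ∀ w ∈ eigenSimplex A, ∀ k, w k ≤ v k := by
    intro v hv w hw
    have hd : Nonempty (Fin d) := by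
      by_contra h
      have := hv.1.2
      simp [not_nonempty_iff.1 h] at this
    have hwpos := pos_of_mem_eigenSimplex hA hirr hw
    obtain ⟨k₁, hk₁⟩ := Finite.exists_min fun k => v k / w k
    set t := v k₁ / w k₁ with ht
    set x := v - t • w with hx
    have hx0 : ∀ k, 0 ≤ x k := by
      intro k
      have := (le_div_iff₀ (hwpos k)).1 (hk₁ k)
      simpa [hx] using this
    have hxk : x k₁ = 0 := by
      have := (hwpos k₁).ne'
      simp [hx, ht, this]
    have hsum : ∑ k, x k = 1 - t := by
      simp [hx, Finset.sum_sub_distrib, ← Finset.mul_sum, hv.1.2, hw.1.2]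
    have hs0 : 0 ≤ 1 - t := hsum ▸ Finset.sum_nonneg fun k _ => hx0 k
    have hs : 1 - t = 0 := by
      by_contra hne
      have hmem : (1 - t)⁻¹ • x ∈ eigenSimplex A := by
        refine ⟨⟨fun k => mul_nonneg (inv_nonneg.2 hs0) (hx0 k), ?_⟩, ?_⟩
        · simp only [Pi.smul_apply, smul_eq_mul, ← Finset.mul_sum, hsum]
          exact inv_mul_cancel₀ hne
        · have hxA : Matrix.vecMul x A = lam A • x := by
            rw [hx, Matrix.sub_vecMul, Matrix.smul_vecMul, hv.2, hw.2, smul_sub, smul_comm]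
          rw [Matrix.smul_vecMul, hxA, smul_comm]
      have := pos_of_mem_eigenSimplex hA hirr hmem k₁
      simp [hxk] at this
    intro k
    have h1 := hx0 k
    have ht1 : t = 1 := by linarith
    simp only [hx, ht1, Pi.sub_apply, Pi.smul_apply, smul_eq_mul, one_mul] at h1
    linarith
  exact fun v hv w hw => funext fun k => le_antisymm (key w hw v hv k) (key v hv w hw k)

end EigenSimplex

/-! ### Calculus of `o(n)` in probability. -/

section InProbability

variable {Ω : Type*} [MeasurableSpace Ω] {μ : Measure Ω}

theorem littleOInProb_iff {Z : ℕ → Ω → ℝ} :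
    LittleOInProb μ Z ↔
      ∀ c : ℝ, 0 < c → Tendsto (fun n : ℕ => μ {ω | c * n ≤ |Z n ω|}) atTop (nhds 0) := by
  rw [LittleOInProb, tendstoInMeasure_iff_norm]
  refine forall₂_congr fun c _ => tendsto_congr' ?_
  filter_upwards [eventually_gt_atTop 0] with n hn
  have hn0 : (0 : ℝ) < n := by exact_mod_cast hn
  congr 1
  ext ω
  simp only [sub_zero, Real.norm_eq_abs, abs_div, Nat.abs_cast, le_div_iff₀ hn0,
    Set.mem_ofPred_eq]

theorem LittleOInProb.mono {Z W : ℕ → Ω → ℝ} (hZ : LittleOInProb μ Z)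
    (h : ∀ᶠ n in atTop, ∀ᵐ ω ∂μ, |W n ω| ≤ |Z n ω|) : LittleOInProb μ W := by
  rw [littleOInProb_iff] at *
  intro c hc
  refine tendsto_of_tendsto_of_tendsto_of_le_of_le' tendsto_const_nhds (hZ c hc)
    (Eventually.of_forall fun _ => zero_le) ?_
  filter_upwards [h] with n hn
  refine measure_mono_ae ?_
  filter_upwards [hn] with ω hω h1
  exact le_trans h1 hω

theorem LittleOInProb.add {Z W : ℕ → Ω → ℝ} (hZ : LittleOInProb μ Z) (hW : LittleOInProb μ W) :
    LittleOInProb μ (fun n ω => Z n ω + W n ω) := by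
  rw [littleOInProb_iff] at *
  intro c hc
  have h := (hZ (c / 2) (by positivity)).add (hW (c / 2) (by positivity))
  rw [add_zero] at h
  refine tendsto_of_tendsto_of_tendsto_of_le_of_le tendsto_const_nhds h
    (fun _ => zero_le) fun n => ?_
  refine (measure_mono ?_).trans (measure_union_le _ _)
  intro ω hω
  by_contra hcon
  simp only [Set.mem_union, Set.mem_ofPred_eq, not_or, not_le] at hcon hω
  have := abs_add_le (Z n ω) (W n ω)
  linarith [hcon.1, hcon.2]

theorem littleOInProb_zero : LittleOInProb μ (fun _ _ => (0 : ℝ)) := by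
  rw [littleOInProb_iff]
  intro c hc
  refine tendsto_const_nhds.congr' ?_
  filter_upwards [eventually_gt_atTop 0] with n hn
  have hn0 : (0 : ℝ) < n := by exact_mod_cast hn
  have : {ω : Ω | c * n ≤ |(0 : ℝ)|} = ∅ := by
    ext ω
    simp only [abs_zero, Set.mem_ofPred_eq, Set.mem_empty_iff_false, iff_false, not_le]
    positivity
  rw [this, measure_empty]

theorem LittleOInProb.sum {ι : Type*} (s : Finset ι) {Z : ι → ℕ → Ω → ℝ}
    (hZ : ∀ i ∈ s, LittleOInProb μ (Z i)) :
    LittleOInProb μ (fun n ω => ∑ i ∈ s, Z i n ω) := by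
  classical
  induction s using Finset.induction_on with
  | empty => simpa using littleOInProb_zero
  | insert i s his ih =>
    simp only [Finset.sum_insert his]
    exact (hZ i (Finset.mem_insert_self _ _)).add
      (ih fun j hj => hZ j (Finset.mem_insert_of_mem hj))

theorem LittleOInProb.tendstoInMeasure_mul {Z : ℕ → Ω → ℝ} (hZ : LittleOInProb μ Z) {K : ℕ}
    (hK : 0 < K) :
    TendstoInMeasure μ (fun n ω => Z (K * n) ω / (n : ℝ)) atTop (fun _ => (0 : ℝ)) := by
  have hK0 : (0 : ℝ) < K := by exact_mod_cast hK
  refine (littleOInProb_iff (Z := fun n ω => Z (K * n) ω)).2 fun c hc => ?_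
  have h := (littleOInProb_iff.1 hZ (c / K) (by positivity)).comp
    (tendsto_id.const_mul_atTop' hK)
  refine h.congr fun n => ?_
  simp only [Function.comp, id]
  congr 1
  ext ω
  simp only [Set.mem_ofPred_eq]
  have : c / K * ((K * n : ℕ) : ℝ) = c * n := by
    push_cast; field_simp
  rw [this]

end InProbability

/-! ### Maximal inequality for martingale differences. -/

section Maximal

variable {Ω : Type*} {m0 : MeasurableSpace Ω} {μ : Measure Ω} [IsProbabilityMeasure μ]

/-- Kolmogorov's maximal inequality for square-integrable martingale differences. -/
theorem measure_exists_le_abs_sum_le (ℱ : Filtration ℕ m0) {ξ : ℕ → Ω → ℝ}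
    (hξ : ∀ j, StronglyMeasurable[ℱ (j + 1)] (ξ j)) (hL : ∀ j, MemLp (ξ j) 2 μ)
    (hc : ∀ j, μ[ξ j | ℱ j] =ᵐ[μ] 0) (n : ℕ) {a : ℝ} (ha : 0 < a) :
    μ {ω | ∃ m ≤ n, a ≤ |∑ j ∈ Finset.range m, ξ j ω|} ≤
      ENNReal.ofReal ((∑ j ∈ Finset.range n, ∫ ω, ξ j ω ^ 2 ∂μ) / a ^ 2) := by
  set S : ℕ → Ω → ℝ := fun m => ∑ j ∈ Finset.range m, ξ j with hS
  have hSm : ∀ m, StronglyMeasurable[ℱ m] (S m) := fun m =>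
    Finset.stronglyMeasurable_sum _ fun j hj =>
      (hξ j).mono (ℱ.mono (Finset.mem_range.1 hj))
  have hSL : ∀ m, MemLp (S m) 2 μ := fun m => memLp_finsetSum' _ fun j _ => hL j
  have hSint : ∀ m, Integrable (fun ω => S m ω ^ 2) μ := fun m => (hSL m).integrable_sq
  have hsucc : ∀ m ω, S (m + 1) ω ^ 2 - S m ω ^ 2 = 2 * (S m ω * ξ m ω) + ξ m ω ^ 2 := by
    intro m ω
    simp only [hS, Finset.sum_range_succ, Pi.add_apply]
    ring
  have hmulint : ∀ m, Integrable (S m * ξ m) μ := fun m => (hSL m).integrable_mul (hL m)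
  have hmul : ∀ m, μ[S m * ξ m | ℱ m] =ᵐ[μ] 0 := by
    intro m
    filter_upwards [condExp_mul_of_stronglyMeasurable_left (hSm m) (hmulint m)
      ((hL m).integrable one_le_two), hc m] with ω h1 h2
    rw [h1, Pi.mul_apply, h2]
    simp
  -- The cross term `S m * ξ m` has conditional mean zero; this gives both the submartingale
  -- property and the additivity of variances in `hvar`.
  have hsub : Submartingale (fun m ω => S m ω ^ 2) ℱ μ := by
    refine submartingale_of_condExp_sub_nonneg_nat (fun m => (hSm m).pow 2) hSint fun m => ?_
    have e : ((fun ω => S (m + 1) ω ^ 2) - fun ω => S m ω ^ 2) =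
        (2 : ℝ) • (S m * ξ m) + fun ω => ξ m ω ^ 2 := by
      funext ω
      simp only [Pi.sub_apply, Pi.add_apply, Pi.smul_apply, Pi.mul_apply, smul_eq_mul]
      exact hsucc m ω
    have h1 : 0 ≤ᵐ[μ] μ[fun ω => ξ m ω ^ 2 | ℱ m] :=
      condExp_nonneg (Eventually.of_forall fun ω => sq_nonneg _)
    rw [e]
    filter_upwards [condExp_add ((hmulint m).smul (2 : ℝ)) (hL m).integrable_sq (ℱ m),
      condExp_smul (2 : ℝ) (S m * ξ m) (ℱ m) (μ := μ), hmul m, h1] with ω h2 h3 h4 h5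
    rw [h2, Pi.add_apply, h3, Pi.smul_apply, h4]
    simpa using h5
  have hvar : ∀ m, ∫ ω, S m ω ^ 2 ∂μ = ∑ j ∈ Finset.range m, ∫ ω, ξ j ω ^ 2 ∂μ := by
    intro m
    induction m with
    | zero => simp [hS]
    | succ m ih =>
      have h0 : ∫ ω, (S m * ξ m) ω ∂μ = 0 := by
        rw [← integral_condExp (ℱ.le m), integral_congr_ae (hmul m)]
        simp
      have h1 : ∫ ω, S (m + 1) ω ^ 2 ∂μ =
          ∫ ω, S m ω ^ 2 + (2 * (S m * ξ m) ω + ξ m ω ^ 2) ∂μ := by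
        refine integral_congr_ae (Eventually.of_forall fun ω => ?_)
        have := hsucc m ω
        simp only [Pi.mul_apply]
        linarith
      have hi2 : Integrable (fun ω => 2 * (S m * ξ m) ω) μ := (hmulint m).const_mul 2
      have hi3 : Integrable (fun ω => 2 * (S m * ξ m) ω + ξ m ω ^ 2) μ :=
        hi2.add (hL m).integrable_sq
      rw [Finset.sum_range_succ, ← ih, h1, integral_add (hSint m) hi3,
        integral_add hi2 (hL m).integrable_sq, integral_const_mul, h0]
      ring
  have hmax := maximal_ineq hsub (fun m ω => sq_nonneg _) (ε := NNReal.mk (a ^ 2) (by positivity)) n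
  set T := {ω | ((NNReal.mk (a ^ 2) (by positivity) : NNReal) : ℝ) ≤ (Finset.range (n + 1)).sup'
    Finset.nonempty_range_add_one fun k => S k ω ^ 2} with hT
  have hsubset : {ω | ∃ m ≤ n, a ≤ |∑ j ∈ Finset.range m, ξ j ω|} ⊆ T := by
    rintro ω ⟨m, hm, hma⟩
    have h1 : a ^ 2 ≤ S m ω ^ 2 := by
      have e : S m ω = ∑ j ∈ Finset.range m, ξ j ω := by simp [hS]
      rw [e, ← sq_abs (∑ j ∈ Finset.range m, ξ j ω)]
      gcongr
    exact h1.trans (Finset.le_sup' (fun k => S k ω ^ 2) (Finset.mem_range.2 (by lia)))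
  refine (measure_mono hsubset).trans ?_
  have h2 : ENNReal.ofReal (a ^ 2) * μ T ≤ ENNReal.ofReal (∫ ω, S n ω ^ 2 ∂μ) := by
    have e : ENNReal.ofReal (a ^ 2) = ((NNReal.mk (a ^ 2) (by positivity) : NNReal) : ENNReal) := by
      rw [ENNReal.ofReal_eq_coe_nnreal (by positivity)]
    rw [e]
    refine hmax.trans (ENNReal.ofReal_le_ofReal ?_)
    exact setIntegral_le_integral (hSint n) (Eventually.of_forall fun ω => sq_nonneg _)
  rw [hvar] at h2
  rw [ENNReal.ofReal_div_of_pos (by positivity), ENNReal.le_div_iff_mul_le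
    (Or.inl (by simpa using ha.ne')) (Or.inl ENNReal.ofReal_ne_top), mul_comm]
  exact h2

end Maximal

/-! ### Conditional independence tested on bounded functions. -/

section CondExp

variable {Ω : Type*} {m m0 : MeasurableSpace Ω} {μ : Measure Ω} [IsProbabilityMeasure μ]

theorem ofReal_ge_measure_of_integral_le {Z : Ω → ℝ} (hZ : Integrable Z μ) (h0 : 0 ≤ᵐ[μ] Z)
    {r a : ℝ} (ha : 0 < a) (hr : ∫ ω, Z ω ∂μ ≤ r) : μ {ω | a ≤ Z ω} ≤ ENNReal.ofReal (r / a) := by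
  have h := (mul_meas_ge_le_integral_of_nonneg h0 hZ a).trans hr
  rw [← ENNReal.ofReal_toReal (measure_ne_top μ {ω | a ≤ Z ω})]
  exact ENNReal.ofReal_le_ofReal ((le_div_iff₀' ha).2 h)

/-- The hypothesis is the case of an indicator `φ`. Linearity extends it to simple functions, and
bounded approximation with dominated convergence for conditional expectations to bounded measurable
`φ`. -/
theorem condExp_sub_mul_comp_eq_zero {E : Type*} [MeasurableSpace E] {X : Ω → E}
    (hX : Measurable X) {f : Ω → ℝ} (hf : Integrable f μ)
    (hfb : ∀ ω, |f ω| ≤ 1)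
    (h : ∀ B, MeasurableSet B → μ[fun ω => f ω * (X ⁻¹' B).indicator (fun _ => (1 : ℝ)) ω | m] =ᵐ[μ]
      μ[f | m] * μ[(X ⁻¹' B).indicator (fun _ => (1 : ℝ)) | m])
    {φ : E → ℝ} (hφ : Measurable φ) {b : ℝ} (hb : ∀ x, |φ x| ≤ b) :
    μ[fun ω => (f ω - μ[f | m] ω) * φ (X ω) | m] =ᵐ[μ] 0 := by
  set g := μ[f | m] with hg
  have hgb : ∀ᵐ ω ∂μ, |g ω| ≤ 1 := ae_bdd_abs_condExp_of_ae_bdd_abs (Eventually.of_forall hfb)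
  have hgm : StronglyMeasurable[m] g := stronglyMeasurable_condExp
  have hfg : Integrable (fun ω => f ω - g ω) μ := hf.sub integrable_condExp
  have hfgb : ∀ᵐ ω ∂μ, ‖f ω - g ω‖ ≤ 2 := by
    filter_upwards [hgb] with ω hω
    have := abs_sub (f ω) (g ω)
    rw [Real.norm_eq_abs]
    linarith [hfb ω]
  have hint : ∀ s : SimpleFunc E ℝ, Integrable (fun ω => (f ω - g ω) * s (X ω)) μ := by
    intro s
    obtain ⟨C, hC⟩ := s.exists_forall_norm_le
    exact hfg.mul_bdd (c := C) ((s.measurable.comp hX).aestronglyMeasurable)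
      (Eventually.of_forall fun ω => hC _)
  have hsimple : ∀ s : SimpleFunc E ℝ, μ[fun ω => (f ω - g ω) * s (X ω) | m] =ᵐ[μ] 0 := by
    intro s
    induction s using SimpleFunc.induction with
    | const c hB =>
      rename_i B
      set i := (X ⁻¹' B).indicator (fun _ => (1 : ℝ)) with hi
      have hBm := hX hB
      have hii : Integrable i μ := (integrable_const (1 : ℝ)).indicator hBm
      have hib : ∀ ω, ‖i ω‖ ≤ 1 := fun ω => by
        simp only [hi, Set.indicator]
        split_ifs <;> simp
      have e : (fun ω => (f ω - g ω) * (SimpleFunc.piecewise B hB (SimpleFunc.const E c)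
          (SimpleFunc.const E 0)) (X ω)) = c • ((fun ω => f ω * i ω) - g * i) := by
        funext ω
        by_cases hω : X ω ∈ B
        · simp [hi, hω]; ring
        · simp [hi, hω]
      have hfi : Integrable (fun ω => f ω * i ω) μ :=
        hf.mul_bdd (c := 1) hii.aestronglyMeasurable (Eventually.of_forall hib)
      have hgi : Integrable (g * i) μ :=
        integrable_condExp.mul_bdd (c := 1) hii.aestronglyMeasurable (Eventually.of_forall hib)
      rw [e]
      filter_upwards [condExp_smul (μ := μ) c ((fun ω => f ω * i ω) - g * i) m,
        condExp_sub hfi hgi m, condExp_mul_of_stronglyMeasurable_left hgm hgi hii,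
        h B hB] with ω h1 h2 h3 h4
      rw [h1, Pi.smul_apply, h2, Pi.sub_apply, h3, h4, sub_self, smul_zero, Pi.zero_apply]
    | add hdis h1 h2 =>
      rename_i s t
      have e : (fun ω => (f ω - g ω) * (s + t) (X ω)) =
          (fun ω => (f ω - g ω) * s (X ω)) + fun ω => (f ω - g ω) * t (X ω) := by
        funext ω
        simp [mul_add]
      rw [e]
      filter_upwards [condExp_add (hint s) (hint t) m, h1, h2] with ω h3 h4 h5
      rw [h3, Pi.add_apply, h4, h5]
      simp
  have hφs := hφ.stronglyMeasurable
  have hlim := tendsto_condExp_unique (m := m) (μ := μ)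
    (fun n ω => (f ω - g ω) * hφs.approxBounded b n (X ω)) (fun _ _ => (0 : ℝ))
    (fun ω => (f ω - g ω) * φ (X ω)) (fun _ => 0) (fun n => hint _)
    (fun n => integrable_zero _ _ _)
    (Eventually.of_forall fun ω => (hφs.tendsto_approxBounded_of_norm_le (hb (X ω))).const_mul _)
    (Eventually.of_forall fun ω => tendsto_const_nhds) (fun _ => 2 * b) (integrable_const _)
    (fun _ => 0) (integrable_zero _ _ _) (fun n => ?_) (fun n => by simp) (fun n => ?_)
  · refine hlim.trans ?_
    rw [show (fun _ : Ω => (0 : ℝ)) = 0 from rfl, condExp_zero]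
  · filter_upwards [hfgb] with ω hω
    rw [norm_mul]
    have hb0 : 0 ≤ b := (abs_nonneg _).trans (hb (X ω))
    exact mul_le_mul hω (hφs.norm_approxBounded_le hb0 n _) (norm_nonneg _) zero_le_two
  · refine (hsimple _).trans ?_
    rw [show (fun _ : Ω => (0 : ℝ)) = 0 from rfl, condExp_zero]

end CondExp

/-! ### Predictable cutoffs and domination by the compensator. -/

section Truncation

variable {Ω : Type*} {m0 : MeasurableSpace Ω} {μ : Measure Ω}

open Classical in
/-- The indicator that the compensator of `N` has not exceeded `r` by stage `j + 1`. -/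
noncomputable def predictableCutoff (μ : Measure Ω) (ℱ : Filtration ℕ m0) (N : ℕ → Ω → ℝ) (r : ℝ)
    (j : ℕ) (ω : Ω) : ℝ :=
  if ∑ i ∈ Finset.range (j + 1), (μ[N i | ℱ i]) ω ≤ r then 1 else 0

variable {ℱ : Filtration ℕ m0} {N : ℕ → Ω → ℝ}

theorem predictableCutoff_mem (r : ℝ) (j : ℕ) (ω : Ω) :
    0 ≤ predictableCutoff μ ℱ N r j ω ∧ predictableCutoff μ ℱ N r j ω ≤ 1 := by
  unfold predictableCutoff
  split_ifs <;> simp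

/-- The compensator including its term of index `j` is already known at time `j`. Predictability
lets the cutoff be pulled out of conditional expectations given `ℱ j`, so it preserves martingale
differences. -/
theorem stronglyMeasurable_predictableCutoff (r : ℝ) (j : ℕ) :
    StronglyMeasurable[ℱ j] (predictableCutoff μ ℱ N r j) := by
  have h : StronglyMeasurable[ℱ j] fun ω => ∑ i ∈ Finset.range (j + 1), (μ[N i | ℱ i]) ω :=
    Finset.stronglyMeasurable_fun_sum _ fun i hi =>
      stronglyMeasurable_condExp.mono (ℱ.mono (Nat.lt_succ_iff.1 (Finset.mem_range.1 hi)))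
  exact StronglyMeasurable.ite (h.measurable measurableSet_Iic) stronglyMeasurable_const
    stronglyMeasurable_const

theorem predictableCutoff_eq_one {r : ℝ} {n : ℕ} {ω : Ω} (h0 : ∀ i, 0 ≤ (μ[N i | ℱ i]) ω)
    (hr : ∑ i ∈ Finset.range n, (μ[N i | ℱ i]) ω ≤ r) {j : ℕ} (hj : j < n) :
    predictableCutoff μ ℱ N r j ω = 1 := by
  refine if_pos (le_trans ?_ hr)
  exact Finset.sum_le_sum_of_subset_of_nonneg (Finset.range_mono hj) fun i _ _ => h0 i

theorem sum_predictableCutoff_mul_le {r : ℝ} (hr : 0 ≤ r) {ω : Ω}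
    (h0 : ∀ i, 0 ≤ (μ[N i | ℱ i]) ω) (n : ℕ) :
    ∑ j ∈ Finset.range n, predictableCutoff μ ℱ N r j ω * (μ[N j | ℱ j]) ω ≤ r := by
  induction n with
  | zero => simpa using hr
  | succ n ih =>
    rw [Finset.sum_range_succ]
    by_cases h : ∑ i ∈ Finset.range (n + 1), (μ[N i | ℱ i]) ω ≤ r
    · rw [← Finset.sum_range_succ]
      refine le_trans (Finset.sum_le_sum fun j _ => ?_) h
      exact mul_le_of_le_one_left (h0 j) (predictableCutoff_mem r j ω).2
    · have : predictableCutoff μ ℱ N r n ω = 0 := if_neg h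
      rw [this, zero_mul, add_zero]
      exact ih

theorem ae_forall_condExp_nonneg (hN0 : ∀ j, 0 ≤ᵐ[μ] N j) :
    ∀ᵐ ω ∂μ, ∀ j, 0 ≤ (μ[N j | ℱ j]) ω :=
  ae_all_iff.2 fun j => condExp_nonneg (hN0 j)

theorem integrable_predictableCutoff_mul (r : ℝ) (j : ℕ) {Z : Ω → ℝ} (hZ : Integrable Z μ) :
    Integrable (fun ω => predictableCutoff μ ℱ N r j ω * Z ω) μ :=
  hZ.bdd_mul (c := 1)
    ((stronglyMeasurable_predictableCutoff r j).mono (ℱ.le j)).aestronglyMeasurable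
    (Eventually.of_forall fun ω => by
      rw [Real.norm_of_nonneg (predictableCutoff_mem r j ω).1]
      exact (predictableCutoff_mem r j ω).2)

variable [IsProbabilityMeasure μ]

theorem integral_predictableCutoff_mul (r : ℝ) (j : ℕ) {Z : Ω → ℝ} (hZ : Integrable Z μ) :
    ∫ ω, predictableCutoff μ ℱ N r j ω * Z ω ∂μ =
      ∫ ω, predictableCutoff μ ℱ N r j ω * (μ[Z | ℱ j]) ω ∂μ := by
  rw [← integral_condExp (ℱ.le j)]
  exact integral_congr_ae (condExp_mul_of_stronglyMeasurable_left
    (stronglyMeasurable_predictableCutoff r j) (integrable_predictableCutoff_mul r j hZ) hZ)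

theorem sum_integral_predictableCutoff_mul_condExp_le (hN0 : ∀ j, 0 ≤ᵐ[μ] N j) {r : ℝ}
    (hr : 0 ≤ r) (n : ℕ) :
    ∑ j ∈ Finset.range n, ∫ ω, predictableCutoff μ ℱ N r j ω * (μ[N j | ℱ j]) ω ∂μ ≤ r := by
  have hi : ∀ j ∈ Finset.range n,
      Integrable (fun ω => predictableCutoff μ ℱ N r j ω * (μ[N j | ℱ j]) ω) μ :=
    fun j _ => integrable_predictableCutoff_mul r j integrable_condExp
  rw [← integral_finsetSum _ hi]
  have h : ∫ _ω, r ∂μ = r := by simp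
  conv_rhs => rw [← h]
  refine integral_mono_ae (integrable_finsetSum _ hi) (integrable_const _) ?_
  filter_upwards [ae_forall_condExp_nonneg hN0] with ω hω
  exact sum_predictableCutoff_mul_le hr hω n

/-- Lenglart's domination inequality for sums of nonnegative variables. -/
theorem measure_le_sum_le (hN : ∀ j, Integrable (N j) μ) (hN0 : ∀ j, 0 ≤ᵐ[μ] N j) {r a : ℝ}
    (hr : 0 ≤ r) (ha : 0 < a) (n : ℕ) :
    μ {ω | a ≤ ∑ j ∈ Finset.range n, N j ω} ≤
      μ {ω | r < ∑ j ∈ Finset.range n, (μ[N j | ℱ j]) ω} + ENNReal.ofReal (r / a) := by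
  -- The cut sum has expectation at most `r`, so Markov's inequality applies; it equals the full sum
  -- unless the compensator exceeds `r`.
  set W : Ω → ℝ := fun ω => ∑ j ∈ Finset.range n, predictableCutoff μ ℱ N r j ω * N j ω with hW
  have hi : ∀ j ∈ Finset.range n, Integrable (fun ω => predictableCutoff μ ℱ N r j ω * N j ω) μ :=
    fun j _ => integrable_predictableCutoff_mul r j (hN j)
  have h1 : μ {ω | a ≤ W ω} ≤ ENNReal.ofReal (r / a) := by
    refine ofReal_ge_measure_of_integral_le (integrable_finsetSum _ hi) ?_ ha ?_
    · filter_upwards [ae_all_iff.2 hN0] with ω hω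
      exact Finset.sum_nonneg fun j _ => mul_nonneg (predictableCutoff_mem r j ω).1 (hω j)
    · rw [integral_finsetSum _ hi,
        Finset.sum_congr rfl fun j _ => integral_predictableCutoff_mul r j (hN j)]
      exact sum_integral_predictableCutoff_mul_condExp_le hN0 hr n
  refine le_trans (le_trans (measure_mono_ae ?_) (measure_union_le _ _)) (add_le_add le_rfl h1)
  filter_upwards [ae_forall_condExp_nonneg (ℱ := ℱ) hN0] with ω hω h2
  by_contra hcon
  obtain ⟨h3, h4⟩ := not_or.1 hcon
  have h3' : ∑ j ∈ Finset.range n, (μ[N j | ℱ j]) ω ≤ r := not_lt.1 h3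
  refine h4 ?_
  have : W ω = ∑ j ∈ Finset.range n, N j ω := Finset.sum_congr rfl fun j hj => by
    rw [predictableCutoff_eq_one hω h3' (Finset.mem_range.1 hj), one_mul]
  change a ≤ W ω
  rw [this]
  exact h2

end Truncation

/-! ### Histories and running maxima. -/

section Histories

variable {d : ℕ} {Ω : Type*} {Y₀ : Ω → Fin d → ℝ} {J : ℕ → Ω → Fin d}
  {D : ℕ → Ω → Matrix (Fin d) (Fin d) ℝ}

theorem measurable_history_urn (n : ℕ) : Measurable[history Y₀ J D n] (urn Y₀ J D n) := by
  rw [measurable_iff_comap_le]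
  exact le_sup_of_le_left (le_iSup₂_of_le n (by simp) le_rfl)

theorem measurable_history_draw {n : ℕ} (hn : 1 ≤ n) :
    Measurable[history Y₀ J D n] (draw J n) := by
  rw [measurable_iff_comap_le]
  exact le_sup_of_le_right (le_sup_of_le_left (le_iSup₂_of_le n (by simp [hn]) le_rfl))

theorem measurable_history_matrix {n : ℕ} (hn : 1 ≤ n) :
    Measurable[history Y₀ J D n] (fun ω (q k : Fin d) => D n ω q k) := by
  rw [measurable_iff_comap_le]
  exact le_sup_of_le_right (le_sup_of_le_right (le_iSup₂_of_le n (by simp [hn]) le_rfl))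

theorem draw_apply_mem (m : ℕ) (ω : Ω) (k : Fin d) : draw J m ω k = 0 ∨ draw J m ω k = 1 := by
  by_cases h : k = J m ω
  · right; rw [draw, h, Pi.single_eq_same]
  · left; rw [draw, Pi.single_eq_of_ne h]

theorem abs_draw_le (m : ℕ) (ω : Ω) (k : Fin d) : |draw J m ω k| ≤ 1 := by
  rcases draw_apply_mem (J := J) m ω k with h | h <;> simp [h]

/-- `max_{m ≤ n} |f m|`. -/
noncomputable def runMax (f : ℕ → Ω → ℝ) (n : ℕ) (ω : Ω) : ℝ :=
  (Finset.range (n + 1)).sup' Finset.nonempty_range_add_one fun m => |f m ω|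

theorem le_runMax (f : ℕ → Ω → ℝ) {m n : ℕ} (hmn : m ≤ n) (ω : Ω) : |f m ω| ≤ runMax f n ω :=
  Finset.le_sup' (fun m => |f m ω|) (Finset.mem_range.2 (by lia))

theorem runMax_nonneg (f : ℕ → Ω → ℝ) (n : ℕ) (ω : Ω) : 0 ≤ runMax f n ω :=
  (abs_nonneg _).trans (le_runMax f (Nat.zero_le n) ω)

theorem sum_Icc_one_eq {M : Type*} [AddCommMonoid M] (f : ℕ → M) (n : ℕ) :
    ∑ m ∈ Finset.Icc 1 n, f m = ∑ j ∈ Finset.range n, f (j + 1) := by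
  induction n with
  | zero => simp
  | succ n ih => rw [Finset.sum_Icc_succ_top (by lia), ih, Finset.sum_range_succ]

end Histories

/-! ### The urn as an adapted process; draws against selection probabilities. -/

section UrnProcess

variable {d : ℕ} {Ω : Type*} [m0 : MeasurableSpace Ω] {μ : Measure Ω}
  {p : Fin d → ℝ} {Y₀ : Ω → Fin d → ℝ} {J : ℕ → Ω → Fin d}
  {D : ℕ → Ω → Matrix (Fin d) (Fin d) ℝ}

theorem IsUrn.measurable_draw (hU : IsUrn μ p Y₀ J D) {m : ℕ} (hm : 1 ≤ m) :
    Measurable (draw J m) :=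
  (measurable_of_finite fun i : Fin d => (Pi.single i 1 : Fin d → ℝ)).comp (hU.measurable_type m hm)

theorem IsUrn.measurable_matrix (hU : IsUrn μ p Y₀ J D) {m : ℕ} (hm : 1 ≤ m) :
    Measurable (fun ω (q k : Fin d) => D m ω q k) :=
  measurable_pi_lambda _ fun q => measurable_pi_lambda _ fun k => hU.measurable_entry m hm q k

theorem IsUrn.measurable_urn (hU : IsUrn μ p Y₀ J D) (m : ℕ) : Measurable (urn Y₀ J D m) := by
  induction m with
  | zero => exact hU.measurable_init
  | succ m ih =>
    refine ih.add (measurable_pi_lambda _ fun k => ?_)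
    simp only [Matrix.vecMul, dotProduct]
    exact Finset.measurable_sum _ fun q _ =>
      ((measurable_pi_apply q).comp (hU.measurable_draw (by lia))).mul
        (hU.measurable_entry (m + 1) (by lia) q k)

/-- The filtration of the histories. -/
noncomputable def IsUrn.filtration (hU : IsUrn μ p Y₀ J D) : Filtration ℕ m0 where
  seq := history Y₀ J D
  mono' := by
    intro i j hij
    refine sup_le_sup ?_ (sup_le_sup ?_ ?_)
    all_goals exact biSup_mono fun m hm => Finset.Icc_subset_Icc_right hij hm
  le' := by
    intro i
    refine sup_le (iSup₂_le fun m _ => (hU.measurable_urn m).comap_le)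
      (sup_le (iSup₂_le fun m hm => ?_) (iSup₂_le fun m hm => ?_))
    · exact (hU.measurable_draw (Finset.mem_Icc.1 hm).1).comap_le
    · exact (hU.measurable_matrix (Finset.mem_Icc.1 hm).1).comap_le

theorem measurable_proportion (p : Fin d → ℝ) (k : Fin d) :
    Measurable fun y : Fin d → ℝ => proportion p y k := by
  have hpos : ∀ k, Measurable fun y : Fin d → ℝ => pos y k := fun k =>
    (measurable_pi_apply k).max measurable_const
  have hsum : Measurable fun y : Fin d → ℝ => ∑ j, pos y j :=
    Finset.measurable_sum _ fun j _ => hpos j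
  have : (fun y : Fin d → ℝ => proportion p y k) =
      fun y => if ∑ j, pos y j = 0 then p k else (∑ j, pos y j)⁻¹ * pos y k := by
    funext y
    unfold proportion
    split_ifs <;> rfl
  rw [this]
  exact Measurable.ite (hsum (measurableSet_singleton 0)) measurable_const (hsum.inv.mul (hpos k))

theorem proportion_mem_Icc (hp : p ∈ stdSimplex ℝ (Fin d)) (y : Fin d → ℝ) (k : Fin d) :
    0 ≤ proportion p y k ∧ proportion p y k ≤ 1 := by
  refine ⟨(proportion_mem hp y).1 k, ?_⟩
  rw [← (proportion_mem hp y).2]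
  exact Finset.single_le_sum (fun j _ => (proportion_mem hp y).1 j) (Finset.mem_univ k)

theorem littleOInProb_runMax {f : ℕ → Ω → ℝ}
    (h : ∀ c : ℝ, 0 < c →
      Tendsto (fun n : ℕ => μ {ω | ∃ m ≤ n, c * n ≤ |f m ω|}) atTop (nhds 0)) :
    LittleOInProb μ (runMax f) := by
  refine littleOInProb_iff.2 fun c hc => (h c hc).congr fun n => ?_
  congr 1
  ext ω
  rw [Set.mem_ofPred_eq, Set.mem_ofPred_eq, abs_of_nonneg (runMax_nonneg f n ω), runMax,
    Finset.le_sup'_iff]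
  simp only [Finset.mem_range, Nat.lt_succ_iff]

variable [IsProbabilityMeasure μ]

theorem IsUrn.integrable_draw (hU : IsUrn μ p Y₀ J D) {m : ℕ} (hm : 1 ≤ m) (k : Fin d) :
    Integrable (fun ω => draw J m ω k) μ :=
  Integrable.of_bound ((measurable_pi_apply k).comp (hU.measurable_draw hm)).aestronglyMeasurable 1
    (Eventually.of_forall fun ω => abs_draw_le m ω k)

/-- The draws follow the selection probabilities up to `o(n)`, uniformly. -/
theorem IsUrn.littleOInProb_draw (hU : IsUrn μ p Y₀ J D) (k : Fin d) :
    LittleOInProb μ (runMax fun m ω =>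
      ∑ j ∈ Finset.range m, (draw J (j + 1) ω k - proportion p (urn Y₀ J D j ω) k)) := by
  set ξ : ℕ → Ω → ℝ := fun j ω => draw J (j + 1) ω k - proportion p (urn Y₀ J D j ω) k with hξ
  have hprop : ∀ j, StronglyMeasurable[hU.filtration j]
      fun ω => proportion p (urn Y₀ J D j ω) k := fun j =>
    ((measurable_proportion p k).comp (measurable_history_urn j)).stronglyMeasurable
  have hm : ∀ j, StronglyMeasurable[hU.filtration (j + 1)] (ξ j) := fun j =>
    (((measurable_pi_apply k).comp
      (measurable_history_draw (Y₀ := Y₀) (D := D) (by lia))).stronglyMeasurable).sub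
      ((hprop j).mono (hU.filtration.mono (Nat.le_succ j)))
  have hb : ∀ j ω, |ξ j ω| ≤ 1 := by
    intro j ω
    have h1 := proportion_mem_Icc hU.prob (urn Y₀ J D j ω) k
    rw [abs_le]
    rcases draw_apply_mem (J := J) (j + 1) ω k with h | h <;> simp only [hξ, h] <;>
      constructor <;> linarith
  have hL : ∀ j, MemLp (ξ j) 2 μ := fun j =>
    MemLp.of_bound ((hm j).mono (hU.filtration.le _)).aestronglyMeasurable 1
      (Eventually.of_forall (hb j))
  have hpi : ∀ j, Integrable (fun ω => proportion p (urn Y₀ J D j ω) k) μ := fun j =>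
    Integrable.of_bound ((hprop j).mono (hU.filtration.le _)).aestronglyMeasurable 1
      (Eventually.of_forall fun ω => by
        have h1 := proportion_mem_Icc hU.prob (urn Y₀ J D j ω) k
        rw [Real.norm_of_nonneg h1.1]; exact h1.2)
  have hc : ∀ j, μ[ξ j | hU.filtration j] =ᵐ[μ] 0 := by
    intro j
    filter_upwards [condExp_sub (hU.integrable_draw (m := j + 1) (by lia) k) (hpi j)
      (hU.filtration j), hU.selection (j + 1) (by lia) k] with ω h1 h2
    refine h1.trans ?_
    rw [Pi.sub_apply, condExp_of_stronglyMeasurable (hU.filtration.le j) (hprop j) (hpi j)]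
    exact sub_eq_zero.2 h2
  refine littleOInProb_runMax fun c hc0 => ?_
  have hlim : Tendsto (fun n : ℕ => ENNReal.ofReal ((c ^ 2)⁻¹ * (n : ℝ)⁻¹)) atTop (nhds 0) := by
    have := (ENNReal.tendsto_ofReal
      ((tendsto_inv_atTop_nhds_zero_nat (𝕜 := ℝ)).const_mul (c ^ 2)⁻¹))
    simpa using this
  refine tendsto_of_tendsto_of_tendsto_of_le_of_le' tendsto_const_nhds hlim
    (Eventually.of_forall fun _ => zero_le) ?_
  filter_upwards [eventually_gt_atTop 0] with n hn
  have hn0 : (0 : ℝ) < n := by exact_mod_cast hn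
  refine (measure_exists_le_abs_sum_le hU.filtration hm hL hc n (a := c * n)
    (by positivity)).trans (ENNReal.ofReal_le_ofReal ?_)
  -- The differences are bounded by one, so the maximal inequality at level `c n` gives `1 / (c²
  -- n)`.
  have h1 : ∑ j ∈ Finset.range n, ∫ ω, ξ j ω ^ 2 ∂μ ≤ n := by
    calc ∑ j ∈ Finset.range n, ∫ ω, ξ j ω ^ 2 ∂μ ≤ ∑ j ∈ Finset.range n, (1 : ℝ) := by
          refine Finset.sum_le_sum fun j _ => ?_
          have : ∫ _ω, (1 : ℝ) ∂μ = 1 := by simp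
          rw [← this]
          refine integral_mono (hL j).integrable_sq (integrable_const _) fun ω => ?_
          exact (sq_le_one_iff_abs_le_one _).2 (hb j ω)
      _ = n := by simp
  calc _ ≤ (n : ℝ) / (c * n) ^ 2 := by gcongr
    _ = _ := by field_simp

end UrnProcess

section Indicator

variable {d : ℕ} {Ω : Type*} {J : ℕ → Ω → Fin d}

theorem draw_apply_eq_indicator (m : ℕ) (q : Fin d) :
    (fun ω => draw J m ω q) = {ω | J m ω = q}.indicator fun _ => (1 : ℝ) := by
  funext ω
  by_cases h : J m ω = q
  · rw [Set.indicator_of_mem (by exact h), draw, h, Pi.single_eq_same]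
  · rw [Set.indicator_of_notMem (by exact h), draw, Pi.single_eq_of_ne (Ne.symm h)]

theorem indicator_inter_one {α : Type*} (s t : Set α) :
    (s ∩ t).indicator (fun _ => (1 : ℝ)) =
      fun x => s.indicator (fun _ => (1 : ℝ)) x * t.indicator (fun _ => (1 : ℝ)) x := by
  funext x
  by_cases h1 : x ∈ s <;> by_cases h2 : x ∈ t <;> simp [h1, h2]

end Indicator

/-! ### Truncated martingale sums. -/

section Martingale

variable {d : ℕ} {Ω : Type*} [m0 : MeasurableSpace Ω] {μ : Measure Ω}
  {p : Fin d → ℝ} {Y₀ : Ω → Fin d → ℝ} {J : ℕ → Ω → Fin d}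
  {D : ℕ → Ω → Matrix (Fin d) (Fin d) ℝ}

theorem measurable_matNorm_of : Measurable fun x : Fin d → Fin d → ℝ => matNorm (Matrix.of x) := by
  unfold matNorm
  refine Finset.measurable_sum _ fun q _ => Finset.measurable_sum _ fun k _ => ?_
  simp only [Matrix.of_apply]
  fun_prop

theorem IsUrn.integrable_matNorm (hU : IsUrn μ p Y₀ J D) {m : ℕ} (hm : 1 ≤ m) :
    Integrable (fun ω => matNorm (D m ω)) μ :=
  integrable_finsetSum _ fun q _ => integrable_finsetSum _ fun k _ =>
    (hU.integrable_entry m hm q k).abs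

theorem IsUrn.measurable_matNorm (hU : IsUrn μ p Y₀ J D) {m : ℕ} (hm : 1 ≤ m) :
    Measurable (fun ω => matNorm (D m ω)) :=
  measurable_matNorm_of.comp (hU.measurable_matrix hm)

theorem abs_condExp_le_condExp {m : MeasurableSpace Ω} {f g : Ω → ℝ} (hf : Integrable f μ)
    (hg : Integrable g μ) (h : ∀ ω, |f ω| ≤ g ω) : ∀ᵐ ω ∂μ, |(μ[f | m]) ω| ≤ (μ[g | m]) ω := by
  filter_upwards [abs_condExp_ae_le_condExp_abs (m := m) (μ := μ) f,
    condExp_mono (m := m) hf.abs hg (Eventually.of_forall h)] with ω h1 h2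
  exact h1.trans h2

variable [IsProbabilityMeasure μ]

/-- Conditional independence enters here: the draw `X_{j+1}` is not known at time `j`, so it cannot
simply be pulled out of the conditional expectation. -/
theorem IsUrn.condExp_draw_mul_sub (hU : IsUrn μ p Y₀ J D) (hI : CondIndepDraws μ Y₀ J D)
    {φ : (Fin d → Fin d → ℝ) → ℝ} (hφ : Measurable φ) {b : ℝ} (hb : ∀ x, |φ x| ≤ b) (j : ℕ)
    (q : Fin d) :
    μ[fun ω => draw J (j + 1) ω q * (φ (D (j + 1) ω) -
      (μ[fun ω' => φ (D (j + 1) ω') | hU.filtration j]) ω) | hU.filtration j] =ᵐ[μ] 0 := by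
  have hX := hU.measurable_matrix (m := j + 1) (by lia)
  have hdi := hU.integrable_draw (m := j + 1) (by lia) q
  set ℱ := hU.filtration
  set f : Ω → ℝ := fun ω => draw J (j + 1) ω q with hf
  set G : Ω → ℝ := fun ω => φ (D (j + 1) ω) with hG
  have hGm : AEStronglyMeasurable G μ := (hφ.comp hX).aestronglyMeasurable
  have hGi : Integrable G μ := Integrable.of_bound hGm b (Eventually.of_forall fun ω => hb _)
  have h0 : μ[fun ω => (f ω - (μ[f | ℱ j]) ω) * G ω | ℱ j] =ᵐ[μ] 0 := by
    refine condExp_sub_mul_comp_eq_zero (X := fun ω (q k : Fin d) => D (j + 1) ω q k) hX hdi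
      (fun ω => abs_draw_le _ _ _) (fun B hB => ?_) hφ hb
    have h1 := hI (j + 1) (by lia) q B hB
    have e : (fun ω => f ω * ((fun ω (q k : Fin d) => D (j + 1) ω q k) ⁻¹' B).indicator
        (fun _ => (1 : ℝ)) ω) = ({ω | J (j + 1) ω = q} ∩
          {ω | (fun q l => D (j + 1) ω q l) ∈ B}).indicator (fun _ => (1 : ℝ)) := by
      rw [indicator_inter_one, hf, draw_apply_eq_indicator]
      rfl
    rw [e, hf, draw_apply_eq_indicator]
    exact h1
  have hfm : AEStronglyMeasurable f μ := hdi.aestronglyMeasurable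
  have hfb : ∀ᵐ ω ∂μ, ‖f ω‖ ≤ 1 := Eventually.of_forall fun ω => abs_draw_le _ _ _
  have hGb : ∀ᵐ ω ∂μ, ‖G ω‖ ≤ b := Eventually.of_forall fun ω => hb _
  have hfG : Integrable (f * G) μ := hdi.mul_bdd hGm hGb
  have hgG : Integrable (μ[f | ℱ j] * G) μ := integrable_condExp.mul_bdd hGm hGb
  have hHf : Integrable (μ[G | ℱ j] * f) μ := integrable_condExp.mul_bdd hfm hfb
  -- The first summand has conditional mean zero by `h0`; each of the other two products has
  -- conditional mean `μ[f | ℱ j] * μ[G | ℱ j]`, so they cancel.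
  have e : (fun ω => f ω * (G ω - (μ[G | ℱ j]) ω)) =
      ((fun ω => (f ω - (μ[f | ℱ j]) ω) * G ω) + μ[f | ℱ j] * G) - μ[G | ℱ j] * f := by
    funext ω
    simp only [Pi.sub_apply, Pi.add_apply, Pi.mul_apply]
    ring
  have hi1 : Integrable (fun ω => (f ω - (μ[f | ℱ j]) ω) * G ω) μ :=
    (hdi.sub integrable_condExp).mul_bdd hGm hGb
  rw [e]
  filter_upwards [condExp_sub (hi1.add hgG) hHf (ℱ j), condExp_add hi1 hgG (ℱ j), h0,
    condExp_mul_of_stronglyMeasurable_left stronglyMeasurable_condExp hgG hGi,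
    condExp_mul_of_stronglyMeasurable_left stronglyMeasurable_condExp hHf hdi] with ω h1 h2 h3 h4 h5
  rw [h1, Pi.sub_apply, h2, Pi.add_apply, h3, h4, h5]
  simp [mul_comm]

/-- The entry `(q, k)` of a matrix, set to zero when the norm of the matrix is at least `a`. -/
noncomputable def truncEntry (a : ℝ) (q k : Fin d) (x : Fin d → Fin d → ℝ) : ℝ :=
  if matNorm (Matrix.of x) < a then x q k else 0

theorem measurable_truncEntry (a : ℝ) (q k : Fin d) : Measurable (truncEntry a q k) :=
  Measurable.ite (measurable_matNorm_of measurableSet_Iio)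
    ((measurable_pi_apply k).comp (measurable_pi_apply q)) measurable_const

theorem abs_truncEntry_le {a : ℝ} (ha : 0 ≤ a) (q k : Fin d) (x : Fin d → Fin d → ℝ) :
    |truncEntry a q k x| ≤ a := by
  unfold truncEntry
  split_ifs with h
  · exact (abs_le_matNorm (Matrix.of x) q k).trans h.le
  · simpa using ha

theorem abs_truncEntry_le_matNorm (a : ℝ) (q k : Fin d) (x : Fin d → Fin d → ℝ) :
    |truncEntry a q k x| ≤ matNorm (Matrix.of x) := by
  unfold truncEntry
  split_ifs with h
  · exact abs_le_matNorm (Matrix.of x) q k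
  · simpa using matNorm_nonneg (Matrix.of x)

/-- Truncation trades a second moment for a first one: `ξ_j² ≤ 2a |ξ_j|`, and `|ξ_j|` is at most the
cutoff times `‖D_{j+1}‖` plus its conditional mean. The cutoff keeps the expected sum of the
conditional means below `r`. -/
theorem IsUrn.measure_truncated_le (hU : IsUrn μ p Y₀ J D) (hI : CondIndepDraws μ Y₀ J D)
    (q k : Fin d) {a r c : ℝ} (ha : 0 ≤ a) (hr : 0 ≤ r) (hc : 0 < c) (n : ℕ) :
    μ {ω | ∃ m ≤ n, c ≤ |∑ j ∈ Finset.range m,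
      predictableCutoff μ hU.filtration (fun j ω => matNorm (D (j + 1) ω)) r j ω *
        (draw J (j + 1) ω q * (truncEntry a q k (D (j + 1) ω) -
          (μ[fun ω' => truncEntry a q k (D (j + 1) ω') | hU.filtration j]) ω))|} ≤
      ENNReal.ofReal (4 * a * r / c ^ 2) := by
  set ℱ := hU.filtration
  set N : ℕ → Ω → ℝ := fun j ω => matNorm (D (j + 1) ω) with hN
  set b := predictableCutoff μ ℱ N r with hb
  set G : ℕ → Ω → ℝ := fun j ω => truncEntry a q k (D (j + 1) ω) with hG
  set ξ : ℕ → Ω → ℝ := fun j ω =>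
    b j ω * (draw J (j + 1) ω q * (G j ω - (μ[G j | ℱ j]) ω)) with hξ
  have hNi : ∀ j, Integrable (N j) μ := fun j => hU.integrable_matNorm (by lia)
  have hN0 : ∀ j ω, 0 ≤ N j ω := fun j ω => matNorm_nonneg _
  have hGsm : ∀ j, StronglyMeasurable[ℱ (j + 1)] (G j) := fun j =>
    ((measurable_truncEntry a q k).comp (measurable_history_matrix (by lia))).stronglyMeasurable
  have hGa : ∀ j ω, |G j ω| ≤ a := fun j ω => abs_truncEntry_le ha q k _
  have hGN : ∀ j ω, |G j ω| ≤ N j ω := fun j ω => abs_truncEntry_le_matNorm a q k _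
  have hGi : ∀ j, Integrable (G j) μ := fun j =>
    Integrable.of_bound ((hGsm j).mono (ℱ.le _)).aestronglyMeasurable a
      (Eventually.of_forall (hGa j))
  have hHa : ∀ j, ∀ᵐ ω ∂μ, |(μ[G j | ℱ j]) ω| ≤ a := fun j =>
    ae_bdd_abs_condExp_of_ae_bdd_abs (Eventually.of_forall (hGa j))
  have hHR : ∀ j, ∀ᵐ ω ∂μ, |(μ[G j | ℱ j]) ω| ≤ (μ[N j | ℱ j]) ω := fun j =>
    abs_condExp_le_condExp (hGi j) (hNi j) (hGN j)
  have hbm : ∀ j, StronglyMeasurable[ℱ j] (b j) := stronglyMeasurable_predictableCutoff r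
  have hdm : ∀ j, StronglyMeasurable[ℱ (j + 1)] fun ω => draw J (j + 1) ω q := fun j =>
    ((measurable_pi_apply q).comp (measurable_history_draw (by lia))).stronglyMeasurable
  have hdiffm : ∀ j, StronglyMeasurable[ℱ (j + 1)]
      fun ω => draw J (j + 1) ω q * (G j ω - (μ[G j | ℱ j]) ω) := fun j =>
    (hdm j).mul ((hGsm j).sub (stronglyMeasurable_condExp.mono (ℱ.mono (Nat.le_succ j))))
  have hξm : ∀ j, StronglyMeasurable[ℱ (j + 1)] (ξ j) := fun j =>
    ((hbm j).mono (ℱ.mono (Nat.le_succ j))).mul (hdiffm j)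
  have hdiffb : ∀ j, ∀ᵐ ω ∂μ, ‖draw J (j + 1) ω q * (G j ω - (μ[G j | ℱ j]) ω)‖ ≤ 2 * a := by
    intro j
    filter_upwards [hHa j] with ω hω
    rw [norm_mul]
    calc _ ≤ 1 * (|G j ω| + |(μ[G j | ℱ j]) ω|) :=
          mul_le_mul (abs_draw_le _ _ _) (abs_sub _ _) (abs_nonneg _) zero_le_one
      _ ≤ _ := by linarith [hGa j ω]
  have hdiffi : ∀ j, Integrable (fun ω => draw J (j + 1) ω q * (G j ω - (μ[G j | ℱ j]) ω)) μ :=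
    fun j => Integrable.of_bound ((hdiffm j).mono (ℱ.le _)).aestronglyMeasurable _ (hdiffb j)
  have hξb : ∀ j, ∀ᵐ ω ∂μ, ‖ξ j ω‖ ≤ 2 * a := by
    intro j
    filter_upwards [hdiffb j] with ω hω
    rw [hξ, norm_mul]
    have h1 := predictableCutoff_mem (μ := μ) (ℱ := ℱ) (N := N) r j ω
    rw [Real.norm_of_nonneg h1.1]
    exact (mul_le_of_le_one_left (norm_nonneg _) h1.2).trans hω
  have hL : ∀ j, MemLp (ξ j) 2 μ := fun j =>
    MemLp.of_bound ((hξm j).mono (ℱ.le _)).aestronglyMeasurable _ (hξb j)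
  have hce : ∀ j, μ[ξ j | ℱ j] =ᵐ[μ] 0 := by
    intro j
    filter_upwards [condExp_mul_of_stronglyMeasurable_left (hbm j)
      (integrable_predictableCutoff_mul r j (hdiffi j)) (hdiffi j),
      hU.condExp_draw_mul_sub hI (measurable_truncEntry a q k) (abs_truncEntry_le ha q k) j q]
      with ω h1 h2
    refine h1.trans ?_
    rw [Pi.mul_apply]
    refine (congrArg (fun x => b j ω * x) h2).trans ?_
    simp
  refine (measure_exists_le_abs_sum_le ℱ hξm hL hce n hc).trans (ENNReal.ofReal_le_ofReal ?_)
  have hint : ∀ j, ∫ ω, ξ j ω ^ 2 ∂μ ≤ 4 * a * ∫ ω, b j ω * (μ[N j | ℱ j]) ω ∂μ := by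
    intro j
    have hi1 := integrable_predictableCutoff_mul (μ := μ) (ℱ := ℱ) (N := N) r j (hNi j)
    have hi2 := integrable_predictableCutoff_mul (μ := μ) (ℱ := ℱ) (N := N) r j
      (integrable_condExp (μ := μ) (f := N j) (m := ℱ j))
    have h1 : ∫ ω, ξ j ω ^ 2 ∂μ ≤
        ∫ ω, 2 * a * (b j ω * N j ω + b j ω * (μ[N j | ℱ j]) ω) ∂μ := by
      refine integral_mono_ae (hL j).integrable_sq ((hi1.add hi2).const_mul _) ?_
      filter_upwards [hξb j, hHR j] with ω h2 h3
      have hb1 := predictableCutoff_mem (μ := μ) (ℱ := ℱ) (N := N) r j ω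
      have h4 : |ξ j ω| ≤ b j ω * (N j ω + (μ[N j | ℱ j]) ω) := by
        rw [hξ, abs_mul, abs_of_nonneg hb1.1]
        refine mul_le_mul_of_nonneg_left ?_ hb1.1
        rw [abs_mul]
        calc _ ≤ 1 * (|G j ω| + |(μ[G j | ℱ j]) ω|) :=
              mul_le_mul (abs_draw_le _ _ _) (abs_sub _ _) (abs_nonneg _) zero_le_one
          _ ≤ _ := by linarith [hGN j ω]
      calc ξ j ω ^ 2 = |ξ j ω| * |ξ j ω| := by rw [← sq_abs, sq]
        _ ≤ (2 * a) * (b j ω * (N j ω + (μ[N j | ℱ j]) ω)) :=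
            mul_le_mul h2 h4 (abs_nonneg _) (by positivity)
        _ = _ := by ring
    refine h1.trans (le_of_eq ?_)
    rw [integral_const_mul, integral_add hi1 hi2, integral_predictableCutoff_mul r j (hNi j)]
    ring
  gcongr
  calc ∑ j ∈ Finset.range n, ∫ ω, ξ j ω ^ 2 ∂μ
      ≤ 4 * a * ∑ j ∈ Finset.range n, ∫ ω, b j ω * (μ[N j | ℱ j]) ω ∂μ := by
        rw [Finset.mul_sum]
        exact Finset.sum_le_sum fun j _ => hint j
    _ ≤ 4 * a * r := by
        gcongr
        exact sum_integral_predictableCutoff_mul_condExp_le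
          (fun j => Eventually.of_forall (hN0 j)) hr n

end Martingale

/-! ### Moment and tail conditions imply the martingale condition; uniform integrability. -/

section SufficientConditions

variable {d : ℕ} {Ω : Type*} {p : Fin d → ℝ} {Y₀ : Ω → Fin d → ℝ} {J : ℕ → Ω → Fin d}
  {D : ℕ → Ω → Matrix (Fin d) (Fin d) ℝ}

/-- The part of `‖D_{j+1}‖` at or above the level `a`. -/
noncomputable def matNormTail (D : ℕ → Ω → Matrix (Fin d) (Fin d) ℝ) (a : ℝ) (j : ℕ) : Ω → ℝ :=
  {ω | a ≤ matNorm (D (j + 1) ω)}.indicator fun ω => matNorm (D (j + 1) ω)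

theorem matNormTail_nonneg (a : ℝ) (j : ℕ) (ω : Ω) : 0 ≤ matNormTail D a j ω :=
  Set.indicator_nonneg (fun _ _ => matNorm_nonneg _) ω

theorem abs_sub_truncEntry_le (a : ℝ) (q k : Fin d) (j : ℕ) (ω : Ω) :
    |D (j + 1) ω q k - truncEntry a q k (D (j + 1) ω)| ≤ matNormTail D a j ω := by
  unfold truncEntry matNormTail
  by_cases h : matNorm (D (j + 1) ω) < a
  · rw [if_pos (by exact h), Set.indicator_of_notMem (by simpa using h), sub_self, abs_zero]
  · rw [if_neg (by exact h), Set.indicator_of_mem (by simpa using h), sub_zero]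
    exact abs_le_matNorm _ q k

variable [m0 : MeasurableSpace Ω] {μ : Measure Ω}

/-- The contribution of the entry `(q, k)` to the martingale `M_{m,2}`. -/
noncomputable def entrySum (μ : Measure Ω) (Y₀ : Ω → Fin d → ℝ) (J : ℕ → Ω → Fin d)
    (D : ℕ → Ω → Matrix (Fin d) (Fin d) ℝ) (q k : Fin d) (m : ℕ) (ω : Ω) : ℝ :=
  ∑ j ∈ Finset.range m, draw J (j + 1) ω q * (D (j + 1) ω q k -
    condMean μ Y₀ J D (j + 1) ω q k)

theorem IsUrn.integrable_matNormTail (hU : IsUrn μ p Y₀ J D) (a : ℝ) (j : ℕ) :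
    Integrable (matNormTail D a j) μ :=
  (hU.integrable_matNorm (by lia)).indicator
    (measurableSet_le measurable_const (hU.measurable_matNorm (by lia)))

theorem martSum_apply (m : ℕ) (ω : Ω) (k : Fin d) :
    martSum μ Y₀ J D m ω k = ∑ q, entrySum μ Y₀ J D q k m ω := by
  simp only [martSum, entrySum, Finset.sum_apply, Matrix.vecMul, dotProduct, Matrix.sub_apply]
  rw [sum_Icc_one_eq, Finset.sum_comm]

theorem integral_le_of_eLpNorm_le {f : Ω → ℝ} (hf : Integrable f μ) {c : ℝ} (hc : 0 ≤ c)
    (h : eLpNorm f 1 μ ≤ ENNReal.ofReal c) : ∫ ω, f ω ∂μ ≤ c := by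
  have h1 : ∫ ω, ‖f ω‖ ∂μ ≤ c := by
    rw [integral_norm_eq_lintegral_enorm hf.aestronglyMeasurable, ← eLpNorm_one_eq_lintegral_enorm]
    exact ENNReal.toReal_le_of_le_ofReal hc h
  exact (integral_mono hf hf.norm fun ω => le_abs_self _).trans h1

variable [IsProbabilityMeasure μ]

/-- The entry sum splits into the truncated martingale, the tails, and the conditional tails
produced by recentring; outside the listed events each contributes less than `c`. The tails are
controlled through their compensator, with level `s`, by `measure_le_sum_le`. -/
theorem IsUrn.measure_entrySum_le (hU : IsUrn μ p Y₀ J D) (hI : CondIndepDraws μ Y₀ J D)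
    (q k : Fin d) {a r s c : ℝ} (ha : 0 ≤ a) (hr : 0 ≤ r) (hs : 0 ≤ s) (hc : 0 < c) (n : ℕ) :
    μ {ω | ∃ m ≤ n, 3 * c ≤ |entrySum μ Y₀ J D q k m ω|} ≤
      (μ {ω | r < ∑ j ∈ Finset.range n,
        (μ[fun ω' => matNorm (D (j + 1) ω') | hU.filtration j]) ω} +
        ENNReal.ofReal (4 * a * r / c ^ 2)) +
      (μ {ω | s < ∑ j ∈ Finset.range n, (μ[matNormTail D a j | hU.filtration j]) ω} +
        ENNReal.ofReal (s / c) +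
        μ {ω | c ≤ ∑ j ∈ Finset.range n, (μ[matNormTail D a j | hU.filtration j]) ω}) := by
  set ℱ := hU.filtration with hℱ
  set N : ℕ → Ω → ℝ := fun j ω => matNorm (D (j + 1) ω) with hN
  have h1 := hU.measure_truncated_le hI q k ha hr hc n
  have h2 := measure_le_sum_le (ℱ := ℱ) (N := matNormTail D a) (hU.integrable_matNormTail a)
    (fun j => Eventually.of_forall (matNormTail_nonneg a j)) hs hc n
  refine le_trans (le_trans (measure_mono_ae ?_) (measure_union_le _ _))
    (add_le_add ((measure_union_le _ _).trans (add_le_add le_rfl h1))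
      ((measure_union_le _ _).trans (add_le_add h2 le_rfl)))
  have hDi : ∀ j, Integrable (fun ω => D (j + 1) ω q k) μ := fun j =>
    hU.integrable_entry (j + 1) (by lia) q k
  have hGi : ∀ j, Integrable (fun ω => truncEntry a q k (D (j + 1) ω)) μ := fun j =>
    Integrable.of_bound ((measurable_truncEntry a q k).comp
      (hU.measurable_matrix (by lia))).aestronglyMeasurable a
      (Eventually.of_forall fun ω => abs_truncEntry_le ha q k _)
  have hdiff : ∀ᵐ ω ∂μ, ∀ j, |condMean μ Y₀ J D (j + 1) ω q k -
      (μ[fun ω' => truncEntry a q k (D (j + 1) ω') | ℱ j]) ω| ≤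
      (μ[matNormTail D a j | ℱ j]) ω := by
    refine ae_all_iff.2 fun j => ?_
    filter_upwards [condExp_sub (hDi j) (hGi j) (ℱ j), abs_condExp_le_condExp (m := ℱ j)
      ((hDi j).sub (hGi j)) (hU.integrable_matNormTail a j)
      (abs_sub_truncEntry_le a q k j)] with ω h3 h4
    rw [h3] at h4
    exact h4
  filter_upwards [hdiff, ae_forall_condExp_nonneg (ℱ := ℱ) (N := N)
    (fun j => Eventually.of_forall fun ω => matNorm_nonneg _),
    ae_forall_condExp_nonneg (ℱ := ℱ) (N := matNormTail D a)
    (fun j => Eventually.of_forall (matNormTail_nonneg a j))] with ω h3 h4 h5 h6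
  by_contra hcon
  obtain ⟨hcon1, hcon2⟩ := not_or.1 hcon
  obtain ⟨h7, h8⟩ := not_or.1 hcon1
  obtain ⟨h9, h10⟩ := not_or.1 hcon2
  have h7' : ∑ j ∈ Finset.range n, (μ[N j | ℱ j]) ω ≤ r := not_lt.1 h7
  have h9' : ∑ j ∈ Finset.range n, matNormTail D a j ω < c := not_le.1 h9
  have h10' : ∑ j ∈ Finset.range n, (μ[matNormTail D a j | ℱ j]) ω < c := not_le.1 h10
  obtain ⟨m, hm, h11⟩ := h6
  have h12 : |∑ j ∈ Finset.range m, predictableCutoff μ ℱ N r j ω *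
      (draw J (j + 1) ω q * (truncEntry a q k (D (j + 1) ω) -
        (μ[fun ω' => truncEntry a q k (D (j + 1) ω') | ℱ j]) ω))| < c := by
    by_contra h13
    exact h8 ⟨m, hm, not_lt.1 h13⟩
  have e : entrySum μ Y₀ J D q k m ω = (∑ j ∈ Finset.range m, predictableCutoff μ ℱ N r j ω *
      (draw J (j + 1) ω q * (truncEntry a q k (D (j + 1) ω) -
        (μ[fun ω' => truncEntry a q k (D (j + 1) ω') | ℱ j]) ω))) +
      ∑ j ∈ Finset.range m, draw J (j + 1) ω q *
        ((D (j + 1) ω q k - truncEntry a q k (D (j + 1) ω)) -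
          (condMean μ Y₀ J D (j + 1) ω q k -
            (μ[fun ω' => truncEntry a q k (D (j + 1) ω') | ℱ j]) ω)) := by
    rw [entrySum, ← Finset.sum_add_distrib]
    refine Finset.sum_congr rfl fun j hj => ?_
    rw [predictableCutoff_eq_one h4 h7' ((Finset.mem_range.1 hj).trans_le hm)]
    ring
  have h13 : |∑ j ∈ Finset.range m, draw J (j + 1) ω q *
        ((D (j + 1) ω q k - truncEntry a q k (D (j + 1) ω)) -
          (condMean μ Y₀ J D (j + 1) ω q k -
            (μ[fun ω' => truncEntry a q k (D (j + 1) ω') | ℱ j]) ω))| < c + c := by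
    refine lt_of_le_of_lt (Finset.abs_sum_le_sum_abs _ _) (lt_of_le_of_lt ?_ (add_lt_add h9' h10'))
    rw [← Finset.sum_add_distrib]
    refine le_trans (Finset.sum_le_sum fun j _ => ?_)
      (Finset.sum_le_sum_of_subset_of_nonneg (Finset.range_mono hm)
        fun j _ _ => add_nonneg (matNormTail_nonneg a j ω) (h5 j))
    rw [abs_mul]
    calc _ ≤ 1 * (|D (j + 1) ω q k - truncEntry a q k (D (j + 1) ω)| +
          |condMean μ Y₀ J D (j + 1) ω q k -
            (μ[fun ω' => truncEntry a q k (D (j + 1) ω') | ℱ j]) ω|) :=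
          mul_le_mul (abs_draw_le _ _ _) (abs_sub _ _) (abs_nonneg _) zero_le_one
      _ ≤ _ := by
          rw [one_mul]
          exact add_le_add (abs_sub_truncEntry_le a q k j ω) (h3 j)
  have h14 := abs_add_le (∑ j ∈ Finset.range m, predictableCutoff μ ℱ N r j ω *
      (draw J (j + 1) ω q * (truncEntry a q k (D (j + 1) ω) -
        (μ[fun ω' => truncEntry a q k (D (j + 1) ω') | ℱ j]) ω)))
      (∑ j ∈ Finset.range m, draw J (j + 1) ω q *
        ((D (j + 1) ω q k - truncEntry a q k (D (j + 1) ω)) -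
          (condMean μ Y₀ J D (j + 1) ω q k -
            (μ[fun ω' => truncEntry a q k (D (j + 1) ω') | ℱ j]) ω)))
  rw [← e] at h14
  linarith

theorem IsUrn.littleOInProb_entrySum (hU : IsUrn μ p Y₀ J D) (hI : CondIndepDraws μ Y₀ J D)
    (hM : MomentCondition μ Y₀ J D) (hT : TailCondition μ Y₀ J D) (q k : Fin d) :
    LittleOInProb μ (runMax (entrySum μ Y₀ J D q k)) := by
  refine littleOInProb_runMax fun γ hγ => ENNReal.tendsto_nhds_zero.2 fun θ hθ => ?_
  have hθ5 : 0 < θ / 5 := ENNReal.div_pos hθ.ne' (by simp)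
  obtain ⟨t, ht0, htθ⟩ := ENNReal.lt_iff_exists_nnreal_btwn.1 hθ5
  have ht0' : (0 : ℝ) < t := by exact_mod_cast ht0
  have htle : ENNReal.ofReal t ≤ θ / 5 := by
    rw [ENNReal.ofReal_coe_nnreal]; exact htθ.le
  obtain ⟨C₀, hC₀⟩ := hM (θ / 5) hθ5
  set C := max C₀ 0 with hC
  have hC0 : 0 ≤ C := le_max_right _ _
  set c := γ / 3 with hc
  have hc0 : 0 < c := by positivity
  -- With truncation level `a = ε n` and `r = C n`, this makes `4 a r / (c n)² ≤ t`. The choice `s =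
  -- t c n` makes the Lenglart term equal to `t`.
  set ε := t * c ^ 2 / (4 * (C + 1)) with hε
  have hε0 : 0 < ε := by positivity
  have hT' := littleOInProb_iff.1 (hT ε hε0)
  have ht1 := ENNReal.tendsto_nhds_zero.1 (hT' (t * c) (by positivity)) (θ / 5) hθ5
  have ht2 := ENNReal.tendsto_nhds_zero.1 (hT' c hc0) (θ / 5) hθ5
  filter_upwards [hC₀, ht1, ht2, eventually_gt_atTop 0] with n h1 h2 h3 hn
  have hn0 : (0 : ℝ) < n := by exact_mod_cast hn
  have hmain := hU.measure_entrySum_le hI q k (a := ε * n) (r := C * n) (s := t * c * n)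
    (c := c * n) (by positivity) (by positivity) (by positivity) (by positivity) n
  have e1 : 3 * (c * n) = γ * n := by rw [hc]; ring
  rw [e1] at hmain
  refine hmain.trans ?_
  have hsum : θ = (θ / 5 + θ / 5) + (θ / 5 + θ / 5 + θ / 5) := by
    have : (θ / 5 + θ / 5) + (θ / 5 + θ / 5 + θ / 5) = 5 * (θ / 5) := by ring
    rw [this, ENNReal.mul_div_cancel (by simp) (by simp)]
  rw [hsum]
  refine add_le_add (add_le_add ?_ ?_) (add_le_add (add_le_add ?_ ?_) ?_)
  · refine le_trans (measure_mono fun ω hω => ?_) h1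
    rw [Set.mem_ofPred_eq] at hω ⊢
    rw [sum_Icc_one_eq]
    refine lt_of_le_of_lt ?_ (hω.trans_le (le_abs_self _))
    exact mul_le_mul_of_nonneg_right (le_max_left _ _) hn0.le
  · refine le_trans (ENNReal.ofReal_le_ofReal ?_) htle
    rw [div_le_iff₀ (by positivity), hε]
    have e : 4 * (t * c ^ 2 / (4 * (C + 1)) * n) * (C * n) =
        t * (c * n) ^ 2 * (C / (C + 1)) := by
      field_simp
    rw [e]
    refine mul_le_of_le_one_right (by positivity) ?_
    rw [div_le_one (by positivity)]
    linarith
  · refine le_trans (measure_mono fun ω hω => ?_) h2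
    rw [Set.mem_ofPred_eq] at hω ⊢
    rw [sum_Icc_one_eq]
    exact hω.le.trans (le_abs_self _)
  · refine le_trans (ENNReal.ofReal_le_ofReal ?_) htle
    rw [mul_assoc, mul_div_assoc, div_self (by positivity), mul_one]
  · refine le_trans (measure_mono fun ω hω => ?_) h3
    rw [Set.mem_ofPred_eq] at hω ⊢
    rw [sum_Icc_one_eq]
    exact le_trans hω (le_abs_self _)

theorem IsUrn.martingaleCondition (hU : IsUrn μ p Y₀ J D) (hI : CondIndepDraws μ Y₀ J D)
    (hM : MomentCondition μ Y₀ J D) (hT : TailCondition μ Y₀ J D) :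
    MartingaleCondition μ Y₀ J D := by
  have h := LittleOInProb.sum Finset.univ fun k _ => LittleOInProb.sum Finset.univ fun q _ =>
    hU.littleOInProb_entrySum hI hM hT q k
  refine h.mono (Eventually.of_forall fun n => Eventually.of_forall fun ω => ?_)
  have h0 : 0 ≤ ∑ k : Fin d, ∑ q : Fin d, runMax (entrySum μ Y₀ J D q k) n ω :=
    Finset.sum_nonneg fun k _ => Finset.sum_nonneg fun q _ => runMax_nonneg _ _ _
  rw [abs_of_nonneg h0, NNReal.abs_eq]
  have : (Finset.Icc 1 n).sup (fun m => ‖martSum μ Y₀ J D m ω‖₊) ≤ NNReal.mk _ h0 := by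
    refine Finset.sup_le fun m hm => ?_
    rw [← NNReal.coe_le_coe, coe_nnnorm]
    refine (pi_norm_le_iff_of_nonneg h0).2 fun k => ?_
    rw [martSum_apply]
    calc ‖∑ q, entrySum μ Y₀ J D q k m ω‖ ≤ ∑ q, |entrySum μ Y₀ J D q k m ω| :=
          norm_sum_le _ _
      _ ≤ ∑ q, runMax (entrySum μ Y₀ J D q k) n ω :=
          Finset.sum_le_sum fun q _ => le_runMax _ (Finset.mem_Icc.1 hm).2 ω
      _ ≤ _ := Finset.single_le_sum
          (f := fun k => ∑ q : Fin d, runMax (entrySum μ Y₀ J D q k) n ω)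
          (fun k _ => Finset.sum_nonneg fun q _ => runMax_nonneg _ _ _) (Finset.mem_univ k)
  exact_mod_cast this

theorem integral_sum_condExp_le {ℱ : Filtration ℕ m0} {N : ℕ → Ω → ℝ} {c : ℝ}
    (hc : ∀ j, ∫ ω, N j ω ∂μ ≤ c) (n : ℕ) :
    ∫ ω, ∑ j ∈ Finset.range n, (μ[N j | ℱ j]) ω ∂μ ≤ n * c := by
  rw [integral_finsetSum _ fun j _ => integrable_condExp]
  calc ∑ j ∈ Finset.range n, ∫ ω, (μ[N j | ℱ j]) ω ∂μ ≤ ∑ j ∈ Finset.range n, c :=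
        Finset.sum_le_sum fun j _ => (integral_condExp (ℱ.le j)).trans_le (hc j)
    _ = n * c := by simp

theorem measure_abs_sum_condExp_le {ℱ : Filtration ℕ m0} {N : ℕ → Ω → ℝ}
    (hN0 : ∀ j ω, 0 ≤ N j ω) {c : ℝ} (hc : ∀ j, ∫ ω, N j ω ∂μ ≤ c) {n : ℕ} (hn : 0 < n) {a : ℝ}
    (ha : 0 < a) :
    μ {ω | a * n ≤ |∑ j ∈ Finset.range n, (μ[N j | ℱ j]) ω|} ≤ ENNReal.ofReal (c / a) := by
  have hn0 : (0 : ℝ) < n := by exact_mod_cast hn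
  have h0 : 0 ≤ᵐ[μ] fun ω => ∑ j ∈ Finset.range n, (μ[N j | ℱ j]) ω := by
    filter_upwards [ae_forall_condExp_nonneg (ℱ := ℱ) (N := N)
      (fun j => Eventually.of_forall (hN0 j))] with ω hω
    exact Finset.sum_nonneg fun j _ => hω j
  have h1 := ofReal_ge_measure_of_integral_le (integrable_finsetSum _ fun j _ => integrable_condExp)
    h0 (by positivity : 0 < a * n) (integral_sum_condExp_le hc n)
  refine (le_trans (measure_mono_ae ?_) h1).trans (ENNReal.ofReal_le_ofReal (le_of_eq ?_))
  · filter_upwards [h0] with ω hω h2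
    exact le_trans h2 (abs_of_nonneg hω).le
  · field_simp

theorem IsUrn.momentCondition_of_uniformIntegrable (hU : IsUrn μ p Y₀ J D)
    (h : UniformIntegrable (fun (m : ℕ) ω => matNorm (D (m + 1) ω)) 1 μ) :
    MomentCondition μ Y₀ J D := by
  obtain ⟨-, -, C, hC⟩ := h
  have hint : ∀ j, ∫ ω, matNorm (D (j + 1) ω) ∂μ ≤ C := fun j =>
    integral_le_of_eLpNorm_le (hU.integrable_matNorm (by lia)) C.2 (by simpa using hC j)
  intro θ hθ
  obtain ⟨t, ht0, htθ⟩ := ENNReal.lt_iff_exists_nnreal_btwn.1 hθ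
  have ht0' : (0 : ℝ) < t := by exact_mod_cast ht0
  refine ⟨(C + 1) / t, ?_⟩
  filter_upwards [eventually_gt_atTop 0] with n hn
  have ha : (0 : ℝ) < (C + 1) / t := by positivity
  refine le_trans (le_trans (measure_mono fun ω hω => ?_)
    (measure_abs_sum_condExp_le (ℱ := hU.filtration) (fun j ω => matNorm_nonneg (D (j + 1) ω))
      hint hn ha)) (le_trans (ENNReal.ofReal_le_ofReal ?_)
      ((ENNReal.ofReal_coe_nnreal (p := t)).trans_le htθ.le))
  · rw [Set.mem_ofPred_eq, sum_Icc_one_eq] at hω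
    exact hω.le
  · have hC0 : (0 : ℝ) ≤ C := C.2
    rw [div_le_iff₀ ha]
    field_simp
    linarith

theorem IsUrn.tailCondition_of_uniformIntegrable (hU : IsUrn μ p Y₀ J D)
    (h : UniformIntegrable (fun (m : ℕ) ω => matNorm (D (m + 1) ω)) 1 μ) :
    TailCondition μ Y₀ J D := by
  intro ε hε
  refine littleOInProb_iff.2 fun c hc => ENNReal.tendsto_nhds_zero.2 fun θ hθ => ?_
  obtain ⟨t, ht0, htθ⟩ := ENNReal.lt_iff_exists_nnreal_btwn.1 hθ
  have ht0' : (0 : ℝ) < t := by exact_mod_cast ht0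
  -- Once `ε n ≥ C`, every tail expectation is at most `t c`, and Markov's inequality at level `c n`
  -- leaves `t`.
  obtain ⟨C, hC⟩ := h.spec one_ne_zero ENNReal.one_ne_top (ε := t * c) (by positivity)
  have hlarge : ∀ᶠ n : ℕ in atTop, (C : ℝ) ≤ ε * n :=
    (tendsto_natCast_atTop_atTop.const_mul_atTop hε).eventually_ge_atTop _
  filter_upwards [eventually_gt_atTop 0, hlarge] with n hn hCn
  have hint : ∀ j, ∫ ω, matNormTail D (ε * n) j ω ∂μ ≤ t * c := fun j => by
    refine integral_le_of_eLpNorm_le (hU.integrable_matNormTail _ j) (by positivity)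
      (le_trans (eLpNorm_mono fun ω => ?_) (hC j))
    unfold matNormTail
    by_cases hω : ε * n ≤ matNorm (D (j + 1) ω)
    · have h2 : ω ∈ {x | C ≤ ‖matNorm (D (j + 1) x)‖₊} := by
        rw [Set.mem_ofPred_eq, ← NNReal.coe_le_coe, coe_nnnorm]
        exact (hCn.trans hω).trans (le_abs_self _)
      rw [Set.indicator_of_mem (by exact hω), Set.indicator_of_mem h2]
    · rw [Set.indicator_of_notMem (by exact hω), norm_zero]
      exact norm_nonneg _
  refine le_trans (le_trans (measure_mono fun ω hω => ?_)
    (measure_abs_sum_condExp_le (ℱ := hU.filtration) (matNormTail_nonneg (D := D) (ε * n))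
      hint hn hc)) (le_trans (ENNReal.ofReal_le_ofReal ?_)
      ((ENNReal.ofReal_coe_nnreal (p := t)).trans_le htθ.le))
  · rw [Set.mem_ofPred_eq, sum_Icc_one_eq] at hω
    exact hω
  · rw [mul_div_assoc, div_self hc.ne', mul_one]

end SufficientConditions

/-! ### Matrices bounded below: the mean condition implies the moment condition. -/

section LowerBound

theorem matNorm_le_matNorm_sub_add {d : ℕ} (A B : Matrix (Fin d) (Fin d) ℝ) :
    matNorm A ≤ matNorm (A - B) + matNorm B := by
  simp only [matNorm, ← Finset.sum_add_distrib, Matrix.sub_apply]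
  exact Finset.sum_le_sum fun q _ => Finset.sum_le_sum fun k _ => by
    simpa using abs_add_le (A q k - B q k) (B q k)

theorem tendsto_measure_natCast_lt {Ω : Type*} [MeasurableSpace Ω] {μ : Measure Ω}
    [IsFiniteMeasure μ] {f : Ω → ℝ} (hf : Measurable f) :
    Tendsto (fun N : ℕ => μ {ω | (N : ℝ) < f ω}) atTop (nhds 0) := by
  have hempty : ⋂ N : ℕ, {ω | (N : ℝ) < f ω} = ∅ := by
    ext ω
    obtain ⟨N, hN⟩ := exists_nat_ge (f ω)
    simpa using ⟨N, hN⟩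
  have h := tendsto_measure_iInter_atTop (μ := μ) (s := fun N : ℕ => {ω | (N : ℝ) < f ω})
    (fun N => (measurableSet_lt measurable_const hf).nullMeasurableSet)
    (fun M N hMN ω (hω : (N : ℝ) < f ω) =>
      show (M : ℝ) < f ω from lt_of_le_of_lt (by exact_mod_cast hMN) hω) ⟨0, measure_ne_top _ _⟩
  rwa [hempty, measure_empty] at h

variable {d : ℕ} {Ω : Type*} [m0 : MeasurableSpace Ω] {μ : Measure Ω} [IsProbabilityMeasure μ]
  {p : Fin d → ℝ} {Y₀ : Ω → Fin d → ℝ} {J : ℕ → Ω → Fin d}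
  {D : ℕ → Ω → Matrix (Fin d) (Fin d) ℝ}

/-- For `x ≥ -c₀` one has `|x| ≤ x + 2|c₀|`, so conditional absolute means are controlled by
conditional means. -/
theorem IsUrn.condExp_matNorm_le (hU : IsUrn μ p Y₀ J D) {c₀ : ℝ} (j : ℕ)
    (hc : ∀ᵐ ω ∂μ, ∀ q k, -c₀ ≤ D (j + 1) ω q k) :
    ∀ᵐ ω ∂μ, (μ[fun ω' => matNorm (D (j + 1) ω') | hU.filtration j]) ω ≤
      matNorm (condMean μ Y₀ J D (j + 1) ω) + d * (d * (2 * |c₀|)) := by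
  have hint : ∀ q k, Integrable (fun ω => D (j + 1) ω q k + 2 * |c₀|) μ := fun q k =>
    (hU.integrable_entry _ (by lia) q k).add (integrable_const _)
  have h1 : μ[fun ω' => matNorm (D (j + 1) ω') | hU.filtration j] ≤ᵐ[μ]
      μ[∑ q, ∑ k, fun ω => D (j + 1) ω q k + 2 * |c₀| | hU.filtration j] := by
    refine condExp_mono (hU.integrable_matNorm (by lia))
      (integrable_finsetSum' _ fun q _ => integrable_finsetSum' _ fun k _ => hint q k) ?_
    filter_upwards [hc] with ω hω
    simp only [Finset.sum_apply, matNorm]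
    refine Finset.sum_le_sum fun q _ => Finset.sum_le_sum fun k _ => ?_
    have := hω q k
    have := le_abs_self c₀
    exact abs_le.2 ⟨by linarith, by linarith [abs_nonneg c₀]⟩
  have h2 : μ[∑ q, ∑ k, fun ω => D (j + 1) ω q k + 2 * |c₀| | hU.filtration j] =ᵐ[μ]
      ∑ q, μ[∑ k, fun ω => D (j + 1) ω q k + 2 * |c₀| | hU.filtration j] :=
    condExp_finsetSum (fun q _ => integrable_finsetSum' _ fun k _ => hint q k) _
  have h3 : ∀ᵐ ω ∂μ, ∀ q, (μ[∑ k, fun ω => D (j + 1) ω q k + 2 * |c₀| | hU.filtration j]) ω =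
      (∑ k, μ[fun ω => D (j + 1) ω q k + 2 * |c₀| | hU.filtration j]) ω :=
    ae_all_iff.2 fun q => condExp_finsetSum (fun k _ => hint q k) _
  have h4 : ∀ᵐ ω ∂μ, ∀ q k, (μ[fun ω => D (j + 1) ω q k + 2 * |c₀| | hU.filtration j]) ω =
      condMean μ Y₀ J D (j + 1) ω q k + 2 * |c₀| := by
    refine ae_all_iff.2 fun q => ae_all_iff.2 fun k => ?_
    filter_upwards [condExp_add (hU.integrable_entry (j + 1) (by lia) q k)
      (integrable_const (2 * |c₀|)) (hU.filtration j)] with ω hω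
    refine hω.trans ?_
    rw [Pi.add_apply, condExp_const (hU.filtration.le j)]
    rfl
  filter_upwards [h1, h2, h3, h4] with ω e1 e2 e3 e4
  refine e1.trans (e2.trans_le ?_)
  rw [Finset.sum_apply]
  calc _ = ∑ q, ∑ k, (condMean μ Y₀ J D (j + 1) ω q k + 2 * |c₀|) := by
        refine Finset.sum_congr rfl fun q _ => ?_
        rw [e3, Finset.sum_apply]
        exact Finset.sum_congr rfl fun k _ => e4 q k
    _ ≤ ∑ q, ∑ k, (|condMean μ Y₀ J D (j + 1) ω q k| + 2 * |c₀|) := by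
        gcongr
        exact le_abs_self _
    _ = _ := by simp [Finset.sum_add_distrib, matNorm]

/-- Although `H` is random, its norm is finite and hence at most some `N` outside an event of small
probability; this yields a deterministic constant. -/
theorem IsUrn.momentCondition_of_bddBelow (hU : IsUrn μ p Y₀ J D)
    {H : Ω → Matrix (Fin d) (Fin d) ℝ} {c₀ : ℝ} (hH : ∀ q k, Measurable fun ω => H ω q k)
    (hc : ∀ m, 1 ≤ m → ∀ᵐ ω ∂μ, ∀ q k, -c₀ ≤ D m ω q k) (hM : MeanCondition μ Y₀ J D H) :
    MomentCondition μ Y₀ J D := by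
  intro θ hθ
  have hθ2 : 0 < θ / 2 := ENNReal.half_pos hθ.ne'
  have hmeas : Measurable fun ω => matNorm (H ω) :=
    measurable_matNorm_of.comp (measurable_pi_lambda _ fun q => measurable_pi_lambda _ (hH q))
  obtain ⟨N, hN⟩ := ((ENNReal.tendsto_nhds_zero.1 (tendsto_measure_natCast_lt (μ := μ) hmeas))
    _ hθ2).exists
  refine ⟨1 + N + d * (d * (2 * |c₀|)), ?_⟩
  filter_upwards [ENNReal.tendsto_nhds_zero.1 (littleOInProb_iff.1 hM 1 one_pos) _ hθ2]
    with n hn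
  refine le_trans (le_trans (measure_mono_ae ?_) (measure_union_le _ _))
    ((add_le_add hN hn).trans_eq (ENNReal.add_halves θ))
  filter_upwards [ae_forall_condExp_nonneg (ℱ := hU.filtration)
      (N := fun j ω => matNorm (D (j + 1) ω))
      (fun j => Eventually.of_forall fun ω => matNorm_nonneg _),
    ae_all_iff.2 fun j => hU.condExp_matNorm_le j (hc (j + 1) (by lia))] with ω h0 h1 hlt
  by_contra hcon
  obtain ⟨h2, h3⟩ := not_or.1 hcon
  have h2' : matNorm (H ω) ≤ N := not_lt.1 h2
  have h3' : |∑ m ∈ Finset.Icc 1 n, matNorm (condMean μ Y₀ J D m ω - H ω)| < 1 * n := not_le.1 h3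
  refine absurd (show (1 + N + d * (d * (2 * |c₀|))) * (n : ℝ) <
    |∑ m ∈ Finset.Icc 1 n, (μ[fun ω' => matNorm (D m ω') | history Y₀ J D (m - 1)]) ω| from hlt)
    (not_lt.2 ?_)
  rw [sum_Icc_one_eq] at h3' ⊢
  simp only [Nat.add_sub_cancel]
  rw [abs_of_nonneg (Finset.sum_nonneg fun j _ => by exact h0 j)]
  calc _ ≤ ∑ j ∈ Finset.range n, (matNorm (condMean μ Y₀ J D (j + 1) ω - H ω) +
          (N + d * (d * (2 * |c₀|)))) := by
        refine Finset.sum_le_sum fun j _ => (h1 j).trans ?_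
        linarith [matNorm_le_matNorm_sub_add (condMean μ Y₀ J D (j + 1) ω) (H ω)]
    _ ≤ _ := by
        rw [Finset.sum_add_distrib, Finset.sum_const, Finset.card_range, nsmul_eq_mul]
        linarith [(le_abs_self _).trans h3'.le]

end LowerBound

/-! ### Passage to the eigenvector set on windows of times. -/

section Window

variable {d : ℕ} {p : Fin d → ℝ} {A : Matrix (Fin d) (Fin d) ℝ}

theorem inv_smul_cumProportion_mem (hp : p ∈ stdSimplex ℝ (Fin d)) (y : ℕ → Fin d → ℝ) {m : ℕ}
    (hm : 0 < m) : (m : ℝ)⁻¹ • cumProportion p y m ∈ stdSimplex ℝ (Fin d) := by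
  have hm0 : (0 : ℝ) < m := by exact_mod_cast hm
  refine ⟨fun k => mul_nonneg (by positivity) (cumProportion_nonneg hp m k), ?_⟩
  simp only [Pi.smul_apply, smul_eq_mul, ← Finset.mul_sum, sum_cumProportion hp]
  field_simp

theorem abs_vecMul_inv_smul_sub_le {z : Fin d → ℝ} {m : ℕ} (hm : 0 < m) {ε : ℝ} (k : Fin d)
    (h : |Matrix.vecMul z A k - lam A * z k| ≤ ε * m) :
    |Matrix.vecMul ((m : ℝ)⁻¹ • z) A k - lam A * ((m : ℝ)⁻¹ • z) k| ≤ ε := by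
  have hm0 : (0 : ℝ) < m := by exact_mod_cast hm
  rw [Matrix.smul_vecMul, Pi.smul_apply, Pi.smul_apply, smul_eq_mul, smul_eq_mul,
    show (m : ℝ)⁻¹ * Matrix.vecMul z A k - lam A * ((m : ℝ)⁻¹ * z k) =
      (m : ℝ)⁻¹ * (Matrix.vecMul z A k - lam A * z k) by ring, abs_mul, abs_of_pos (by positivity),
    inv_mul_le_iff₀ hm0]
  linarith

/-- The trajectory without fluctuations, started at the origin. -/
noncomputable def freeTrajectory (p : Fin d → ℝ) (A : Matrix (Fin d) (Fin d) ℝ) : ℕ → Fin d → ℝ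
  | 0 => 0
  | m + 1 => freeTrajectory p A m + Matrix.vecMul (proportion p (freeTrajectory p A m)) A

theorem freeTrajectory_eq (p : Fin d → ℝ) (A : Matrix (Fin d) (Fin d) ℝ) (m : ℕ) :
    freeTrajectory p A m = Matrix.vecMul (cumProportion p (freeTrajectory p A) m) A := by
  induction m with
  | zero => simp [freeTrajectory, cumProportion]
  | succ m ih => rw [cumProportion_succ, Matrix.add_vecMul, ← ih]; rfl

/-- The noise-free trajectory satisfies the tracking hypothesis with zero error, so it supplies
approximate eigenvectors of arbitrary precision; Perron–Frobenius theory is not invoked. -/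
theorem eigenSimplex_nonempty (hp : p ∈ stdSimplex ℝ (Fin d)) (hA : Admissible A) :
    (eigenSimplex A).Nonempty := by
  refine eigenSimplex_nonempty_of_forall fun ε hε => ?_
  obtain ⟨η, hη, n₀, h⟩ := exists_forall_trajectory hp hA 1 hε
  set n := n₀ + 1 with hn
  refine ⟨_, inv_smul_cumProportion_mem hp (freeTrajectory p A) (m := n) (by lia), fun k =>
    abs_vecMul_inv_smul_sub_le (by lia) k ((h n (by lia) (freeTrajectory p A) ?_).1 n le_rfl
      (by lia) k)⟩
  intro m _ k
  rw [← freeTrajectory_eq, sub_self, abs_zero]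
  positivity

/-- The total divided by `m` is within `d b` of `l`, hence at least `l / 2`, and normalization is
stable. -/
theorem dist_proportion_le {y s : Fin d → ℝ} {l b : ℝ} {m : ℕ} (hm : 0 < m) (hl : 0 < l)
    (hb : (d + 1) * b ≤ l / 2) (hs : s ∈ stdSimplex ℝ (Fin d))
    (h : ∀ k, |(m : ℝ)⁻¹ * pos y k - l * s k| ≤ b) (k : Fin d) :
    |proportion p y k - s k| ≤ (d + 1) * b / (l / 2) := by
  have hm0 : (0 : ℝ) < m := by exact_mod_cast hm
  have hb0 : 0 ≤ b := (abs_nonneg _).trans (h k)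
  set a := (m : ℝ)⁻¹ * ∑ j, pos y j with ha
  have hal : |a - l| ≤ d * b := by
    have : a - l = ∑ j, ((m : ℝ)⁻¹ * pos y j - l * s j) := by
      rw [Finset.sum_sub_distrib, ← Finset.mul_sum, ← Finset.mul_sum, hs.2, mul_one]
    rw [this]
    exact (Finset.abs_sum_le_sum_abs _ _).trans
      ((Finset.sum_le_sum fun j _ => h j).trans (by simp))
  have ha2 : l / 2 ≤ a := by nlinarith [(abs_le.1 hal).1]
  have hα : ∑ j, pos y j ≠ 0 := fun h0 => by
    rw [ha, h0, mul_zero] at ha2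
    linarith
  have hprop : a * (proportion p y k - s k) = ((m : ℝ)⁻¹ * pos y k - l * s k) - (a - l) * s k := by
    rw [proportion, if_neg hα, Pi.smul_apply, smul_eq_mul, ha]
    field_simp
    ring
  have hsk : 0 ≤ s k ∧ s k ≤ 1 :=
    ⟨hs.1 k, hs.2 ▸ Finset.single_le_sum (fun j _ => hs.1 j) (Finset.mem_univ k)⟩
  have h1 : a * |proportion p y k - s k| ≤ (d + 1) * b := by
    rw [← abs_of_pos (by linarith : 0 < a), ← abs_mul, hprop]
    refine (abs_sub _ _).trans ?_
    rw [abs_mul, abs_of_nonneg hsk.1]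
    have : |a - l| * s k ≤ d * b * 1 := mul_le_mul hal hsk.2 hsk.1 (by positivity)
    linarith [h k]
  rw [le_div_iff₀ (by positivity)]
  nlinarith [abs_nonneg (proportion p y k - s k)]

/-- A trajectory that follows its selection proportions up to a small error is, on a window of
times of the same order, close to a point of the eigenvector set. -/
theorem exists_forall_window (hp : p ∈ stdSimplex ℝ (Fin d)) (hA : Admissible A) (K : ℕ)
    {ε : ℝ} (hε : 0 < ε) :
    ∃ η : ℝ, 0 < η ∧ ∃ n₀ : ℕ, ∀ n ≥ n₀, ∀ y c : ℕ → Fin d → ℝ,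
      (∀ m ≤ K * n, ∀ k, |y m k - Matrix.vecMul (cumProportion p y m) A k| ≤ η * n) →
      (∀ m ≤ K * n, ∀ k, |c m k - cumProportion p y m k| ≤ η * n) →
      ∀ m, n ≤ m → m ≤ K * n → ∃ s ∈ eigenSimplex A,
        dist ((m : ℝ)⁻¹ • y m) (lam A • s) ≤ ε ∧ dist ((m : ℝ)⁻¹ • pos (y m)) (lam A • s) ≤ ε ∧
        dist (proportion p (y m)) s ≤ ε ∧ dist ((m : ℝ)⁻¹ • c m) s ≤ ε := by
  set l := lam A with hldef
  have hl : 0 < l := hA.lam_pos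
  -- The tolerance `b` is spent in quarters: `y` against `z A`, `z A` against `l z`, `l z` against
  -- `l s`, and `y⁺` against `y`.
  obtain ⟨b, hb0, hbε, hbl, hbl2⟩ : ∃ b : ℝ, 0 < b ∧ b ≤ ε ∧ (d + 1) * b ≤ l / 2 ∧
      (d + 1) * b / (l / 2) ≤ ε := by
    have hd : (0 : ℝ) < d + 1 := by positivity
    refine ⟨min ε (min (l / 2 / (d + 1)) (ε * (l / 2) / (d + 1))), by positivity,
      min_le_left _ _, ?_, ?_⟩
    · rw [← le_div_iff₀' hd]
      exact (min_le_right _ _).trans (min_le_left _ _)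
    · rw [div_le_iff₀ (by positivity), ← le_div_iff₀' hd]
      exact (min_le_right _ _).trans (min_le_right _ _)
  obtain ⟨ε₁, hε₁, hlε₁, hε₁ε⟩ : ∃ e : ℝ, 0 < e ∧ l * e ≤ b / 4 ∧ e ≤ ε / 2 := by
    refine ⟨min (b / 4 / l) (ε / 2), by positivity, ?_, min_le_right _ _⟩
    rw [← le_div_iff₀' hl]
    exact min_le_left _ _
  obtain ⟨δ, hδ, hδε⟩ := exists_forall_infDist_eigenSimplex_lt (A := A) hε₁
  obtain ⟨η₁, hη₁, n₁, htraj⟩ := exists_forall_trajectory hp hA K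
    (ε := min δ (b / 4)) (by positivity)
  refine ⟨min η₁ (b / 4), by positivity, n₁ + 1, fun n hn y c hy hc m hnm hmK => ?_⟩
  have hn0 : (0 : ℝ) ≤ n := by positivity
  have hm : 0 < m := by lia
  have hm0 : (0 : ℝ) < m := by exact_mod_cast hm
  have hnm0 : (n : ℝ) ≤ m := by exact_mod_cast hnm
  obtain ⟨h1, h2⟩ := htraj n (by lia) y fun m hm k => (hy m hm k).trans
    (mul_le_mul_of_nonneg_right (min_le_left _ _) hn0)
  set z := cumProportion p y m with hz
  obtain ⟨s, hs, hws⟩ := (Metric.infDist_lt_iff (eigenSimplex_nonempty hp hA)).1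
    (hδε _ (inv_smul_cumProportion_mem hp y hm) fun k => (abs_vecMul_inv_smul_sub_le hm k
      (h1 m hnm hmK k)).trans (min_le_left _ _))
  have hwk : ∀ k, |(m : ℝ)⁻¹ * z k - s k| ≤ ε₁ := fun k =>
    (dist_le_pi_dist _ _ k).trans hws.le
  have hscale : ∀ {x t : ℝ}, 0 ≤ t → |x| ≤ t * n → |(m : ℝ)⁻¹ * x| ≤ t := by
    intro x t ht hx
    rw [abs_mul, abs_of_pos (by positivity), inv_mul_le_iff₀ hm0]
    nlinarith
  have hyk : ∀ k, |(m : ℝ)⁻¹ * y m k - l * s k| ≤ 3 * (b / 4) := by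
    intro k
    have e1 := hscale (by positivity) ((hy m hmK k).trans
      (mul_le_mul_of_nonneg_right (min_le_right _ _) hn0))
    have e2 := (abs_vecMul_inv_smul_sub_le hm k (h1 m hnm hmK k)).trans (min_le_right _ _)
    have e3 : |l * ((m : ℝ)⁻¹ * z k - s k)| ≤ b / 4 := by
      rw [abs_mul, abs_of_pos hl]
      exact (mul_le_mul_of_nonneg_left (hwk k) hl.le).trans hlε₁
    rw [Matrix.smul_vecMul, Pi.smul_apply, Pi.smul_apply, smul_eq_mul, smul_eq_mul] at e2
    rw [show (m : ℝ)⁻¹ * y m k - l * s k = (m : ℝ)⁻¹ * (y m k - Matrix.vecMul z A k) +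
      ((m : ℝ)⁻¹ * Matrix.vecMul z A k - l * ((m : ℝ)⁻¹ * z k)) +
        l * ((m : ℝ)⁻¹ * z k - s k) by ring]
    linarith [abs_add_three ((m : ℝ)⁻¹ * (y m k - Matrix.vecMul z A k))
      ((m : ℝ)⁻¹ * Matrix.vecMul z A k - l * ((m : ℝ)⁻¹ * z k)) (l * ((m : ℝ)⁻¹ * z k - s k))]
  have hposk : ∀ k, |(m : ℝ)⁻¹ * pos (y m) k - l * s k| ≤ b := by
    intro k
    have e1 := hscale (by positivity) ((h2 m hmK k).trans
      (mul_le_mul_of_nonneg_right (min_le_right _ _) hn0))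
    rw [show (m : ℝ)⁻¹ * pos (y m) k - l * s k = (m : ℝ)⁻¹ * (pos (y m) k - y m k) +
      ((m : ℝ)⁻¹ * y m k - l * s k) by ring]
    linarith [abs_add_le ((m : ℝ)⁻¹ * (pos (y m) k - y m k)) ((m : ℝ)⁻¹ * y m k - l * s k),
      hyk k]
  refine ⟨s, hs, (dist_pi_le_iff hε.le).2 fun k => ?_, (dist_pi_le_iff hε.le).2 fun k => ?_,
    (dist_pi_le_iff hε.le).2 fun k => ?_, (dist_pi_le_iff hε.le).2 fun k => ?_⟩
  · exact (hyk k).trans (by linarith)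
  · exact (hposk k).trans hbε
  · exact (dist_proportion_le hm hl hbl hs.1 hposk k).trans hbl2
  · have e1 := hscale (by positivity) ((hc m hmK k).trans
      (mul_le_mul_of_nonneg_right (min_le_right _ _) hn0))
    rw [Real.dist_eq, Pi.smul_apply, smul_eq_mul, show (m : ℝ)⁻¹ * c m k - s k =
      (m : ℝ)⁻¹ * (c m k - z k) + ((m : ℝ)⁻¹ * z k - s k) by ring]
    linarith [abs_add_le ((m : ℝ)⁻¹ * (c m k - z k)) ((m : ℝ)⁻¹ * z k - s k), hwk k]

end Window

/-! ### Decomposition of the urn and transfer to convergence in probability. -/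

section Decomposition

variable {d : ℕ} {Ω : Type*} {p : Fin d → ℝ} {Y₀ : Ω → Fin d → ℝ} {J : ℕ → Ω → Fin d}
  {D : ℕ → Ω → Matrix (Fin d) (Fin d) ℝ}

/-- The number of draws of type `k` minus the sum of the selection probabilities. -/
noncomputable def drawError (p : Fin d → ℝ) (Y₀ : Ω → Fin d → ℝ) (J : ℕ → Ω → Fin d)
    (D : ℕ → Ω → Matrix (Fin d) (Fin d) ℝ) (k : Fin d) (m : ℕ) (ω : Ω) : ℝ :=
  ∑ j ∈ Finset.range m, (draw J (j + 1) ω k - proportion p (urn Y₀ J D j ω) k)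

theorem counts_sub_cumProportion (m : ℕ) (ω : Ω) (k : Fin d) :
    counts J m ω k - cumProportion p (fun j => urn Y₀ J D j ω) m k =
      drawError p Y₀ J D k m ω := by
  rw [counts, sum_Icc_one_eq, cumProportion, drawError, Finset.sum_sub_distrib, Finset.sum_apply,
    Finset.sum_apply]

theorem sum_abs_draw (m : ℕ) (ω : Ω) : ∑ k, |draw J m ω k| = 1 := by
  rw [Finset.sum_eq_single (J m ω) (fun k _ hk => by rw [draw, Pi.single_eq_of_ne hk, abs_zero])
    (by simp), draw, Pi.single_eq_same, abs_one]

theorem sum_runMax_nonneg (n : ℕ) (ω : Ω) : 0 ≤ ∑ k, runMax (drawError p Y₀ J D k) n ω :=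
  Finset.sum_nonneg fun _ _ => runMax_nonneg _ _ _

theorem sum_abs_counts_sub_le {m n : ℕ} (hmn : m ≤ n) (ω : Ω) :
    ∑ k, |counts J m ω k - cumProportion p (fun j => urn Y₀ J D j ω) m k| ≤
      ∑ k, runMax (drawError p Y₀ J D k) n ω :=
  Finset.sum_le_sum fun k _ => by
    rw [counts_sub_cumProportion]
    exact le_runMax _ hmn ω

variable [MeasurableSpace Ω] {μ : Measure Ω}

/-- A pathwise identity, so that `A` may be the random value `H ω`, which need not be known to the
past. -/
theorem urn_eq_add (μ : Measure Ω) (A : Matrix (Fin d) (Fin d) ℝ) (m : ℕ) (ω : Ω) :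
    urn Y₀ J D m ω = Y₀ ω + martSum μ Y₀ J D m ω +
      ∑ j ∈ Finset.range m,
        Matrix.vecMul (draw J (j + 1) ω) (condMean μ Y₀ J D (j + 1) ω - A) +
      Matrix.vecMul (counts J m ω) A := by
  rw [martSum, counts, sum_Icc_one_eq, sum_Icc_one_eq]
  induction m with
  | zero => simp [urn]
  | succ m ih =>
    simp only [Finset.sum_range_succ, urn, ih, Matrix.add_vecMul, Matrix.vecMul_sub]
    abel

/-- A bound, uniform over the first `n` stages, for the deviation of the urn from the trajectory
that follows its selection proportions. -/
noncomputable def fluctuation (μ : Measure Ω) (p : Fin d → ℝ) (Y₀ : Ω → Fin d → ℝ)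
    (J : ℕ → Ω → Fin d) (D : ℕ → Ω → Matrix (Fin d) (Fin d) ℝ)
    (H : Ω → Matrix (Fin d) (Fin d) ℝ) (n : ℕ) (ω : Ω) : ℝ :=
  (((Finset.Icc 1 n).sup (fun m => ‖martSum μ Y₀ J D m ω‖₊) : NNReal) : ℝ) +
    ∑ m ∈ Finset.Icc 1 n, matNorm (condMean μ Y₀ J D m ω - H ω) +
    ∑ k, runMax (drawError p Y₀ J D k) n ω

theorem norm_martSum_le {m n : ℕ} (hmn : m ≤ n) (ω : Ω) :
    ‖martSum μ Y₀ J D m ω‖ ≤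
      (((Finset.Icc 1 n).sup (fun m => ‖martSum μ Y₀ J D m ω‖₊) : NNReal) : ℝ) := by
  rcases Nat.eq_zero_or_pos m with rfl | hm
  · simp [martSum]
  · rw [← coe_nnnorm, NNReal.coe_le_coe]
    exact Finset.le_sup (f := fun m => ‖martSum μ Y₀ J D m ω‖₊) (Finset.mem_Icc.2 ⟨hm, hmn⟩)

theorem sum_matNorm_nonneg (H : Ω → Matrix (Fin d) (Fin d) ℝ) (n : ℕ) (ω : Ω) :
    0 ≤ ∑ m ∈ Finset.Icc 1 n, matNorm (condMean μ Y₀ J D m ω - H ω) :=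
  Finset.sum_nonneg fun _ _ => matNorm_nonneg _

theorem abs_counts_sub_le (H : Ω → Matrix (Fin d) (Fin d) ℝ) {m n : ℕ} (hmn : m ≤ n) (ω : Ω)
    (k : Fin d) :
    |counts J m ω k - cumProportion p (fun j => urn Y₀ J D j ω) m k| ≤
      fluctuation μ p Y₀ J D H n ω := by
  have h := (Finset.single_le_sum (f := fun k =>
    |counts J m ω k - cumProportion p (fun j => urn Y₀ J D j ω) m k|)
    (fun _ _ => abs_nonneg _) (Finset.mem_univ k)).trans (sum_abs_counts_sub_le hmn ω)
  have h1 := sum_matNorm_nonneg (μ := μ) (Y₀ := Y₀) (J := J) (D := D) H n ω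
  refine h.trans ?_
  unfold fluctuation
  linarith [NNReal.coe_nonneg ((Finset.Icc 1 n).sup (fun m => ‖martSum μ Y₀ J D m ω‖₊))]

theorem abs_urn_sub_le (μ : Measure Ω) (H : Ω → Matrix (Fin d) (Fin d) ℝ) {m n : ℕ} (hmn : m ≤ n)
    (ω : Ω) (k : Fin d) :
    |urn Y₀ J D m ω k -
        Matrix.vecMul (cumProportion p (fun j => urn Y₀ J D j ω) m) (H ω) k| ≤
      ‖Y₀ ω‖ + (1 + matNorm (H ω)) * fluctuation μ p Y₀ J D H n ω := by
  set a : ℝ := (((Finset.Icc 1 n).sup (fun m => ‖martSum μ Y₀ J D m ω‖₊) : NNReal) : ℝ) with ha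
  set b := ∑ m ∈ Finset.Icc 1 n, matNorm (condMean μ Y₀ J D m ω - H ω) with hb
  set c := ∑ k, runMax (drawError p Y₀ J D k) n ω with hc
  set z := cumProportion p (fun j => urn Y₀ J D j ω) m with hz
  have ha0 : 0 ≤ a := NNReal.coe_nonneg _
  have hb0 : 0 ≤ b := sum_matNorm_nonneg H n ω
  have hc0 : 0 ≤ c := sum_runMax_nonneg n ω
  have hH := matNorm_nonneg (H ω)
  have h1 : |Y₀ ω k| ≤ ‖Y₀ ω‖ := norm_le_pi_norm (Y₀ ω) k
  have h2 : |martSum μ Y₀ J D m ω k| ≤ a :=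
    (norm_le_pi_norm (martSum μ Y₀ J D m ω) k).trans (norm_martSum_le hmn ω)
  have h3 : |∑ j ∈ Finset.range m,
      Matrix.vecMul (draw J (j + 1) ω) (condMean μ Y₀ J D (j + 1) ω - H ω) k| ≤ b := by
    rw [hb, sum_Icc_one_eq]
    refine (Finset.abs_sum_le_sum_abs _ _).trans ((Finset.sum_le_sum fun j _ => ?_).trans
      (Finset.sum_le_sum_of_subset_of_nonneg (Finset.range_mono hmn)
        fun _ _ _ => matNorm_nonneg _))
    refine (abs_vecMul_le _ _ k).trans ?_
    rw [sum_abs_draw, one_mul]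
  have h4 : |Matrix.vecMul (counts J m ω - z) (H ω) k| ≤ c * matNorm (H ω) :=
    (abs_vecMul_le _ _ k).trans (mul_le_mul_of_nonneg_right (sum_abs_counts_sub_le hmn ω) hH)
  have key : urn Y₀ J D m ω k - Matrix.vecMul z (H ω) k = Y₀ ω k + martSum μ Y₀ J D m ω k +
      ∑ j ∈ Finset.range m,
        Matrix.vecMul (draw J (j + 1) ω) (condMean μ Y₀ J D (j + 1) ω - H ω) k +
      Matrix.vecMul (counts J m ω - z) (H ω) k := by
    rw [urn_eq_add μ (H ω), Matrix.sub_vecMul]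
    simp only [Pi.add_apply, Pi.sub_apply, Finset.sum_apply]
    ring
  have h5 : |urn Y₀ J D m ω k - Matrix.vecMul z (H ω) k| ≤
      ‖Y₀ ω‖ + a + b + c * matNorm (H ω) := by
    rw [key]
    refine (abs_add_le _ _).trans (add_le_add ((abs_add_le _ _).trans (add_le_add
      ((abs_add_le _ _).trans (add_le_add h1 h2)) h3)) h4)
  refine h5.trans ?_
  have h6 : fluctuation μ p Y₀ J D H n ω = a + b + c := rfl
  rw [h6]
  nlinarith [mul_nonneg hH ha0, mul_nonneg hH hb0]

variable [IsProbabilityMeasure μ]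

theorem IsUrn.littleOInProb_fluctuation (hU : IsUrn μ p Y₀ J D)
    {H : Ω → Matrix (Fin d) (Fin d) ℝ} (hM : MeanCondition μ Y₀ J D H)
    (hX : MartingaleCondition μ Y₀ J D) : LittleOInProb μ (fluctuation μ p Y₀ J D H) :=
  (LittleOInProb.add hX hM).add (LittleOInProb.sum Finset.univ fun k _ => hU.littleOInProb_draw k)

/-- Convergence in probability of functionals of the urn that are determined, up to a small error,
by the trajectory following its selection proportions. -/
theorem IsUrn.tendstoInMeasure_of_forall (hU : IsUrn μ p Y₀ J D)
    {H : Ω → Matrix (Fin d) (Fin d) ℝ} (hM : MeanCondition μ Y₀ J D H)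
    (hX : MartingaleCondition μ Y₀ J D) {K : ℕ} (hK : 0 < K) {E : Type*} [PseudoMetricSpace E]
    {F : ℕ → Ω → E} {f : Ω → E} (hF : ∀ n, AEStronglyMeasurable (F n) μ)
    (h : ∀ᵐ ω ∂μ, ∀ ε : ℝ, 0 < ε → ∃ η : ℝ, 0 < η ∧ ∃ n₀ : ℕ, ∀ n ≥ n₀,
      (∀ m ≤ K * n, ∀ k, |urn Y₀ J D m ω k -
        Matrix.vecMul (cumProportion p (fun j => urn Y₀ J D j ω) m) (H ω) k| ≤ η * n) →
      (∀ m ≤ K * n, ∀ k,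
        |counts J m ω k - cumProportion p (fun j => urn Y₀ J D j ω) m k| ≤ η * n) →
      dist (F n ω) (f ω) ≤ ε) :
    TendstoInMeasure μ F atTop f := by
  -- The thresholds `η` and `n₀` depend on `ω` without any measurability. Along a further
  -- subsequence the fluctuation at time `K n`, divided by `n`, tends to zero almost surely, and the
  -- pathwise hypothesis applies for each `ω` separately.
  refine (exists_seq_tendstoInMeasure_atTop_iff hF).2 fun ns hns => ?_
  obtain ⟨ns', hns', hae⟩ := (((hU.littleOInProb_fluctuation hM hX).tendstoInMeasure_mul hK).comp
    hns.tendsto_atTop).exists_seq_tendsto_ae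
  refine ⟨ns', hns', ?_⟩
  filter_upwards [hae, h] with ω h1 h2
  have hlim : Tendsto (fun i => ns (ns' i)) atTop atTop :=
    hns.tendsto_atTop.comp hns'.tendsto_atTop
  refine Metric.tendsto_nhds.2 fun ε hε => ?_
  obtain ⟨η, hη, n₀, h3⟩ := h2 (ε / 2) (by positivity)
  have hA := matNorm_nonneg (H ω)
  -- Half of `η` pays for the fluctuation with its factor `1 + matNorm (H ω)`, the other half for
  -- `Y₀ ω`.
  set η' := η / 2 / (1 + matNorm (H ω)) with hη'
  have hη'0 : 0 < η' := by positivity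
  have hη'η : (1 + matNorm (H ω)) * η' = η / 2 := by
    rw [hη']; field_simp
  have hη'le : η' ≤ η := by nlinarith [mul_nonneg hA hη'0.le]
  have hbig : ∀ᶠ i in atTop, ‖Y₀ ω‖ ≤ η / 2 * (ns (ns' i) : ℝ) :=
    ((tendsto_natCast_atTop_atTop.comp hlim).const_mul_atTop (by positivity)).eventually_ge_atTop _
  filter_upwards [h1.eventually_lt_const hη'0, hbig, hlim.eventually_ge_atTop (n₀ + 1)]
    with i e1 e2 e3
  set n := ns (ns' i) with hn
  have hn0 : (0 : ℝ) < n := by exact_mod_cast (show 0 < n by lia)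
  have e1' : fluctuation μ p Y₀ J D H (K * n) ω ≤ η' * n := ((div_lt_iff₀ hn0).1 e1).le
  refine (h3 n (by lia) (fun m hm k => ?_) (fun m hm k => ?_)).trans_lt (by linarith)
  · refine (abs_urn_sub_le μ H hm ω k).trans ?_
    have := mul_le_mul_of_nonneg_left e1' (by linarith : 0 ≤ 1 + matNorm (H ω))
    rw [← mul_assoc, hη'η] at this
    linarith
  · exact (abs_counts_sub_le H hm ω k).trans (e1'.trans (by gcongr))

end Decomposition

/-! ### The limit statements. -/

section Limits

variable {d : ℕ} {Ω : Type*} [MeasurableSpace Ω] {μ : Measure Ω}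
  {p : Fin d → ℝ} {Y₀ : Ω → Fin d → ℝ} {J : ℕ → Ω → Fin d}
  {D : ℕ → Ω → Matrix (Fin d) (Fin d) ℝ}

theorem aemeasurable_finset_sup (s : Finset ℕ) {f : ℕ → Ω → NNReal}
    (hf : ∀ m, AEMeasurable (f m) μ) : AEMeasurable (fun ω => s.sup fun m => f m ω) μ := by
  induction s using Finset.induction_on with
  | empty => simp
  | insert a s _ ih =>
    simp only [Finset.sup_insert]
    exact (hf a).sup ih

theorem measurable_pos : Measurable (pos : (Fin d → ℝ) → Fin d → ℝ) :=
  measurable_pi_lambda _ fun k => (measurable_pi_apply k).max measurable_const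

theorem IsUrn.measurable_counts (hU : IsUrn μ p Y₀ J D) (m : ℕ) : Measurable (counts J m) := by
  have : Measurable fun ω => ∑ j ∈ Finset.Icc 1 m, draw J j ω :=
    Finset.measurable_sum _ fun j hj => hU.measurable_draw (Finset.mem_Icc.1 hj).1
  exact this

theorem IsUrn.measurable_proportion_urn (hU : IsUrn μ p Y₀ J D) (m : ℕ) :
    Measurable fun ω => proportion p (urn Y₀ J D m ω) :=
  (measurable_pi_lambda _ (measurable_proportion p)).comp (hU.measurable_urn m)

/-- Up to time `n`, the urn and the draw counts follow the selection proportions up to `e`. -/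
def Tracks (p : Fin d → ℝ) (A : Matrix (Fin d) (Fin d) ℝ) (y c : ℕ → Fin d → ℝ) (n : ℕ)
    (e : ℝ) : Prop :=
  (∀ m ≤ n, ∀ k, |y m k - Matrix.vecMul (cumProportion p y m) A k| ≤ e) ∧
    ∀ m ≤ n, ∀ k, |c m k - cumProportion p y m k| ≤ e

variable {H : Ω → Matrix (Fin d) (Fin d) ℝ}

theorem IsUrn.ae_exists_window (hU : IsUrn μ p Y₀ J D) (hadm : ∀ᵐ ω ∂μ, Admissible (H ω)) :
    ∀ᵐ ω ∂μ, ∀ K : ℕ, ∀ ε : ℝ, 0 < ε → ∃ η : ℝ, 0 < η ∧ ∃ n₀ : ℕ, ∀ n ≥ n₀,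
      Tracks p (H ω) (fun m => urn Y₀ J D m ω) (fun m => counts J m ω) (K * n) (η * n) →
      ∀ m, n ≤ m → m ≤ K * n → ∃ s ∈ eigenSimplex (H ω),
        dist ((m : ℝ)⁻¹ • urn Y₀ J D m ω) (lam (H ω) • s) ≤ ε ∧
        dist ((m : ℝ)⁻¹ • pos (urn Y₀ J D m ω)) (lam (H ω) • s) ≤ ε ∧
        dist (proportion p (urn Y₀ J D m ω)) s ≤ ε ∧
        dist ((m : ℝ)⁻¹ • counts J m ω) s ≤ ε := by
  filter_upwards [hadm] with ω hω K ε hε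
  obtain ⟨η, hη, n₀, h⟩ := exists_forall_window hU.prob hω K hε
  exact ⟨η, hη, n₀, fun n hn ht => h n hn _ _ ht.1 ht.2⟩

variable [IsProbabilityMeasure μ]

theorem IsUrn.windowDistTendsto (hU : IsUrn μ p Y₀ J D)
    (hM : MeanCondition μ Y₀ J D H)
    (hX : MartingaleCondition μ Y₀ J D) (T : ℝ) {x : ℕ → Ω → Fin d → ℝ}
    {S : Ω → Set (Fin d → ℝ)}
    (hx : ∀ m, AEMeasurable (fun ω => Metric.infNndist (x m ω) (S ω)) μ)
    (h : ∀ᵐ ω ∂μ, ∀ K : ℕ, ∀ ε : ℝ, 0 < ε → ∃ η : ℝ, 0 < η ∧ ∃ n₀ : ℕ, ∀ n ≥ n₀,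
      Tracks p (H ω) (fun m => urn Y₀ J D m ω) (fun m => counts J m ω) (K * n) (η * n) →
      ∀ m, n ≤ m → m ≤ K * n → ∃ s ∈ S ω, dist (x m ω) s ≤ ε) :
    WindowDistTendsto μ T x S := by
  -- This `K` is positive and satisfies `⌊n T⌋ ≤ K n`.
  refine hU.tendstoInMeasure_of_forall hM hX (K := ⌈T⌉₊ + 1) (Nat.succ_pos _)
    (fun n => (aemeasurable_finset_sup _ hx).aestronglyMeasurable) ?_
  filter_upwards [h] with ω hω ε hε
  obtain ⟨η, hη, n₀, h1⟩ := hω (⌈T⌉₊ + 1) ε hε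
  refine ⟨η, hη, n₀, fun n hn hy hc => ?_⟩
  rw [NNReal.dist_eq, NNReal.coe_zero, sub_zero, NNReal.abs_eq]
  suffices (Finset.Icc n ⌊(n : ℝ) * T⌋₊).sup (fun m => Metric.infNndist (x m ω) (S ω)) ≤
    NNReal.mk ε hε.le from this
  refine Finset.sup_le fun m hm => ?_
  obtain ⟨h2, h3⟩ := Finset.mem_Icc.1 hm
  have h4 : ⌊(n : ℝ) * T⌋₊ ≤ (⌈T⌉₊ + 1) * n := by
    refine Nat.floor_le_of_le ?_
    push_cast
    have := Nat.le_ceil T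
    have hn0 : (0 : ℝ) ≤ n := by positivity
    nlinarith
  obtain ⟨s, hs, hds⟩ := h1 n hn ⟨hy, hc⟩ m h2 (h3.trans h4)
  exact (Metric.infDist_le_dist_of_mem hs).trans hds

theorem IsUrn.windowDistTendsto_all (hU : IsUrn μ p Y₀ J D)
    (hH : ∀ q k, Measurable fun ω => H ω q k) (hadm : ∀ᵐ ω ∂μ, Admissible (H ω))
    (hM : MeanCondition μ Y₀ J D H) (hX : MartingaleCondition μ Y₀ J D) (T : ℝ) :
    WindowDistTendsto μ T (fun m ω => (m : ℝ)⁻¹ • urn Y₀ J D m ω)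
        (fun ω => scaledEigenSimplex (H ω)) ∧
      WindowDistTendsto μ T (fun m ω => (m : ℝ)⁻¹ • pos (urn Y₀ J D m ω))
        (fun ω => scaledEigenSimplex (H ω)) ∧
      WindowDistTendsto μ T (fun m ω => proportion p (urn Y₀ J D m ω))
        (fun ω => eigenSimplex (H ω)) ∧
      WindowDistTendsto μ T (fun m ω => (m : ℝ)⁻¹ • counts J m ω)
        (fun ω => eigenSimplex (H ω)) := by
  have hw := hU.ae_exists_window hadm
  have hy : ∀ m : ℕ, Measurable fun ω => (m : ℝ)⁻¹ • urn Y₀ J D m ω := fun m =>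
    (hU.measurable_urn m).const_smul (m : ℝ)⁻¹
  have hpos : ∀ m : ℕ, Measurable fun ω => (m : ℝ)⁻¹ • pos (urn Y₀ J D m ω) := fun m =>
    (measurable_pos.comp (hU.measurable_urn m)).const_smul (m : ℝ)⁻¹
  have hcounts : ∀ m : ℕ, Measurable fun ω => (m : ℝ)⁻¹ • counts J m ω := fun m =>
    (hU.measurable_counts m).const_smul (m : ℝ)⁻¹
  refine ⟨hU.windowDistTendsto hM hX T (fun m => (aemeasurable_infNndist_eigenSimplex hH hadm (hy m).aemeasurable).2) ?_,
    hU.windowDistTendsto hM hX T (fun m => (aemeasurable_infNndist_eigenSimplex hH hadm (hpos m).aemeasurable).2) ?_,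
    hU.windowDistTendsto hM hX T (fun m => (aemeasurable_infNndist_eigenSimplex hH hadm
      (hU.measurable_proportion_urn m).aemeasurable).1) ?_,
    hU.windowDistTendsto hM hX T (fun m => (aemeasurable_infNndist_eigenSimplex hH hadm (hcounts m).aemeasurable).1) ?_⟩
  all_goals
    filter_upwards [hw] with ω hω K ε hε
    obtain ⟨η, hη, n₀, h⟩ := hω K ε hε
    refine ⟨η, hη, n₀, fun n hn ht m h1 h2 => ?_⟩
    obtain ⟨s, hs, e1, e2, e3, e4⟩ := h n hn ht m h1 h2
  · exact ⟨_, ⟨s, hs, rfl⟩, e1⟩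
  · exact ⟨_, ⟨s, hs, rfl⟩, e2⟩
  · exact ⟨s, hs, e3⟩
  · exact ⟨s, hs, e4⟩

theorem IsUrn.tendstoInMeasure_all (hU : IsUrn μ p Y₀ J D)
    (hadm : ∀ᵐ ω ∂μ, Admissible (H ω)) (hM : MeanCondition μ Y₀ J D H)
    (hX : MartingaleCondition μ Y₀ J D) {v : Ω → Fin d → ℝ}
    (hv : ∀ᵐ ω ∂μ, eigenSimplex (H ω) = {v ω}) :
    TendstoInMeasure μ (fun (n : ℕ) ω => (n : ℝ)⁻¹ • urn Y₀ J D n ω) atTop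
        (fun ω => lam (H ω) • v ω) ∧
      TendstoInMeasure μ (fun (n : ℕ) ω => (n : ℝ)⁻¹ • pos (urn Y₀ J D n ω)) atTop
        (fun ω => lam (H ω) • v ω) ∧
      TendstoInMeasure μ (fun (n : ℕ) ω => proportion p (urn Y₀ J D n ω)) atTop v ∧
      TendstoInMeasure μ (fun (n : ℕ) ω => (n : ℝ)⁻¹ • counts J n ω) atTop v := by
  have hw := hU.ae_exists_window hadm
  have hy : ∀ m : ℕ, Measurable fun ω => (m : ℝ)⁻¹ • urn Y₀ J D m ω := fun m =>
    (hU.measurable_urn m).const_smul (m : ℝ)⁻¹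
  have hpos : ∀ m : ℕ, Measurable fun ω => (m : ℝ)⁻¹ • pos (urn Y₀ J D m ω) := fun m =>
    (measurable_pos.comp (hU.measurable_urn m)).const_smul (m : ℝ)⁻¹
  have hcounts : ∀ m : ℕ, Measurable fun ω => (m : ℝ)⁻¹ • counts J m ω := fun m =>
    (hU.measurable_counts m).const_smul (m : ℝ)⁻¹
  refine ⟨hU.tendstoInMeasure_of_forall hM hX one_pos
      (fun n => (hy n).aestronglyMeasurable) ?_,
    hU.tendstoInMeasure_of_forall hM hX one_pos
      (fun n => (hpos n).aestronglyMeasurable) ?_,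
    hU.tendstoInMeasure_of_forall hM hX one_pos
      (fun n => (hU.measurable_proportion_urn n).aestronglyMeasurable) ?_,
    hU.tendstoInMeasure_of_forall hM hX one_pos
      (fun n => (hcounts n).aestronglyMeasurable) ?_⟩
  all_goals
    filter_upwards [hw, hv] with ω hω hvω ε hε
    obtain ⟨η, hη, n₀, h⟩ := hω 1 ε hε
    refine ⟨η, hη, n₀, fun n hn h1 h2 => ?_⟩
    obtain ⟨s, hs, e1, e2, e3, e4⟩ := h n hn ⟨h1, h2⟩ n le_rfl (one_mul n).ge
    rw [hvω, Set.mem_singleton_iff] at hs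
    subst hs
  · exact e1
  · exact e2
  · exact e3
  · exact e4

/-- Measurability comes from the convergence itself: a pointwise choice `v₀` is the limit in measure
of the measurable selection proportions, hence almost everywhere equal to a measurable function.
`tendstoInMeasure_all` asks for no measurability of `v`, so there is no circularity. -/
theorem IsUrn.exists_limit (hU : IsUrn μ p Y₀ J D) (hadm : ∀ᵐ ω ∂μ, Admissible (H ω))
    (hM : MeanCondition μ Y₀ J D H) (hX : MartingaleCondition μ Y₀ J D)
    (hirr : ∀ᵐ ω ∂μ, ¬ Reducible (H ω)) :
    ∃ v : Ω → Fin d → ℝ, Measurable v ∧ ∀ᵐ ω ∂μ, eigenSimplex (H ω) = {v ω} := by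
  have h : ∀ ω, ∃ v : Fin d → ℝ, Admissible (H ω) → ¬ Reducible (H ω) →
      eigenSimplex (H ω) = {v} := by
    intro ω
    by_cases hω : Admissible (H ω) ∧ ¬ Reducible (H ω)
    · obtain ⟨v, hv⟩ := eigenSimplex_nonempty hU.prob hω.1
      exact ⟨v, fun h1 h2 => (eigenSimplex_subsingleton h1 h2).eq_singleton_of_mem hv⟩
    · exact ⟨0, fun h1 h2 => (hω ⟨h1, h2⟩).elim⟩
  choose v₀ hv₀ using h
  have hae : ∀ᵐ ω ∂μ, eigenSimplex (H ω) = {v₀ ω} := by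
    filter_upwards [hadm, hirr] with ω h1 h2 using hv₀ ω h1 h2
  have hmeas : AEMeasurable v₀ μ := TendstoInMeasure.aemeasurable
    (fun n => (hU.measurable_proportion_urn n).aemeasurable)
    (hU.tendstoInMeasure_all hadm hM hX hae).2.2.1
  refine ⟨hmeas.mk, hmeas.measurable_mk, ?_⟩
  filter_upwards [hae, hmeas.ae_eq_mk] with ω h1 h2
  rw [h1, h2]

end Limits

end FriedmanUrn

theorem theorem3p5 {d : ℕ} {Ω : Type*} [MeasurableSpace Ω] (μ : Measure Ω)
    [IsProbabilityMeasure μ] (p : Fin d → ℝ) (Y₀ : Ω → Fin d → ℝ) (J : ℕ → Ω → Fin d)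
    (D : ℕ → Ω → Matrix (Fin d) (Fin d) ℝ) (hU : FriedmanUrn.IsUrn μ p Y₀ J D) :
    -- convergence to the (random) set of scaled eigenvectors, and to a point if irreducible
    (∀ H : Ω → Matrix (Fin d) (Fin d) ℝ,
      (∀ q k, Measurable (fun ω => H ω q k)) →
      (∀ᵐ ω ∂μ, FriedmanUrn.Admissible (H ω)) →
      FriedmanUrn.MeanCondition μ Y₀ J D H →
      FriedmanUrn.MartingaleCondition μ Y₀ J D →
      (∀ᵐ ω ∂μ, (FriedmanUrn.eigenSimplex (H ω)).Nonempty) ∧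
      (∀ T : ℝ, 0 < T →
        FriedmanUrn.WindowDistTendsto μ T
          (fun m ω => (m : ℝ)⁻¹ • FriedmanUrn.urn Y₀ J D m ω)
          (fun ω => FriedmanUrn.scaledEigenSimplex (H ω)) ∧
        FriedmanUrn.WindowDistTendsto μ T
          (fun m ω => (m : ℝ)⁻¹ • FriedmanUrn.pos (FriedmanUrn.urn Y₀ J D m ω))
          (fun ω => FriedmanUrn.scaledEigenSimplex (H ω)) ∧
        FriedmanUrn.WindowDistTendsto μ T
          (fun m ω => FriedmanUrn.proportion p (FriedmanUrn.urn Y₀ J D m ω))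
          (fun ω => FriedmanUrn.eigenSimplex (H ω)) ∧
        FriedmanUrn.WindowDistTendsto μ T
          (fun m ω => (m : ℝ)⁻¹ • FriedmanUrn.counts J m ω)
          (fun ω => FriedmanUrn.eigenSimplex (H ω))) ∧
      ((∀ᵐ ω ∂μ, ¬ FriedmanUrn.Reducible (H ω)) →
        ∃ v : Ω → Fin d → ℝ, Measurable v ∧
          (∀ᵐ ω ∂μ, FriedmanUrn.eigenSimplex (H ω) = {v ω}) ∧
          TendstoInMeasure μ
            (fun (n : ℕ) ω => (n : ℝ)⁻¹ • FriedmanUrn.urn Y₀ J D n ω) atTop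
            (fun ω => FriedmanUrn.lam (H ω) • v ω) ∧
          TendstoInMeasure μ
            (fun (n : ℕ) ω => (n : ℝ)⁻¹ • FriedmanUrn.pos (FriedmanUrn.urn Y₀ J D n ω)) atTop
            (fun ω => FriedmanUrn.lam (H ω) • v ω) ∧
          TendstoInMeasure μ
            (fun (n : ℕ) ω => FriedmanUrn.proportion p (FriedmanUrn.urn Y₀ J D n ω)) atTop v ∧
          TendstoInMeasure μ
            (fun (n : ℕ) ω => (n : ℝ)⁻¹ • FriedmanUrn.counts J n ω) atTop v)) ∧
    -- sufficient conditions for the martingale condition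
    (FriedmanUrn.CondIndepDraws μ Y₀ J D →
      FriedmanUrn.MomentCondition μ Y₀ J D →
      FriedmanUrn.TailCondition μ Y₀ J D →
      FriedmanUrn.MartingaleCondition μ Y₀ J D) ∧
    (UniformIntegrable (fun (m : ℕ) ω => FriedmanUrn.matNorm (D (m + 1) ω)) 1 μ →
      FriedmanUrn.MomentCondition μ Y₀ J D ∧ FriedmanUrn.TailCondition μ Y₀ J D) ∧
    (∀ (H : Ω → Matrix (Fin d) (Fin d) ℝ) (c₀ : ℝ),
      (∀ q k, Measurable (fun ω => H ω q k)) →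
      (∀ m, 1 ≤ m → ∀ᵐ ω ∂μ, ∀ q k, -c₀ ≤ D m ω q k) →
      FriedmanUrn.MeanCondition μ Y₀ J D H →
      FriedmanUrn.MomentCondition μ Y₀ J D) := by
  refine ⟨fun H hH hadm hM hX => ⟨?_, fun T _ => hU.windowDistTendsto_all hH hadm hM hX T,
    fun hirr => ?_⟩, fun hI hM hT => hU.martingaleCondition hI hM hT,
    fun h => ⟨hU.momentCondition_of_uniformIntegrable h, hU.tailCondition_of_uniformIntegrable h⟩,
    fun H c₀ hH hc hM => hU.momentCondition_of_bddBelow hH hc hM⟩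
  · filter_upwards [hadm] with ω hω using FriedmanUrn.eigenSimplex_nonempty hU.prob hω
  · obtain ⟨v, hvm, hv⟩ := hU.exists_limit hadm hM hX hirr
    exact ⟨v, hvm, hv, hU.tendstoInMeasure_all hadm hM hX hv⟩
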